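/- **Setting.** Let $\vec e_1=(1,0)$, $\vec e_2=(0,1)$ and $B\subset\mathbb Z^2$. Given a path $w_0,\dots,w_t$ in $\mathbb Z^2$, a direction $\vec e\in\{\pm\vec e_1,\pm\vec e_2\}$ is *allowed* at time $t$ if no site $w_t+k\vec e$, $k>0$, belongs to $B\cup\{w_0,\dots,w_t\}$. Consider the process that starts at $(0,0)$ and, given its past, jumps at each step to a neighbour chosen uniformly among those lying in an allowed direction. For $B=\varnothing$ it is the *prudent walk*; for $B=\{(x,y):x\le 0,\ y\le 0\}$ it is the *corner-model walk* $\widehat\gamma$. **Excursions.** The trajectory of $\widehat\gamma$ is cut into excursions $j=0,1,2,\dots$ which are alternately vertical and horizontal; excursion $0$ is vertical if $\widehat\gamma_1=\vec e_1$ and horizontal if $\widehat\gamma_1=\vec e_2$. Let $i_j$ be the index of the vertical coordinate if excursion $j$ is vertical and of the horizontal one otherwise. Excursion $j$ takes place between the times $\tau_j$ and $\tau_{j+1}$, where $\tau_0=0$ and $\tau_{j+1}=\inf\{t>\tau_j:\widehat\gamma_t(i_j)>\widehat\gamma_{\tau_j}(i_j)\}-1$. Its depth is $m_j=\widehat\gamma_{\tau_j}(i_j)-\min_{\tau_j\le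 t\le\tau_{j+1}}\widehat\gamma_t(i_j)$. **Coupling.** Let $\sigma$ be uniform on $\{-1,1\}^2$ and independent of $\widehat\gamma$. A walk $\gamma$ with $\gamma_0=(0,0)$ is built by concatenating pieces of the excursions of $\widehat\gamma$, as follows. Keep track of a width and a height, both initially $0$, and of a pair of signs, initially $\sigma$. At excursion $j$, let $\ell_j$ be the current height if the excursion is vertical and the current width if it is horizontal. - If $m_j\le\ell_j$, keep the whole excursion. - If $m_j>\ell_j$, truncate it: keep it only up to the time just before $\widehat\gamma_{\tau_j}(i_j)-\widehat\gamma_t(i_j)$ first equals $\ell_j+1$. The kept steps, with their coordinates multiplied by the current signs, are appended to $\gamma$. The displacement of the kept piece in the coordinate other than $i_j$ is added to the width (vertical excursion) or to the height (horizontal excursion). Finally, if the excursion was truncated, the sign of coordinate $i_j$ is reversed. **Theorem.** The walk $\gamma$ is a prudent walk. Let $\mathcal Q_1$ be the event that $\gamma$ eventually settles in the first quadrant, i.e. that $\gamma_t\in\{(x,y):x\ge 0,\ y\ge 0\}$ for all sufficiently large $t$. Then $P(\mathcal Q_1)=1/4$ and, for every $\epsilon>0$, \[ \lim_{t\to\infty}P\Bigl(\sup_{0\le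 s\le t}\bigl\|\tfrac1t\widehat\gamma_s-\tfrac1t\gamma_s\bigr\|_2\ge\epsilon\Bigm|\mathcal Q_1\Bigr)=0 . \] Moreover, almost surely only finitely many excursions are truncated, and almost surely on $\mathcal Q_1$ one has $\sup_{t\ge0}\|\widehat\gamma_t-\gamma_t\|_2<\infty$. -/

import Mathlib

open MeasureTheory ProbabilityTheory Filter Topology
open scoped ENNReal

noncomputable section

namespace PrudentWalk

/-- The sites of the square lattice; coordinate `0` is horizontal, coordinate `1` is vertical. -/
abbrev Site : Type := Fin 2 → ℤ

/-- The unit vector along coordinate `i`. -/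
def unitVec (i : Fin 2) : Site := Pi.single i 1

/-- The four lattice directions. -/
def directions : Finset Site := {unitVec 0, -unitVec 0, unitVec 1, -unitVec 1}

open scoped Classical in
/-- The directions allowed at time `t` to a walk that has followed `w` up to time `t` in the presence
of the set `B` of forbidden sites: those in which one sees, from `w t`, neither a site of `B` nor a
site visited up to time `t`. -/
def allowedDirections (B : Set Site) (w : ℕ → Site) (t : ℕ) : Finset Site :=
  directions.filter fun e => ∀ k : ℕ, 0 < k → w t + k • e ∉ B ∪ w '' Set.Iic t

open scoped Classical in
/-- The process `X` starts at the origin and, given its past up to time `t`, jumps at time `t + 1`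
to a neighbour chosen uniformly among those lying in a direction allowed at time `t`. -/
structure IsUniformWalk {Ω : Type*} [MeasurableSpace Ω] (B : Set Site) (μ : Measure Ω)
    (X : ℕ → Ω → Site) : Prop where
  measurable : ∀ t, Measurable (X t)
  start : ∀ᵐ ω ∂μ, X 0 ω = 0
  step : ∀ (t : ℕ) (w : ℕ → Site),
    μ {ω | ∀ s ≤ t + 1, X s ω = w s} =
      (if w (t + 1) - w t ∈ allowedDirections B w t
        then ((allowedDirections B w t).card : ℝ≥0∞)⁻¹ else 0) *
      μ {ω | ∀ s ≤ t, X s ω = w s}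

/-- The (kinetic) prudent walk. -/
def IsPrudentWalk {Ω : Type*} [MeasurableSpace Ω] (μ : Measure Ω) (X : ℕ → Ω → Site) : Prop :=
  IsUniformWalk ∅ μ X

/-- The infinite rectangle `{x ≤ 0, y ≤ 0}`. -/
def southWest : Set Site := {x | ∀ i, x i ≤ 0}

/-- The walk of the corner model. -/
def IsCornerWalk {Ω : Type*} [MeasurableSpace Ω] (μ : Measure Ω) (X : ℕ → Ω → Site) : Prop :=
  IsUniformWalk southWest μ X

/-! ### Excursions of a trajectory `w` of the corner model

The excursions are numbered `0, 1, 2, …` and are alternately vertical and horizontal. The first one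
is vertical if the first step of `w` is horizontal, and horizontal otherwise. -/

/-- The coordinate of the side along which the `j`-th excursion takes place: `1` for a vertical
excursion, `0` for a horizontal one. (In `Fin 2`, `i + 1` is the coordinate other than `i`.) -/
def side (w : ℕ → Site) : ℕ → Fin 2
  | 0 => if w 1 = unitVec 0 then 1 else 0
  | j + 1 => side w j + 1

/-- The time at which the `j`-th excursion starts. The `j`-th excursion ends, and the next one
starts, just before the walk leaves its present extremal level in the coordinate `side w j`. -/
def startTime (w : ℕ → Site) : ℕ → ℕ
  | 0 => 0
  | j + 1 => sInf {t | startTime w j < t ∧ w (startTime w j) (side w j) < w t (side w j)} - 1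

/-- How far, at time `t`, the walk is behind the corner from which the `j`-th excursion started,
along the side of that excursion. -/
def depth (w : ℕ → Site) (j t : ℕ) : ℤ := w (startTime w j) (side w j) - w t (side w j)

/-- The maximal depth of the `j`-th excursion is larger than `l`. -/
def Exceeds (w : ℕ → Site) (j : ℕ) (l : ℤ) : Prop :=
  ∃ t, startTime w j ≤ t ∧ t ≤ startTime w (j + 1) ∧ l < depth w j t

open scoped Classical in
/-- The time up to which the `j`-th excursion is kept if the side along which it takes place has
length `l`: all of it if its depth does not exceed `l`; otherwise it is truncated when the walk
steps to depth `l + 1`. That step itself leaves the rectangle; it is the first step of the next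
excursion of the prudent walk, so it is not counted here. -/
def keptEnd (w : ℕ → Site) (j : ℕ) (l : ℤ) : ℕ :=
  if Exceeds w j l then sInf {t | startTime w j ≤ t ∧ depth w j t = l + 1} - 1
  else startTime w (j + 1)

/-! ### The prudent walk constructed from `w` -/

/-- The width (coordinate `0`) and the height (coordinate `1`) of the bounding rectangle of the
prudent walk at the start of its `j`-th excursion, in lattice steps: each excursion increases the
extent perpendicular to its side by the displacement of its kept part. -/
def extent (w : ℕ → Site) : ℕ → Fin 2 → ℤ
  | 0 => 0
  | j + 1 => Function.update (extent w j) (side w j + 1)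
      (extent w j (side w j + 1) +
        (w (keptEnd w j (extent w j (side w j))) (side w j + 1) -
          w (startTime w j) (side w j + 1)))

/-- The `j`-th excursion does not fit into the bounding rectangle of the prudent walk. -/
def IsTruncated (w : ℕ → Site) (j : ℕ) : Prop := Exceeds w j (extent w j (side w j))

/-- The number of steps of the `j`-th excursion of the prudent walk. -/
def keptLength (w : ℕ → Site) (j : ℕ) : ℕ :=
  keptEnd w j (extent w j (side w j)) - startTime w j

/-- The time at which the prudent walk starts its `j`-th excursion. -/
def clock (w : ℕ → Site) (j : ℕ) : ℕ := ∑ i ∈ Finset.range j, keptLength w i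

open scoped Classical in
/-- The signs by which the two coordinates of the `j`-th excursion are reflected. Initially they are
`s`; each truncated excursion, after which the prudent walk is at the other end of the side, changes
the sign of the coordinate of that side. -/
def reflection (w : ℕ → Site) (s : Fin 2 → ℤˣ) : ℕ → Fin 2 → ℤˣ
  | 0 => s
  | j + 1 =>
      if IsTruncated w j then
        Function.update (reflection w s j) (side w j) (-reflection w s j (side w j))
      else reflection w s j

/-- The excursion to which the step of the prudent walk from time `n` to time `n + 1` belongs. -/
def excursionIndex (w : ℕ → Site) (n : ℕ) : ℕ := Nat.findGreatest (fun j => clock w j ≤ n) n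

/-- The time `t` such that the step of the prudent walk from time `n` to time `n + 1` is a reflected
copy of the step of `w` from time `t` to time `t + 1`. -/
def sourceTime (w : ℕ → Site) (n : ℕ) : ℕ :=
  startTime w (excursionIndex w n) + (n - clock w (excursionIndex w n))

/-- The concatenation of the kept parts of the excursions of `w`, reflected appropriately. -/
def coupledPath (w : ℕ → Site) (s : Fin 2 → ℤˣ) (t : ℕ) : Site := fun i =>
  ∑ n ∈ Finset.range t, (reflection w s (excursionIndex w n) i : ℤ) *
    (w (sourceTime w n + 1) i - w (sourceTime w n) i)

/-- The coupled walk, built from the process `X` and the initial signs `σ`. -/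
def coupledWalk {Ω : Type*} (X : ℕ → Ω → Site) (σ : Ω → Fin 2 → ℤˣ) (t : ℕ) (ω : Ω) : Site :=
  coupledPath (fun n => X n ω) (σ ω) t

/-- The event that `X` eventually settles in the first quadrant. -/
def settlesFirstQuadrant {Ω : Type*} (X : ℕ → Ω → Site) : Set Ω :=
  {ω | ∃ t₀ : ℕ, ∀ t ≥ t₀, ∀ i, 0 ≤ X t ω i}

/-- A lattice site as a point of the Euclidean plane. -/
def toPlane (x : Site) : EuclideanSpace ℝ (Fin 2) := WithLp.toLp 2 fun i => (x i : ℝ)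

end PrudentWalk

end

open PrudentWalk

/-! The coupling rests on a common local rule. A walk on a side of the region it has explored may
step outward, or along the side without turning back, and nowhere else: the allowed steps depend
only on the side, the outward direction and the last step (`OnSide.mem_allowed_iff`). This holds for
the corner walk at every positive time (`InExcursion`) and for the coupled path with respect to its
bounding rectangle (`Good.onSide_of_fills`), so a reflected excursion that fits into the side is as
good as an excursion of the prudent walk. If the corner walk is about to reach a depth one more than
the length of the side, the coupled path stands at the opposite corner and the same step takes it
out of the rectangle. Since every excursion begins with one outward step, this forced step is also
the first step of the next excursion with the sign reversed, so the remainder of the truncated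
excursion can be skipped (`Good.coupledPath_next`). The correspondence between the two clocks is
determined by the past (`Corresponds.agree`), and the transition probabilities carry over
(`measure_coupledPath_step`). The independent signs turn a uniform choice between two first steps
into one among four.

Everything else follows once almost surely only finitely many excursions are truncated, that is,
once the sides of the rectangle outgrow the depths (`Tame`). An excursion has depth at least `K`
with probability at most `2 / (K + 3)`, whereas the generating function of its outward displacement
equals `1 - 2 * δ` at a point within order `δ ^ 2` of `1`, the signature of a tail of order `n ^
(-1/2)`. Heuristically, `N` excursions thus have depths of order at most `N` and total displacement
of order `N ^ 2`; the proof separates the two at the scale `N ^ (3/2)`, along `N = n ^ 4`.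

No independence of excursions is established. Both estimates come from explicit superharmonic
functions of the stage of one excursion (`IsPotential`). Multiplying final values of completed
excursions, the current value and initial values of later excursions gives a supermartingale
(`potential_average`), and Markov's inequality yields `measure_le_of_potential`. This also shows
that excursions are finite (`ae_exc_succ`). Truncated excursions contribute only part of their
displacement, so the lower bound for the sides counts only shallow excursions: after `2 * N`
excursions both sides are at least `N`, and an excursion of depth at most `N` is kept whole
(`Good.sum_shallowDisp_le`). Borel–Cantelli then gives `ae_tame`.

After the last truncation the coupled path is a fixed reflection of the corner path, up to a shift
in time and a translation (`Good.exists_shift`). Both coordinates of the corner path tend to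
infinity, so the coupled path settles in the first quadrant exactly if the final reflection is
trivial. For each corner path exactly one of the four initial sign pairs achieves this, whence the
probability `1/4`. In that case the two paths stay at bounded distance, which rescaling sends to
zero. -/

namespace PrudentWalk

/-! ### One-step transitions of a uniform walk -/

/-- Two trajectories agree up to time `u`. -/
def Agree (u : ℕ) (x y : ℕ → Site) : Prop := ∀ s ≤ u, x s = y s

theorem Agree.symm {u : ℕ} {x y : ℕ → Site} (h : Agree u x y) : Agree u y x :=
  fun s hs => (h s hs).symm

theorem Agree.mono {u v : ℕ} {x y : ℕ → Site} (h : Agree u x y) (hv : v ≤ u) : Agree v x y :=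
  fun s hs => h s (hs.trans hv)

/-- The trajectory `x` continued, after time `u`, by a step `e`. -/
def extendPath (x : ℕ → Site) (u : ℕ) (e : Site) : ℕ → Site :=
  Function.update x (u + 1) (x u + e)

theorem extendPath_of_le (x : ℕ → Site) {u s : ℕ} (e : Site) (h : s ≤ u) :
    extendPath x u e s = x s := by
  simp [extendPath, Function.update_of_ne (show s ≠ u + 1 by omega)]

theorem agree_extendPath (x : ℕ → Site) (u : ℕ) (e : Site) : Agree u (extendPath x u e) x :=
  fun _ hs => extendPath_of_le x e hs

theorem extendPath_succ (x : ℕ → Site) (u : ℕ) (e : Site) :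
    extendPath x u e (u + 1) = x u + e := by simp [extendPath]

theorem Agree.allowedDirections_eq {B : Set Site} {u : ℕ} {x y : ℕ → Site} (h : Agree u x y) :
    allowedDirections B x u = allowedDirections B y u := by
  have him : x '' Set.Iic u = y '' Set.Iic u := Set.image_congr fun s hs => h s hs
  unfold allowedDirections
  rw [him, h u le_rfl]

/-- The trajectory `x` starts at the origin and makes only allowed steps up to time `u`. -/
def ValidUpTo (B : Set Site) (x : ℕ → Site) (u : ℕ) : Prop :=
  x 0 = 0 ∧ ∀ t < u, x (t + 1) - x t ∈ allowedDirections B x t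

theorem ValidUpTo.mono {B : Set Site} {x : ℕ → Site} {u v : ℕ} (h : ValidUpTo B x u)
    (hv : v ≤ u) : ValidUpTo B x v := ⟨h.1, fun t ht => h.2 t (ht.trans_le hv)⟩

theorem Agree.validUpTo_iff {B : Set Site} {u : ℕ} {x y : ℕ → Site} (hxy : Agree u x y) :
    ValidUpTo B x u ↔ ValidUpTo B y u := by
  unfold ValidUpTo
  rw [hxy 0 (Nat.zero_le _)]
  refine and_congr_right fun _ => forall₂_congr fun t ht => ?_
  rw [hxy _ (by omega), hxy _ (by omega), (hxy.mono (by omega)).allowedDirections_eq]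

variable {Ω : Type*} {B : Set Site} {X : ℕ → Ω → Site}

/-- The trajectory of the process `X`. -/
def trajectory (X : ℕ → Ω → Site) (ω : Ω) : ℕ → Site := fun t => X t ω

/-- The initial piece of the trajectory of `X`. -/
def initialPiece (X : ℕ → Ω → Site) (u : ℕ) (ω : Ω) : Fin (u + 1) → Site := fun s => X s ω

theorem initialPiece_eq_iff {u : ℕ} {ω ω' : Ω} :
    initialPiece X u ω = initialPiece X u ω' ↔ Agree u (trajectory X ω) (trajectory X ω') := by
  constructor
  · intro h s hs
    exact congrFun h ⟨s, by omega⟩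
  · intro h
    funext s
    exact h s (by omega)

/-- A finite path, continued by a constant path. -/
def pieceToPath {u : ℕ} (p : Fin (u + 1) → Site) : ℕ → Site :=
  fun s => p ⟨min s u, by omega⟩

theorem agree_pieceToPath (u : ℕ) (ω : Ω) :
    Agree u (pieceToPath (initialPiece X u ω)) (trajectory X ω) := by
  intro s hs
  simp [pieceToPath, initialPiece, trajectory, min_eq_left hs]

theorem initialPiece_eq_piece_iff {u : ℕ} {p : Fin (u + 1) → Site} {ω : Ω} :
    initialPiece X u ω = p ↔ ∀ s ≤ u, X s ω = pieceToPath p s := by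
  constructor
  · rintro rfl s hs
    exact (agree_pieceToPath u ω s hs).symm
  · intro h
    funext s
    have := h s (by omega)
    simpa [pieceToPath, initialPiece, min_eq_left (show (s : ℕ) ≤ u by omega)] using this

variable [MeasurableSpace Ω] {μ : Measure Ω}

theorem measurable_initialPiece (hX : ∀ t, Measurable (X t)) (u : ℕ) :
    Measurable (initialPiece X u) :=
  measurable_pi_lambda _ fun s => hX s

/-- The set `S` need not be measurable: additivity over the countably many measurable fibres of `R`
is applied to `μ.restrict S`. -/
theorem measure_eq_tsum_fiber {ι : Type*} [Countable ι] [MeasurableSpace ι]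
    [MeasurableSingletonClass ι] {R : Ω → ι} (hR : Measurable R) (S : Set Ω) :
    μ S = ∑' p, μ (R ⁻¹' {p} ∩ S) := by
  have h := tsum_measure_preimage_singleton (μ := μ.restrict S) (Set.to_countable Set.univ)
    (f := R) (fun y _ => hR (measurableSet_singleton y))
  simp only [Set.preimage_univ, Measure.restrict_apply_univ] at h
  rw [← h, tsum_univ (fun p => (μ.restrict S) (R ⁻¹' {p}))]
  exact tsum_congr fun p => Measure.restrict_apply (hR (measurableSet_singleton p))

/-- One-step transition probability, for an event that is determined by the trajectory up to time
`u` and a step that is a function of this trajectory. -/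
theorem IsUniformWalk.measure_step (h : IsUniformWalk B μ X) (u : ℕ) {G A : Set (ℕ → Site)}
    (hG : ∀ᵐ ω ∂μ, trajectory X ω ∈ G)
    (hA : ∀ x ∈ A, x ∈ G → ∀ y ∈ G, Agree u x y → y ∈ A) {φ : (ℕ → Site) → Site}
    (hφ : ∀ x ∈ A, x ∈ G → ∀ y ∈ G, Agree u x y → φ x = φ y) {q : ℝ≥0∞}
    (hq : ∀ x ∈ A, x ∈ G → (if φ x ∈ allowedDirections B x u
      then ((allowedDirections B x u).card : ℝ≥0∞)⁻¹ else 0) = q) :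
    μ {ω | trajectory X ω ∈ A ∧ X (u + 1) ω - X u ω = φ (trajectory X ω)} =
      q * μ {ω | trajectory X ω ∈ A} := by
  have hR := measurable_initialPiece h.measurable u
  rw [measure_eq_tsum_fiber hR, measure_eq_tsum_fiber hR {ω | trajectory X ω ∈ A},
    ← ENNReal.tsum_mul_left]
  refine tsum_congr fun p => ?_
  -- A fibre containing one path of `A ∩ G` has almost all its paths in `A`, with the same
  -- prescribed step, so both events become cylinders and the defining transition rule applies. Any
  -- other fibre meets `A` in a null set.
  by_cases hp : ∃ ω, initialPiece X u ω = p ∧ trajectory X ω ∈ A ∧ trajectory X ω ∈ G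
  · obtain ⟨ω₀, rfl, hA₀, hG₀⟩ := hp
    set x := trajectory X ω₀ with hx
    have key : ∀ ω, initialPiece X u ω = initialPiece X u ω₀ → trajectory X ω ∈ G →
        trajectory X ω ∈ A ∧ φ (trajectory X ω) = φ x := by
      intro ω hω hωG
      have hag := (initialPiece_eq_iff.1 hω).symm
      exact ⟨hA x hA₀ hG₀ _ hωG hag, (hφ x hA₀ hG₀ _ hωG hag).symm⟩
    have e1 : μ (initialPiece X u ⁻¹' {initialPiece X u ω₀} ∩ {ω | trajectory X ω ∈ A}) =
        μ {ω | ∀ s ≤ u, X s ω = extendPath x u (φ x) s} := by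
      refine measure_congr ?_
      filter_upwards [hG] with ω hω
      refine propext ⟨fun hh s hs => ?_, fun hh => ?_⟩
      · rw [extendPath_of_le _ _ hs]
        exact initialPiece_eq_iff.1 hh.1 s hs
      · have : initialPiece X u ω = initialPiece X u ω₀ := by
          refine initialPiece_eq_iff.2 fun s hs => ?_
          have := hh s hs
          rw [extendPath_of_le _ _ hs] at this
          exact this
        exact ⟨this, (key ω this hω).1⟩
    have e2 : μ (initialPiece X u ⁻¹' {initialPiece X u ω₀} ∩
          {ω | trajectory X ω ∈ A ∧ X (u + 1) ω - X u ω = φ (trajectory X ω)}) =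
        μ {ω | ∀ s ≤ u + 1, X s ω = extendPath x u (φ x) s} := by
      refine measure_congr ?_
      filter_upwards [hG] with ω hω
      refine propext ⟨fun hh s hs => ?_, fun hh => ?_⟩
      · have hag := initialPiece_eq_iff.1 hh.1
        rcases Nat.lt_or_ge u s with hs' | hs'
        · obtain rfl : s = u + 1 := by omega
          have h1 := hh.2.2
          rw [(key ω hh.1 hω).2] at h1
          rw [extendPath_succ, ← h1]
          have h2 : X u ω = x u := hag u le_rfl
          rw [h2]; abel
        · rw [extendPath_of_le _ _ hs']
          exact hag s hs'
      · have : initialPiece X u ω = initialPiece X u ω₀ := by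
          refine initialPiece_eq_iff.2 fun s hs => ?_
          have := hh s (by omega)
          rw [extendPath_of_le _ _ hs] at this
          exact this
        refine ⟨this, (key ω this hω).1, ?_⟩
        rw [(key ω this hω).2, hh (u + 1) le_rfl, hh u (by omega), extendPath_succ,
          extendPath_of_le _ _ le_rfl]
        abel
    rw [e1, e2, h.step u, (agree_extendPath x u (φ x)).allowedDirections_eq, extendPath_succ,
      extendPath_of_le _ _ le_rfl, add_sub_cancel_left, hq x hA₀ hG₀]
  · have hz : ∀ S : Set Ω, (∀ ω ∈ S, trajectory X ω ∈ A) →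
        μ (initialPiece X u ⁻¹' {p} ∩ S) = 0 := by
      intro S hS
      refine measure_mono_null (t := {ω | ¬ trajectory X ω ∈ G}) ?_ hG
      rintro ω ⟨h1, h2⟩ h3
      exact hp ⟨ω, h1, hS ω h2, h3⟩
    rw [hz {ω | trajectory X ω ∈ A} fun ω hω => hω, mul_zero]
    exact hz _ fun ω hω => hω.1

/-- Almost surely, all steps of a uniform walk are allowed. -/
theorem IsUniformWalk.ae_step_mem (h : IsUniformWalk B μ X) (t : ℕ) :
    ∀ᵐ ω ∂μ, X (t + 1) ω - X t ω ∈ allowedDirections B (trajectory X ω) t := by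
  have key : ∀ e : Site, ∀ᵐ ω ∂μ, X (t + 1) ω - X t ω = e →
      e ∈ allowedDirections B (trajectory X ω) t := by
    intro e
    -- Restricting to paths for which `e` is forbidden makes the transition probability zero;
    -- countably many values of `e` are then combined.
    have := h.measure_step t (G := Set.univ) (A := {x | e ∉ allowedDirections B x t})
      (φ := fun _ => e) (q := 0) (by simp)
      (fun x hx _ y _ hxy => by
        simp only [Set.mem_ofPred_eq] at hx ⊢
        rwa [← hxy.allowedDirections_eq]) (fun _ _ _ _ _ _ => rfl)
      (fun x hx _ => if_neg hx)
    rw [zero_mul] at this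
    filter_upwards [measure_eq_zero_iff_ae_notMem.1 this] with ω hω he
    by_contra hne
    exact hω ⟨hne, he⟩
  filter_upwards [ae_all_iff.2 key] with ω hω
  exact hω _ rfl

theorem IsUniformWalk.ae_valid (h : IsUniformWalk B μ X) :
    ∀ᵐ ω ∂μ, ∀ u, ValidUpTo B (trajectory X ω) u := by
  filter_upwards [h.start, ae_all_iff.2 h.ae_step_mem] with ω h0 h1 u
  exact ⟨h0, fun t _ => h1 t⟩

theorem lintegral_restrict_eq_tsum {ι : Type*} [Countable ι] [MeasurableSpace ι]
    [MeasurableSingletonClass ι] {R : Ω → ι} (hR : Measurable R) (S : Set Ω) (F : ι → ℝ≥0∞) :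
    ∫⁻ ω in S, F (R ω) ∂μ = ∑' p, F p * μ (R ⁻¹' {p} ∩ S) := by
  rw [← lintegral_map (f := F) Measurable.of_discrete hR, lintegral_countable']
  refine tsum_congr fun p => ?_
  rw [Measure.map_apply hR (measurableSet_singleton p),
    Measure.restrict_apply (hR (measurableSet_singleton p))]

theorem directions_finite_allowed {x : ℕ → Site} {t : ℕ} {e : Site}
    (he : e ∈ allowedDirections B x t) : e ∈ directions := by
  classical
  simp only [allowedDirections, Finset.mem_filter] at he
  exact he.1

/-- If `V'` averaged over the allowed steps is at most `V`, its expectation does not exceed that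
of `V`. -/
theorem IsUniformWalk.lintegral_le (h : IsUniformWalk B μ X) (u : ℕ)
    {V V' : (ℕ → Site) → ℝ≥0∞}
    (hV'a : ∀ x y, Agree (u + 1) x y → V' x = V' y)
    (hle : ∀ x, ValidUpTo B x u → ∑ e ∈ allowedDirections B x u, V' (extendPath x u e) ≤
      (allowedDirections B x u).card * V x) :
    ∫⁻ ω, V' (trajectory X ω) ∂μ ≤ ∫⁻ ω, V (trajectory X ω) ∂μ := by
  classical
  have hR := measurable_initialPiece h.measurable u
  have hext : ∀ (e : Site) ω, V' (extendPath (trajectory X ω) u e) =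
      V' (extendPath (pieceToPath (initialPiece X u ω)) u e) := by
    intro e ω
    refine hV'a _ _ fun s hs => ?_
    have hag := agree_pieceToPath (X := X) u ω
    rcases Nat.lt_or_ge u s with hs' | hs'
    · obtain rfl : s = u + 1 := by omega
      rw [extendPath_succ, extendPath_succ, hag u le_rfl]
    · rw [extendPath_of_le _ _ hs', extendPath_of_le _ _ hs', hag s hs']
  let c : Site → (ℕ → Site) → ℝ≥0∞ := fun e x => if e ∈ allowedDirections B x u
      then ((allowedDirections B x u).card : ℝ≥0∞)⁻¹ else 0
  have hc : ∀ (e : Site) ω, c e (trajectory X ω) = c e (pieceToPath (initialPiece X u ω)) := by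
    intro e ω
    simp only [c, (agree_pieceToPath (X := X) u ω).allowedDirections_eq]
  have hmeas : ∀ F : (Fin (u + 1) → Site) → ℝ≥0∞,
      Measurable fun ω => F (initialPiece X u ω) :=
    fun F => (Measurable.of_discrete (f := F)).comp hR
  have hS : ∀ e : Site, MeasurableSet {ω | X (u + 1) ω - X u ω = e} := fun e =>
    measurableSet_eq_fun ((h.measurable _).sub (h.measurable _)) measurable_const
  -- The indicator of the step `e` is replaced by its conditional probability, initial piece by
  -- initial piece.
  have hstep : ∀ e : Site, ∫⁻ ω in {ω | X (u + 1) ω - X u ω = e},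
      V' (extendPath (trajectory X ω) u e) ∂μ =
      ∫⁻ ω, c e (trajectory X ω) * V' (extendPath (trajectory X ω) u e) ∂μ := by
    intro e
    simp only [hext, hc]
    rw [lintegral_restrict_eq_tsum hR _ fun p => V' (extendPath (pieceToPath p) u e),
      ← setLIntegral_univ,
      lintegral_restrict_eq_tsum hR _ fun p => c e (pieceToPath p) *
        V' (extendPath (pieceToPath p) u e)]
    refine tsum_congr fun p => ?_
    have := h.measure_step u (G := Set.univ) (A := {x | Agree u x (pieceToPath p)})
      (φ := fun _ => e) (q := c e (pieceToPath p)) (by simp)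
      (fun x hx _ y _ hxy s hs => by rw [← hxy s hs, hx s hs]) (fun _ _ _ _ _ _ => rfl)
      (fun x (hx : Agree _ _ _) _ => by simp only [c, hx.allowedDirections_eq])
    have e1 : initialPiece X u ⁻¹' {p} = {ω | trajectory X ω ∈ {x | Agree u x (pieceToPath p)}} := by
      ext ω
      simp only [Set.mem_preimage, Set.mem_singleton_iff, initialPiece_eq_piece_iff]
      rfl
    rw [Set.inter_univ, e1, mul_right_comm, mul_comm (c _ _ * _), ← this]
    rfl
  have hae : ∫⁻ ω, V' (trajectory X ω) ∂μ = ∑ e ∈ directions, ∫⁻ ω in {ω | X (u + 1) ω - X u ω = e},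
      V' (extendPath (trajectory X ω) u e) ∂μ := by
    simp_rw [← lintegral_indicator (hS _)]
    rw [← lintegral_finsetSum]
    · refine lintegral_congr_ae ?_
      filter_upwards [h.ae_step_mem u] with ω hω
      rw [Finset.sum_eq_single_of_mem _ (directions_finite_allowed hω)]
      · rw [Set.indicator_of_mem (by simp)]
        refine hV'a _ _ fun s hs => ?_
        rcases Nat.lt_or_ge u s with hs' | hs'
        · obtain rfl : s = u + 1 := by omega
          rw [extendPath_succ]; simp [trajectory]
        · rw [extendPath_of_le _ _ hs']
      · intro e _ he
        exact Set.indicator_of_notMem (fun hh => he hh.symm) _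
    · intro e _
      refine Measurable.indicator ?_ (hS e)
      simp only [hext]
      exact hmeas fun p => V' (extendPath (pieceToPath p) u e)
  rw [hae, Finset.sum_congr rfl fun e _ => hstep e, ← lintegral_finsetSum]
  · refine lintegral_mono_ae ?_
    filter_upwards [h.ae_valid] with ω hω
    have hle' := hle _ (hω u)
    set x := trajectory X ω
    calc ∑ e ∈ directions, c e x * V' (extendPath x u e)
        = ((allowedDirections B x u).card : ℝ≥0∞)⁻¹ *
            ∑ e ∈ allowedDirections B x u, V' (extendPath x u e) := by
          have hsub : allowedDirections B x u ⊆ directions := fun e he =>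
            directions_finite_allowed he
          rw [← Finset.sum_subset hsub, Finset.mul_sum]
          · refine Finset.sum_congr rfl fun e he => ?_
            simp only [c, if_pos he]
          · intro e _ he
            simp only [c, if_neg he, zero_mul]
      _ ≤ ((allowedDirections B x u).card : ℝ≥0∞)⁻¹ *
            ((allowedDirections B x u).card * V x) := by gcongr
      -- The inequality `a⁻¹ * a ≤ 1` in `ℝ≥0∞` also covers an empty set of allowed directions,
      -- whose nonemptiness is therefore not needed.
      _ ≤ V x := by
          rw [← mul_assoc]
          exact mul_le_of_le_one_left zero_le (ENNReal.inv_mul_le_one _)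
  · intro e _
    simp only [hext, hc]
    exact hmeas fun p => c e (pieceToPath p) * V' (extendPath (pieceToPath p) u e)

end PrudentWalk

namespace PrudentWalk

/-! ### Allowed directions of a walk on the side of its bounding rectangle -/

theorem fin_two_add (i : Fin 2) : i + 1 + 1 = i := by fin_cases i <;> rfl

theorem fin_two_ne (i : Fin 2) : i + 1 ≠ i := by fin_cases i <;> decide

theorem fin_two_eq_or (i k : Fin 2) : k = i ∨ k = i + 1 := by
  fin_cases i <;> fin_cases k <;> decide

theorem site_ext (i : Fin 2) {x y : Site} (h : x i = y i) (h' : x (i + 1) = y (i + 1)) :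
    x = y := by
  funext k
  rcases fin_two_eq_or i k with rfl | rfl
  exacts [h, h']

theorem mem_directions_iff (i : Fin 2) {e : Site} :
    e ∈ directions ↔ (e i = 0 ∧ (e (i + 1) = 1 ∨ e (i + 1) = -1)) ∨
      (e (i + 1) = 0 ∧ (e i = 1 ∨ e i = -1)) := by
  have key : e ∈ directions ↔ (e 0 = 0 ∧ (e 1 = 1 ∨ e 1 = -1)) ∨
      (e 1 = 0 ∧ (e 0 = 1 ∨ e 0 = -1)) := by
    simp only [directions, unitVec, Finset.mem_insert, Finset.mem_singleton, funext_iff,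
      Fin.forall_fin_two, Pi.neg_apply, Pi.single_apply]
    simp
    tauto
  rw [key]
  fin_cases i
  · rfl
  · exact or_comm

theorem coord_unit {r : ℤ} (hr : r = 1 ∨ r = -1) : r * r = 1 := by
  rcases hr with rfl | rfl <;> rfl

theorem add_nsmul_coord (x e : Site) (k : ℕ) (i : Fin 2) : (x + k • e) i = x i + k * e i := by
  simp [nsmul_eq_mul]

/-- The sites that a walk avoids: those of `B` and those visited up to time `n`. -/
def occupied (B : Set Site) (w : ℕ → Site) (n : ℕ) : Set Site := B ∪ w '' Set.Iic n

theorem mem_allowedDirections {B : Set Site} {w : ℕ → Site} {n : ℕ} {e : Site} :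
    e ∈ allowedDirections B w n ↔
      e ∈ directions ∧ ∀ k : ℕ, 0 < k → w n + k • e ∉ occupied B w n := by
  classical
  simp only [allowedDirections, Finset.mem_filter, occupied]

theorem occupied_succ (B : Set Site) (w : ℕ → Site) (n : ℕ) :
    occupied B w (n + 1) = insert (w (n + 1)) (occupied B w n) := by
  have : Set.Iic (n + 1) = insert (n + 1) (Set.Iic n) := by
    ext k; simp only [Set.mem_Iic, Set.mem_insert_iff]; omega
  rw [occupied, this, Set.image_insert_eq, Set.union_insert, occupied]

theorem self_mem_occupied (B : Set Site) (w : ℕ → Site) (n : ℕ) : w n ∈ occupied B w n :=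
  Or.inr ⟨n, Set.mem_Iic.2 le_rfl, rfl⟩

/-- The occupied sites lie in the rectangle `R 0 × R 1`, and each row and each column of that
rectangle contains one of them. -/
structure Fills (B : Set Site) (w : ℕ → Site) (n : ℕ) (R : Fin 2 → Set ℤ) : Prop where
  mem : ∀ x ∈ occupied B w n, ∀ k, x k ∈ R k
  exists_mem : ∀ k, ∀ v ∈ R k, ∃ x ∈ occupied B w n, x k = v

/-- The walk is on the side of the rectangle along coordinate `i`, with outward direction `r` in
the other coordinate; its last step was outward if `c = 0`, and `c` along the side otherwise. -/
structure OnSide (B : Set Site) (w : ℕ → Site) (n : ℕ) (R : Fin 2 → Set ℤ) (i : Fin 2)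
    (r c : ℤ) : Prop extends Fills B w n R where
  outer : ∀ x ∈ occupied B w n, r * x (i + 1) ≤ r * w n (i + 1)
  inner : ∀ v ∈ R i, ∃ x ∈ occupied B w n, x i = v ∧ r * x (i + 1) < r * w n (i + 1)
  column : ∀ x ∈ occupied B w n, x (i + 1) = w n (i + 1) →
    (c = 0 → x i = w n i) ∧ c * x i ≤ c * w n i
  back : c ≠ 0 → ∃ x ∈ occupied B w n, x (i + 1) = w n (i + 1) ∧ x i = w n i - c

variable {B : Set Site} {w : ℕ → Site} {n : ℕ} {R : Fin 2 → Set ℤ} {i : Fin 2} {r c : ℤ}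

/-- After an outward step the new site is strictly outermost and alone in its row, so the memory of
the last step is erased. Only extremality of the current position is assumed, so that the lemma also
opens an excursion from a corner. -/
theorem Fills.outward (h : Fills B w n R) (hr : r = 1 ∨ r = -1)
    (hout : ∀ x ∈ occupied B w n, r * x (i + 1) ≤ r * w n (i + 1))
    (h1 : w (n + 1) i = w n i) (h2 : w (n + 1) (i + 1) = w n (i + 1) + r)
    {R' : Fin 2 → Set ℤ} (hi : R' i = R i) (ho : R' (i + 1) = insert (w (n + 1) (i + 1)) (R (i + 1))) :
    OnSide B w (n + 1) R' i r 0 := by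
  have hrr := coord_unit hr
  have hlt : ∀ x ∈ occupied B w n, r * x (i + 1) < r * w (n + 1) (i + 1) := by
    intro x hx
    have := hout x hx
    rw [h2, mul_add, hrr]; omega
  have hsub : ∀ x ∈ occupied B w n, x ∈ occupied B w (n + 1) := fun x hx => by
    rw [occupied_succ]; exact Or.inr hx
  refine ⟨⟨?_, ?_⟩, ?_, ?_, ?_, fun hh => absurd rfl hh⟩
  · intro x hx k
    rw [occupied_succ] at hx
    rcases hx with rfl | hx
    · rcases fin_two_eq_or i k with rfl | rfl
      · rw [hi, h1]; exact h.mem _ (self_mem_occupied B w n) _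
      · rw [ho]; exact Or.inl rfl
    · rcases fin_two_eq_or i k with rfl | rfl
      · rw [hi]; exact h.mem x hx _
      · rw [ho]; exact Or.inr (h.mem x hx _)
  · intro k v hv
    rcases fin_two_eq_or i k with rfl | rfl
    · rw [hi] at hv
      obtain ⟨x, hx, hxv⟩ := h.exists_mem _ v hv
      exact ⟨x, hsub x hx, hxv⟩
    · rw [ho] at hv
      rcases hv with rfl | hv
      · exact ⟨_, self_mem_occupied B w _, rfl⟩
      · obtain ⟨x, hx, hxv⟩ := h.exists_mem _ v hv
        exact ⟨x, hsub x hx, hxv⟩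
  · intro x hx
    rw [occupied_succ] at hx
    rcases hx with rfl | hx
    exacts [le_rfl, (hlt x hx).le]
  · intro v hv
    rw [hi] at hv
    obtain ⟨x, hx, hxv⟩ := h.exists_mem _ v hv
    exact ⟨x, hsub x hx, hxv, hlt x hx⟩
  · intro x hx hxo
    rw [occupied_succ] at hx
    rcases hx with rfl | hx
    · exact ⟨fun _ => rfl, le_rfl⟩
    · have := hlt x hx
      rw [hxo] at this
      exact absurd this (lt_irrefl _)

theorem OnSide.outward (h : OnSide B w n R i r c) (hr : r = 1 ∨ r = -1)
    (h1 : w (n + 1) i = w n i) (h2 : w (n + 1) (i + 1) = w n (i + 1) + r)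
    {R' : Fin 2 → Set ℤ} (hi : R' i = R i) (ho : R' (i + 1) = insert (w (n + 1) (i + 1)) (R (i + 1))) :
    OnSide B w (n + 1) R' i r 0 :=
  h.toFills.outward hr h.outer h1 h2 hi ho

/-- The site just left becomes the witness in `back` that forbids turning round; the occupied sites
of the current row all remain behind the walk. -/
theorem OnSide.along (h : OnSide B w n R i r c) {c' : ℤ} (hc' : c' = 1 ∨ c' = -1)
    (hcc : c = 0 ∨ c = c') (h1 : w (n + 1) i = w n i + c') (h2 : w (n + 1) (i + 1) = w n (i + 1))
    (hmem : w (n + 1) i ∈ R i) : OnSide B w (n + 1) R i r c' := by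
  have hcu := coord_unit hc'
  have hsub : ∀ x ∈ occupied B w n, x ∈ occupied B w (n + 1) := fun x hx => by
    rw [occupied_succ]; exact Or.inr hx
  refine ⟨⟨?_, ?_⟩, ?_, ?_, ?_, fun _ => ?_⟩
  · intro x hx k
    rw [occupied_succ] at hx
    rcases hx with rfl | hx
    · rcases fin_two_eq_or i k with rfl | rfl
      · exact hmem
      · rw [h2]; exact h.mem _ (self_mem_occupied B w n) _
    · exact h.mem x hx k
  · intro k v hv
    obtain ⟨x, hx, hxv⟩ := h.exists_mem _ v hv
    exact ⟨x, hsub x hx, hxv⟩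
  · intro x hx
    rw [h2]
    rw [occupied_succ] at hx
    rcases hx with rfl | hx
    exacts [by rw [h2], h.outer x hx]
  · intro v hv
    obtain ⟨x, hx, hxv⟩ := h.inner v hv
    rw [h2]
    exact ⟨x, hsub x hx, hxv⟩
  · intro x hx hxo
    refine ⟨fun h0 => by omega, ?_⟩
    rw [occupied_succ] at hx
    rcases hx with rfl | hx
    · exact le_rfl
    · obtain ⟨ha, hb⟩ := h.column x hx (hxo.trans h2)
      rw [h1, mul_add, hcu]
      rcases hcc with h0 | rfl
      · rw [ha h0]; omega
      · omega
  · exact ⟨w n, hsub _ (self_mem_occupied B w n), h2.symm, by omega⟩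

/-- The directions allowed to a walk on the side of its bounding rectangle. -/
theorem OnSide.mem_allowed_iff (h : OnSide B w n R i r c) (hr : r = 1 ∨ r = -1)
    (hc : c = 0 ∨ c = 1 ∨ c = -1) {e : Site} :
    e ∈ allowedDirections B w n ↔ (e i = 0 ∧ e (i + 1) = r) ∨
      (e (i + 1) = 0 ∧ (e i = 1 ∨ e i = -1) ∧ (c = 0 ∨ c = e i)) := by
  have hrr := coord_unit hr
  rw [mem_allowedDirections, mem_directions_iff i]
  constructor
  · rintro ⟨hd, ha⟩
    rcases hd with ⟨h0, h1⟩ | ⟨h0, h1⟩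
    · refine Or.inl ⟨h0, ?_⟩
      by_contra hne
      have her : e (i + 1) = -r := by omega
      -- The inward direction is blocked by an occupied site of the same column, at the distance
      -- used as the number of steps below.
      obtain ⟨x, hx, hxi, hxo⟩ := h.inner _ (h.mem _ (self_mem_occupied B w n) i)
      have hpos : 0 < r * w n (i + 1) - r * x (i + 1) := by omega
      refine ha (r * w n (i + 1) - r * x (i + 1)).toNat (by omega) ?_
      convert hx using 1
      refine site_ext i ?_ ?_
      · simp [h0, hxi]
      · rw [add_nsmul_coord, her, Int.toNat_of_nonneg hpos.le]
        linear_combination (-w n (i + 1) + x (i + 1)) * hrr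
    · refine Or.inr ⟨h0, h1, ?_⟩
      by_contra! hne
      obtain ⟨x, hx, hxo, hxi⟩ := h.back hne.1
      refine ha 1 one_pos ?_
      convert hx using 1
      refine site_ext i ?_ ?_
      · simp only [Pi.add_apply, one_smul]; omega
      · simp [h0, hxo]
  · rintro (⟨h0, h1⟩ | ⟨h0, h1, h2⟩)
    · refine ⟨Or.inl ⟨h0, by omega⟩, fun k hk hx => ?_⟩
      have := h.outer _ hx
      rw [add_nsmul_coord, h1] at this
      have e1 : r * (w n (i + 1) + k * r) = r * w n (i + 1) + k := by
        linear_combination (k : ℤ) * hrr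
      omega
    · refine ⟨Or.inr ⟨h0, h1⟩, fun k hk hx => ?_⟩
      obtain ⟨ha, hb⟩ := h.column _ hx (by simp [h0])
      rw [add_nsmul_coord] at ha hb
      rcases h2 with h2 | h2
      · have := ha h2
        rcases h1 with h1 | h1 <;> rw [h1] at this <;> omega
      · subst h2
        have e1 : e i * (w n i + k * e i) = e i * w n i + k := by
          linear_combination (k : ℤ) * coord_unit h1
        omega

/-- The site with coordinate `a` along `i` and `b` along the other axis. -/
def siteOf (i : Fin 2) (a b : ℤ) : Site := fun k => if k = i then a else b

@[simp] theorem siteOf_self (i : Fin 2) (a b : ℤ) : siteOf i a b i = a := if_pos rfl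

@[simp] theorem siteOf_other (i : Fin 2) (a b : ℤ) : siteOf i a b (i + 1) = b :=
  if_neg (fin_two_ne i)

theorem eq_siteOf {x : Site} {a b : ℤ} (h : x i = a) (h' : x (i + 1) = b) :
    x = siteOf i a b := site_ext i (by simp [h]) (by simp [h'])

theorem siteOf_inj {a b a' b' : ℤ} : siteOf i a b = siteOf i a' b' ↔ a = a' ∧ b = b' := by
  refine ⟨fun h => ⟨?_, ?_⟩, fun h => by rw [h.1, h.2]⟩
  · simpa using congrFun h i
  · simpa using congrFun h (i + 1)

open scoped Classical in
theorem OnSide.allowed_eq_of_zero (h : OnSide B w n R i r 0) (hr : r = 1 ∨ r = -1) :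
    allowedDirections B w n = {siteOf i 0 r, siteOf i 1 0, siteOf i (-1) 0} := by
  ext e
  rw [h.mem_allowed_iff hr (Or.inl rfl)]
  simp only [Finset.mem_insert, Finset.mem_singleton]
  constructor
  · rintro (⟨h0, h1⟩ | ⟨h0, h1 | h1, -⟩)
    · exact Or.inl (eq_siteOf h0 h1)
    · exact Or.inr (Or.inl (eq_siteOf h1 h0))
    · exact Or.inr (Or.inr (eq_siteOf h1 h0))
  · rintro (rfl | rfl | rfl) <;> simp

open scoped Classical in
theorem OnSide.allowed_eq_of_ne (h : OnSide B w n R i r c) (hr : r = 1 ∨ r = -1)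
    (hc : c = 1 ∨ c = -1) :
    allowedDirections B w n = {siteOf i 0 r, siteOf i c 0} := by
  ext e
  rw [h.mem_allowed_iff hr (Or.inr hc)]
  simp only [Finset.mem_insert, Finset.mem_singleton]
  constructor
  · rintro (⟨h0, h1⟩ | ⟨h0, h1, h2⟩)
    · exact Or.inl (eq_siteOf h0 h1)
    · exact Or.inr (eq_siteOf (by omega) h0)
  · rintro (rfl | rfl)
    · simp
    · simpa using Or.inr hc

end PrudentWalk

namespace PrudentWalk

/-! ### The excursion in progress at a given time -/

open scoped Classical in
/-- The index and the starting time of the excursion in progress at time `u`. -/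
def current (x : ℕ → Site) : ℕ → ℕ × ℕ
  | 0 => (0, 0)
  | u + 1 =>
      if x (current x u).2 (side x (current x u).1) < x (u + 1) (side x (current x u).1)
        then ((current x u).1 + 1, u) else current x u

/-- The index of the excursion in progress at time `u`. -/
def exc (x : ℕ → Site) (u : ℕ) : ℕ := (current x u).1

/-- The starting time of the excursion in progress at time `u`. -/
def excStart (x : ℕ → Site) (u : ℕ) : ℕ := (current x u).2

/-- The coordinate along the side of the excursion in progress at time `u`. -/
def excSide (x : ℕ → Site) (u : ℕ) : Fin 2 := side x (exc x u)

/-- The step from time `u` to time `u + 1` ends the excursion in progress. -/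
def Leaves (x : ℕ → Site) (u : ℕ) : Prop :=
  x (excStart x u) (excSide x u) < x (u + 1) (excSide x u)

variable {x y : ℕ → Site} {u : ℕ}

theorem exc_succ_of_leaves (h : Leaves x u) : exc x (u + 1) = exc x u + 1 :=
  congrArg Prod.fst (if_pos h)

theorem excStart_succ_of_leaves (h : Leaves x u) : excStart x (u + 1) = u :=
  congrArg Prod.snd (if_pos h)

theorem exc_succ_of_not_leaves (h : ¬ Leaves x u) : exc x (u + 1) = exc x u :=
  congrArg Prod.fst (if_neg h)

theorem excStart_succ_of_not_leaves (h : ¬ Leaves x u) : excStart x (u + 1) = excStart x u :=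
  congrArg Prod.snd (if_neg h)

theorem exc_zero : exc x 0 = 0 := rfl

theorem excStart_zero : excStart x 0 = 0 := rfl

theorem exc_le_succ (x : ℕ → Site) (u : ℕ) : exc x u ≤ exc x (u + 1) := by
  by_cases h : Leaves x u
  · rw [exc_succ_of_leaves h]; omega
  · rw [exc_succ_of_not_leaves h]

theorem monotone_exc (x : ℕ → Site) : Monotone (exc x) := monotone_nat_of_le_succ (exc_le_succ x)

theorem leaves_iff_exc : Leaves x u ↔ exc x (u + 1) ≠ exc x u := by
  constructor
  · intro h
    rw [exc_succ_of_leaves h]; omega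
  · intro h
    by_contra hn
    exact h (exc_succ_of_not_leaves hn)

theorem side_succ (x : ℕ → Site) (j : ℕ) : side x (j + 1) = side x j + 1 := rfl

theorem excStart_le (x : ℕ → Site) (u : ℕ) : excStart x u ≤ u := by
  induction u with
  | zero => exact le_rfl
  | succ u ih =>
    by_cases h : Leaves x u
    · rw [excStart_succ_of_leaves h]; omega
    · rw [excStart_succ_of_not_leaves h]; omega

theorem excStart_lt (x : ℕ → Site) (u : ℕ) : excStart x (u + 1) < u + 1 := by
  by_cases h : Leaves x u
  · rw [excStart_succ_of_leaves h]; omega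
  · rw [excStart_succ_of_not_leaves h]
    have := excStart_le x u
    omega

theorem excSide_succ_of_leaves (h : Leaves x u) : excSide x (u + 1) = excSide x u + 1 := by
  unfold excSide; rw [exc_succ_of_leaves h, side_succ]

theorem excSide_succ_of_not_leaves (h : ¬ Leaves x u) : excSide x (u + 1) = excSide x u := by
  unfold excSide; rw [exc_succ_of_not_leaves h]

/-- The component of the last step along the side of the excursion in progress. -/
def lastAlong (x : ℕ → Site) (u : ℕ) : ℤ := x u (excSide x u) - x (u - 1) (excSide x u)

/-- The depth at time `u` of the excursion in progress. -/
def curDepth (x : ℕ → Site) (u : ℕ) : ℤ := x (excStart x u) (excSide x u) - x u (excSide x u)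

/-- The rectangle explored by a walk of the corner model at time `u`. -/
def cornerRange (x : ℕ → Site) (u : ℕ) (k : Fin 2) : Set ℤ :=
  Set.Iic (if k = excSide x u then x (excStart x u) k else x u k)

theorem cornerRange_side (x : ℕ → Site) (u : ℕ) :
    cornerRange x u (excSide x u) = Set.Iic (x (excStart x u) (excSide x u)) := by
  simp [cornerRange]

theorem cornerRange_other (x : ℕ → Site) (u : ℕ) :
    cornerRange x u (excSide x u + 1) = Set.Iic (x u (excSide x u + 1)) := by
  simp [cornerRange]

/-- What holds at every positive time of a walk of the corner model. -/
structure InExcursion (x : ℕ → Site) (u : ℕ) : Prop where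
  onSide : OnSide southWest x u (cornerRange x u) (excSide x u) 1 (lastAlong x u)
  last_mem : lastAlong x u = 0 ∨ lastAlong x u = 1 ∨ lastAlong x u = -1
  le_corner : ∀ t, excStart x u ≤ t → t ≤ u →
    x t (excSide x u) ≤ x (excStart x u) (excSide x u)
  outward_le : ∀ t, excStart x u ≤ t → t < u →
    x t (excSide x u + 1) ≤ x (t + 1) (excSide x u + 1)
  first_step : x (excStart x u + 1) (excSide x u + 1) = x (excStart x u) (excSide x u + 1) + 1 ∧
    x (excStart x u + 1) (excSide x u) = x (excStart x u) (excSide x u)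
  start_eq : startTime x (exc x u) = excStart x u

theorem InExcursion.curDepth_nonneg (h : InExcursion x u) : 0 ≤ curDepth x u := by
  have := h.le_corner u (excStart_le x u) le_rfl
  unfold curDepth
  omega

theorem insert_Iic_succ {a b : ℤ} (h : b = a + 1) : Set.Iic b = insert b (Set.Iic a) := by
  subst h; ext v; simp only [Set.mem_Iic, Set.mem_insert_iff]; omega

/-- The possible steps during an excursion. -/
theorem InExcursion.step_cases (h : InExcursion x u)
    (hv : x (u + 1) - x u ∈ allowedDirections southWest x u) :
    (¬ Leaves x u ∧ x (u + 1) (excSide x u) = x u (excSide x u) ∧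
      x (u + 1) (excSide x u + 1) = x u (excSide x u + 1) + 1) ∨
    (x (u + 1) (excSide x u + 1) = x u (excSide x u + 1) ∧ ∃ c : ℤ, (c = 1 ∨ c = -1) ∧
      (lastAlong x u = 0 ∨ lastAlong x u = c) ∧
      x (u + 1) (excSide x u) = x u (excSide x u) + c ∧
      (Leaves x u ↔ c = 1 ∧ curDepth x u = 0)) := by
  have hle := h.le_corner u (excStart_le x u) le_rfl
  rw [h.onSide.mem_allowed_iff (Or.inl rfl) h.last_mem] at hv
  simp only [Pi.sub_apply] at hv
  unfold Leaves curDepth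
  rcases hv with ⟨h0, h1⟩ | ⟨h0, h1, h2⟩
  · left; omega
  · right
    exact ⟨by omega, _, h1, h2, by omega, by omega⟩

/-- Used at time `1` and after each completed excursion: in both cases the walk leaves the corner of
a quadrant already filled, and the invariant restarts from that step. -/
theorem inExcursion_of_outward {i : Fin 2} {v : ℕ} {R : Fin 2 → Set ℤ}
    (hF : Fills southWest x v R) (hR : R i = Set.Iic (x v i))
    (hRo : R (i + 1) = Set.Iic (x v (i + 1)))
    (hs : excSide x (v + 1) = i) (ht : excStart x (v + 1) = v)
    (h1 : x (v + 1) i = x v i) (h2 : x (v + 1) (i + 1) = x v (i + 1) + 1)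
    (hstart : startTime x (exc x (v + 1)) = v) : InExcursion x (v + 1) := by
  subst hs
  have hl : lastAlong x (v + 1) = 0 := by
    unfold lastAlong; simp only [Nat.add_sub_cancel]; omega
  refine ⟨?_, Or.inl hl, ?_, ?_, ?_, by rw [hstart, ht]⟩
  · rw [hl]
    refine hF.outward (Or.inl rfl) (fun y hy => ?_) h1 h2 ?_ ?_
    · have := hF.mem y hy (excSide x (v + 1) + 1)
      rw [hRo, Set.mem_Iic] at this
      omega
    · rw [cornerRange_side, ht, hR]
    · rw [cornerRange_other, hRo, insert_Iic_succ h2]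
  · rw [ht]; intro t a b
    obtain rfl | rfl : t = v ∨ t = v + 1 := by omega
    exacts [le_rfl, h1.le]
  · rw [ht]; intro t a b
    obtain rfl : t = v := by omega
    omega
  · rw [ht]; exact ⟨h2, h1⟩

theorem fills_southWest (h0 : x 0 = 0) : Fills southWest x 0 (fun _ => Set.Iic 0) := by
  have hocc : occupied southWest x 0 = southWest := by
    rw [occupied, Set.union_eq_left]
    rintro y ⟨s, hs, rfl⟩
    obtain rfl : s = 0 := by simpa using hs
    intro i; simp [h0]
  refine ⟨?_, ?_⟩
  · rw [hocc]; exact fun y hy k => hy k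
  · rw [hocc]; exact fun k v hv => ⟨fun _ => v, fun _ => hv, rfl⟩

/-- The first step of a walk of the corner model. -/
theorem first_step_cases (h0 : x 0 = 0) (hv : x 1 - x 0 ∈ allowedDirections southWest x 0) :
    x 1 (side x 0) = 0 ∧ x 1 (side x 0 + 1) = 1 := by
  rw [h0, sub_zero, mem_allowedDirections, mem_directions_iff 0] at hv
  obtain ⟨hd, hn⟩ := hv
  have hneg : ∀ k, x 1 k ≠ -1 := by
    intro k hk
    refine hn 1 one_pos (Or.inl fun i => ?_)
    rw [h0, zero_add, one_smul]
    rcases fin_two_eq_or k i with rfl | rfl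
    · omega
    · rcases hd with h | h <;> fin_cases k <;> simp_all
  have h01 := hneg 0
  have h11 := hneg (0 + 1)
  by_cases hx : x 1 = unitVec 0
  · have : side x 0 = 1 := by simp [side, hx]
    rw [this, hx]; simp [unitVec]
  · have hs : side x 0 = 0 := by simp [side, hx]
    rw [hs]
    have : x 1 0 ≠ 1 := fun h => hx (site_ext 0 (by simpa [unitVec] using h) (by
      simp [unitVec]; simp at hd; omega))
    omega

theorem inExcursion_one (h : ValidUpTo southWest x 1) : InExcursion x 1 := by
  obtain ⟨h1, h2⟩ := first_step_cases h.1 (h.2 0 one_pos)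
  have hl : ¬ Leaves x 0 := by
    unfold Leaves excSide excStart
    rw [exc_zero]
    show ¬ x 0 _ < x 1 _
    rw [h.1, h1]
    exact lt_irrefl _
  have hs : excSide x 1 = side x 0 := by rw [excSide_succ_of_not_leaves hl]; rfl
  refine inExcursion_of_outward (i := side x 0) (fills_southWest h.1) ?_ ?_ hs ?_ ?_ ?_ ?_
  · rw [h.1]; rfl
  · rw [h.1]; rfl
  · rw [excStart_succ_of_not_leaves hl, excStart_zero]
  · rw [h1, h.1]; rfl
  · rw [h2, h.1]; rfl
  · rw [exc_succ_of_not_leaves hl]; rfl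

/-- Reconciles the step-by-step bookkeeping of `current` with the infimum in `startTime`: the level
of the corner is not exceeded before time `u + 1`, so the infimum is `u + 1` and the subtraction
returns `u`. -/
theorem InExcursion.startTime_succ (h : InExcursion x u) (hl : Leaves x u) :
    startTime x (exc x u + 1) = u := by
  rw [startTime, h.start_eq]
  have : sInf {t | excStart x u < t ∧ x (excStart x u) (excSide x u) < x t (excSide x u)} =
      u + 1 := by
    refine le_antisymm (Nat.sInf_le ⟨?_, hl⟩) (le_csInf ⟨u + 1, ?_, hl⟩ ?_)
    · have := excStart_le x u; omega
    · have := excStart_le x u; omega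
    · rintro t ⟨ht, hlt⟩
      by_contra hc
      exact absurd (h.le_corner t ht.le (by omega)) (by omega)
  change sInf {t | excStart x u < t ∧ x (excStart x u) (excSide x u) < x t (excSide x u)} - 1 = u
  omega

/-- A leaving step starts at depth zero and goes towards the corner; it is outward for the next
excursion, whose side is the other coordinate, while the filled quadrant is the same. Any other step
propagates `OnSide`. -/
theorem InExcursion.succ (h : InExcursion x u) (hu : 0 < u)
    (hv : x (u + 1) - x u ∈ allowedDirections southWest x u) : InExcursion x (u + 1) := by
  have hsl := excStart_le x u
  have hlt : excStart x u < u := by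
    obtain ⟨v, rfl⟩ : ∃ v, u = v + 1 := ⟨u - 1, by omega⟩
    exact excStart_lt x v
  by_cases hl : Leaves x u
  · rcases h.step_cases hv with ⟨hn, -⟩ | ⟨ho, c, hc, hcc, hs, hiff⟩
    · exact absurd hl hn
    · obtain ⟨rfl, hd⟩ := hiff.1 hl
      unfold curDepth at hd
      refine inExcursion_of_outward (i := excSide x u + 1) h.onSide.toFills (cornerRange_other x u)
        ?_ (excSide_succ_of_leaves hl) (excStart_succ_of_leaves hl) ho ?_ ?_
      · rw [fin_two_add, cornerRange_side]; congr 1; omega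
      · rw [fin_two_add]; exact hs
      · rw [exc_succ_of_leaves hl]; exact h.startTime_succ hl
  · have es := excSide_succ_of_not_leaves hl
    have et := excStart_succ_of_not_leaves hl
    have ee := exc_succ_of_not_leaves hl
    have hla : lastAlong x (u + 1) = x (u + 1) (excSide x u) - x u (excSide x u) := by
      unfold lastAlong; rw [es]; simp
    have hnl : x (u + 1) (excSide x u) ≤ x (excStart x u) (excSide x u) := not_lt.1 hl
    have hcase := h.step_cases hv
    refine ⟨?_, ?_, ?_, ?_, ?_, ?_⟩
    · rw [hla, es]
      rcases hcase with ⟨-, h1, h2⟩ | ⟨ho, c, hc, hcc, hs, -⟩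
      · rw [h1, sub_self]
        refine h.onSide.outward (Or.inl rfl) h1 h2 ?_ ?_
        · rw [cornerRange_side, ← es, ← et, cornerRange_side]
        · rw [cornerRange_other, ← es, cornerRange_other, es, insert_Iic_succ h2]
      · have hR : cornerRange x (u + 1) = cornerRange x u := by
          funext k
          rcases fin_two_eq_or (excSide x u) k with rfl | rfl
          · rw [cornerRange_side, ← es, ← et, cornerRange_side]
          · rw [cornerRange_other, ← es, cornerRange_other, es, ho]
        rw [hR, show x (u + 1) (excSide x u) - x u (excSide x u) = c by omega]
        refine h.onSide.along hc hcc hs ho ?_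
        rw [cornerRange_side]; exact hnl
    · rw [hla]
      rcases hcase with ⟨-, h1, h2⟩ | ⟨ho, c, hc, hcc, hs, -⟩ <;> omega
    · rw [es, et]
      intro t h1 h2
      rcases Nat.lt_or_ge u t with h3 | h3
      · obtain rfl : t = u + 1 := by omega
        exact hnl
      · exact h.le_corner t h1 h3
    · rw [es, et]
      intro t h1 h2
      rcases Nat.lt_or_ge t u with h3 | h3
      · exact h.outward_le t h1 h3
      · obtain rfl : t = u := by omega
        rcases hcase with ⟨-, h1, h2⟩ | ⟨ho, -⟩ <;> omega
    · rw [es, et]; exact h.first_step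
    · rw [ee, et]; exact h.start_eq

theorem ValidUpTo.inExcursion (h : ValidUpTo southWest x u) (hu : 0 < u) : InExcursion x u := by
  induction u with
  | zero => omega
  | succ u ih =>
    rcases Nat.eq_zero_or_pos u with rfl | hu'
    · exact inExcursion_one h
    · exact (ih (h.mono (by omega)) hu').succ hu' (h.2 u (by omega))

/-! ### Locality -/

/-- The orientation of every excursion is decided by the step to time `1`, hence the positivity
condition here and in the locality lemmas below. -/
theorem Agree.side_eq (h : Agree u x y) (hu : 0 < u) (j : ℕ) : side x j = side y j := by
  induction j with
  | zero => unfold side; rw [h 1 hu]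
  | succ j ih => rw [side_succ, side_succ, ih]

theorem Agree.current_eq (h : Agree u x y) (hu : 0 < u) : current x u = current y u := by
  have key : ∀ v ≤ u, current x v = current y v := by
    intro v
    induction v with
    | zero => exact fun _ => rfl
    | succ v ih =>
      intro hv
      have h1 := excStart_le y v
      unfold excStart at h1
      rw [current, current, ih (by omega), h.side_eq hu, h (v + 1) hv,
        h (current y v).2 (by omega)]
  exact key u le_rfl

theorem Agree.exc_eq (h : Agree u x y) (hu : 0 < u) : exc x u = exc y u :=
  congrArg Prod.fst (h.current_eq hu)

theorem Agree.excStart_eq (h : Agree u x y) (hu : 0 < u) : excStart x u = excStart y u :=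
  congrArg Prod.snd (h.current_eq hu)

theorem Agree.excSide_eq (h : Agree u x y) (hu : 0 < u) : excSide x u = excSide y u := by
  unfold excSide; rw [h.exc_eq hu, h.side_eq hu]

theorem Agree.curDepth_eq (h : Agree u x y) (hu : 0 < u) : curDepth x u = curDepth y u := by
  unfold curDepth
  rw [h.excSide_eq hu, h.excStart_eq hu, h u le_rfl, h _ (excStart_le y u)]

theorem Agree.lastAlong_eq (h : Agree u x y) (hu : 0 < u) : lastAlong x u = lastAlong y u := by
  unfold lastAlong
  rw [h.excSide_eq hu, h u le_rfl, h (u - 1) (by omega)]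

theorem Agree.leaves_iff (h : Agree (u + 1) x y) (hu : 0 < u) : Leaves x u ↔ Leaves y u := by
  rw [leaves_iff_exc, leaves_iff_exc, h.exc_eq (by omega), (h.mono (by omega)).exc_eq hu]

end PrudentWalk

namespace PrudentWalk

/-! ### Potentials of excursions -/

variable {B : Set Site} {x y : ℕ → Site} {u : ℕ}

open scoped Classical in
/-- The maximal depth reached up to time `u` by the excursion in progress. -/
noncomputable def maxDepth (x : ℕ → Site) : ℕ → ℤ
  | 0 => 0
  | u + 1 => if Leaves x u then 0 else max (maxDepth x u) (curDepth x (u + 1))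

theorem maxDepth_succ_of_leaves (h : Leaves x u) : maxDepth x (u + 1) = 0 := if_pos h

theorem maxDepth_succ_of_not_leaves (h : ¬ Leaves x u) :
    maxDepth x (u + 1) = max (maxDepth x u) (curDepth x (u + 1)) := if_neg h

/-- The outward displacement up to time `u` of the excursion in progress. -/
def outDisp (x : ℕ → Site) (u : ℕ) : ℤ :=
  x u (excSide x u + 1) - x (excStart x u) (excSide x u + 1)

/-- The stage of an excursion: its depth, the component of its last step along its side, its outward
displacement and its maximal depth. -/
structure Stage where
  depth : ℤ
  last : ℤ
  disp : ℤ
  deepest : ℤ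

/-- The stage at time `u` of the excursion in progress. -/
noncomputable def stage (x : ℕ → Site) (u : ℕ) : Stage :=
  ⟨curDepth x u, lastAlong x u, outDisp x u, maxDepth x u⟩

/-- The value of a potential after a step towards the corner: the excursion ends if it is at the
level of the corner. -/
noncomputable def upValue (Ψ : Stage → ℝ) (Φ : ℤ → ℤ → ℝ) (d n m : ℤ) : ℝ :=
  if d = 0 then Φ n m else Ψ ⟨d - 1, 1, n, m⟩

/-- `Ψ` is a nonnegative superharmonic function of the stage of an excursion, with final value `Φ`
and with initial value at most `a`. -/
structure IsPotential (Ψ : Stage → ℝ) (Φ : ℤ → ℤ → ℝ) (a : ℝ) : Prop where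
  nonneg : ∀ d c n m, 0 ≤ d → d ≤ m → 1 ≤ n → c = 0 ∨ c = 1 ∨ c = -1 → 0 ≤ Ψ ⟨d, c, n, m⟩
  exit_nonneg : ∀ n m, 1 ≤ n → 0 ≤ m → 0 ≤ Φ n m
  fresh : Ψ ⟨0, 0, 1, 0⟩ ≤ a
  average_out : ∀ d n m, 0 ≤ d → d ≤ m → 1 ≤ n →
    Ψ ⟨d, 0, n + 1, m⟩ + upValue Ψ Φ d n m + Ψ ⟨d + 1, -1, n, max m (d + 1)⟩ ≤ 3 * Ψ ⟨d, 0, n, m⟩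
  average_up : ∀ d n m, 0 ≤ d → d ≤ m → 1 ≤ n →
    Ψ ⟨d, 0, n + 1, m⟩ + upValue Ψ Φ d n m ≤ 2 * Ψ ⟨d, 1, n, m⟩
  average_down : ∀ d n m, 0 ≤ d → d ≤ m → 1 ≤ n →
    Ψ ⟨d, 0, n + 1, m⟩ + Ψ ⟨d + 1, -1, n, max m (d + 1)⟩ ≤ 2 * Ψ ⟨d, -1, n, m⟩

/-- The step that ends an excursion is already the first outward step of the next one, so a fresh
excursion has displacement `1`. -/
theorem InExcursion.stage_succ_of_leaves (h : InExcursion x u)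
    (hv : x (u + 1) - x u ∈ allowedDirections southWest x u) (hl : Leaves x u) :
    stage x (u + 1) = ⟨0, 0, 1, 0⟩ := by
  rcases h.step_cases hv with ⟨hn, -⟩ | ⟨ho, c, hc, hcc, hs, hiff⟩
  · exact absurd hl hn
  · obtain ⟨rfl, hd⟩ := hiff.1 hl
    unfold stage
    rw [maxDepth_succ_of_leaves hl]
    unfold curDepth lastAlong outDisp
    rw [excSide_succ_of_leaves hl, excStart_succ_of_leaves hl, fin_two_add, hs, ho]
    simp

theorem InExcursion.stage_succ_of_not_leaves (hl : ¬ Leaves x u) :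
    stage x (u + 1) = ⟨curDepth x u - (x (u + 1) (excSide x u) - x u (excSide x u)),
      x (u + 1) (excSide x u) - x u (excSide x u),
      outDisp x u + (x (u + 1) (excSide x u + 1) - x u (excSide x u + 1)),
      max (maxDepth x u) (curDepth x u - (x (u + 1) (excSide x u) - x u (excSide x u)))⟩ := by
  have hd : curDepth x (u + 1) =
      curDepth x u - (x (u + 1) (excSide x u) - x u (excSide x u)) := by
    unfold curDepth
    rw [excSide_succ_of_not_leaves hl, excStart_succ_of_not_leaves hl]; ring
  unfold stage
  rw [maxDepth_succ_of_not_leaves hl, hd]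
  unfold lastAlong outDisp
  rw [excSide_succ_of_not_leaves hl, excStart_succ_of_not_leaves hl]
  simp

theorem ValidUpTo.curDepth_le_maxDepth (h : ValidUpTo southWest x u) (hu : 0 < u) :
    curDepth x u ≤ maxDepth x u := by
  obtain ⟨v, rfl⟩ : ∃ v, u = v + 1 := ⟨u - 1, by omega⟩
  by_cases hl : Leaves x v
  · rcases Nat.eq_zero_or_pos v with rfl | hv
    · exfalso
      have h1 := (first_step_cases h.1 (h.2 0 one_pos)).1
      unfold Leaves excSide at hl
      rw [exc_zero, excStart_zero, h.1, h1] at hl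
      exact lt_irrefl _ hl
    · have := ((h.mono (by omega)).inExcursion hv).stage_succ_of_leaves (h.2 v (by omega)) hl
      have e1 : curDepth x (v + 1) = 0 := congrArg Stage.depth this
      have e2 : maxDepth x (v + 1) = 0 := congrArg Stage.deepest this
      rw [e1, e2]
  · rw [maxDepth_succ_of_not_leaves hl]; exact le_max_right _ _

theorem stage_one (h : ValidUpTo southWest x 1) : exc x 1 = 0 ∧ stage x 1 = ⟨0, 0, 1, 0⟩ := by
  obtain ⟨h1, h2⟩ := first_step_cases h.1 (h.2 0 one_pos)
  have hl : ¬ Leaves x 0 := by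
    intro hl
    unfold Leaves excSide at hl
    rw [exc_zero, excStart_zero, h.1, h1] at hl
    exact lt_irrefl _ hl
  refine ⟨exc_succ_of_not_leaves hl, ?_⟩
  rw [InExcursion.stage_succ_of_not_leaves hl]
  have hs : excSide x 0 = side x 0 := rfl
  have hd : curDepth x 0 = 0 := by unfold curDepth; rw [excStart_zero, sub_self]
  have ho : outDisp x 0 = 0 := by unfold outDisp; rw [excStart_zero, sub_self]
  rw [hs, hd, ho, zero_add, h1, h2, h.1]
  simp [maxDepth]

theorem ValidUpTo.outDisp_pos (h : ValidUpTo southWest x u) (hu : 0 < u) :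
    1 ≤ outDisp x u := by
  induction u with
  | zero => omega
  | succ u ih =>
    rcases Nat.eq_zero_or_pos u with rfl | hu'
    · have : outDisp x 1 = 1 := congrArg Stage.disp (stage_one h).2
      rw [this]
    · have hE := (h.mono (Nat.le_succ u)).inExcursion hu'
      have hv := h.2 u (Nat.lt_succ_self u)
      by_cases hl : Leaves x u
      · have : outDisp x (u + 1) = 1 := congrArg Stage.disp (hE.stage_succ_of_leaves hv hl)
        rw [this]
      · have := congrArg Stage.disp (InExcursion.stage_succ_of_not_leaves hl)
        have ih' := ih (h.mono (Nat.le_succ u)) hu'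
        change outDisp x (u + 1) = _ at this
        simp only at this
        rcases hE.step_cases hv with ⟨-, -, h1⟩ | ⟨h1, -⟩ <;> rw [h1] at this <;> omega

open scoped Classical in
/-- The product of the final values of the first `J` excursions over those completed before
time `u`. -/
noncomputable def excProd (Φ : ℕ → ℤ → ℤ → ℝ) (J : ℕ) (x : ℕ → Site) : ℕ → ℝ
  | 0 => 1
  | u + 1 => excProd Φ J x u *
      if Leaves x u ∧ exc x u < J then Φ (exc x u) (outDisp x u) (maxDepth x u) else 1

/-- The product of the potentials of the first `J` excursions at time `u`. -/
noncomputable def potential (Ψ : ℕ → Stage → ℝ) (Φ : ℕ → ℤ → ℤ → ℝ) (a : ℕ → ℝ) (J : ℕ) (x : ℕ → Site)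
    (u : ℕ) : ℝ :=
  excProd Φ J x u * if exc x u < J
    then Ψ (exc x u) (stage x u) * ∏ k ∈ Finset.Ico (exc x u + 1) J, a k else 1

variable {Ψ : ℕ → Stage → ℝ} {Φ : ℕ → ℤ → ℤ → ℝ} {a : ℕ → ℝ} {J : ℕ}

theorem Agree.maxDepth_eq (h : Agree u x y) (hu : 0 < u) : maxDepth x u = maxDepth y u := by
  have key : ∀ v, v + 1 ≤ u → maxDepth x (v + 1) = maxDepth y (v + 1) := by
    intro v
    induction v with
    | zero =>
      intro hv
      have : Leaves x 0 ↔ Leaves y 0 := by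
        rw [leaves_iff_exc, leaves_iff_exc, (h.mono hv).exc_eq one_pos, exc_zero, exc_zero]
      by_cases hl : Leaves x 0
      · rw [maxDepth_succ_of_leaves hl, maxDepth_succ_of_leaves (this.1 hl)]
      · rw [maxDepth_succ_of_not_leaves hl, maxDepth_succ_of_not_leaves (mt this.2 hl),
          (h.mono hv).curDepth_eq one_pos]
        rfl
    | succ v ih =>
      intro hv
      have := (h.mono hv).leaves_iff (Nat.succ_pos v)
      by_cases hl : Leaves x (v + 1)
      · rw [maxDepth_succ_of_leaves hl, maxDepth_succ_of_leaves (this.1 hl)]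
      · rw [maxDepth_succ_of_not_leaves hl, maxDepth_succ_of_not_leaves (mt this.2 hl),
          (h.mono hv).curDepth_eq (Nat.succ_pos _), ih (by omega)]
  obtain ⟨v, rfl⟩ : ∃ v, u = v + 1 := ⟨u - 1, by omega⟩
  exact key v le_rfl

theorem Agree.outDisp_eq (h : Agree u x y) (hu : 0 < u) : outDisp x u = outDisp y u := by
  unfold outDisp
  rw [h.excSide_eq hu, h.excStart_eq hu, h u le_rfl, h _ (excStart_le y u)]

theorem Agree.stage_eq (h : Agree u x y) (hu : 0 < u) : stage x u = stage y u := by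
  unfold stage
  rw [h.curDepth_eq hu, h.lastAlong_eq hu, h.outDisp_eq hu, h.maxDepth_eq hu]

theorem Agree.excProd_eq (h : Agree u x y) (hx : ValidUpTo southWest x u)
    (hy : ValidUpTo southWest y u) : excProd Φ J x u = excProd Φ J y u := by
  induction u with
  | zero => rfl
  | succ u ih =>
    rw [excProd, excProd, ih (h.mono (Nat.le_succ u)) (hx.mono (Nat.le_succ u))
      (hy.mono (Nat.le_succ u))]
    -- At time zero the orientation is not yet determined and locality fails; validity shows instead
    -- that no excursion ends there.
    rcases Nat.eq_zero_or_pos u with rfl | hu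
    · have hn : ∀ z, ValidUpTo southWest z 1 → ¬ Leaves z 0 := fun z hz hl => by
        have h1 := (stage_one hz).1
        rw [exc_succ_of_leaves hl] at h1
        omega
      rw [if_neg fun hh => hn x hx hh.1, if_neg fun hh => hn y hy hh.1]
    · have h' := h.mono (Nat.le_succ u)
      rw [h'.exc_eq hu, h'.outDisp_eq hu, h'.maxDepth_eq hu]
      have hiff : Leaves x u ∧ exc y u < J ↔ Leaves y u ∧ exc y u < J :=
        and_congr_left' (h.leaves_iff hu)
      by_cases hl : Leaves x u ∧ exc y u < J
      · rw [if_pos hl, if_pos (hiff.1 hl)]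
      · rw [if_neg hl, if_neg (mt hiff.2 hl)]

theorem Agree.potential_eq (h : Agree u x y) (hu : 0 < u) (hx : ValidUpTo southWest x u)
    (hy : ValidUpTo southWest y u) : potential Ψ Φ a J x u = potential Ψ Φ a J y u := by
  unfold potential
  rw [h.excProd_eq hx hy, h.exc_eq hu, h.stage_eq hu]

theorem excProd_nonneg (hp : ∀ k, IsPotential (Ψ k) (Φ k) (a k)) (h : ValidUpTo southWest x u) :
    0 ≤ excProd Φ J x u := by
  induction u with
  | zero => exact zero_le_one
  | succ u ih =>
    have h' := h.mono (Nat.le_succ u)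
    rw [excProd]
    refine mul_nonneg (ih h') ?_
    split_ifs with hl
    · rcases Nat.eq_zero_or_pos u with rfl | hu
      · have h1 := (stage_one h).1
        rw [exc_succ_of_leaves hl.1] at h1
        omega
      · refine (hp _).exit_nonneg _ _ (h'.outDisp_pos hu) ?_
        exact (h'.inExcursion hu).curDepth_nonneg.trans (h'.curDepth_le_maxDepth hu)
    · exact zero_le_one

theorem IsPotential.initial_nonneg {Ψ : Stage → ℝ} {Φ : ℤ → ℤ → ℝ} {a : ℝ}
    (h : IsPotential Ψ Φ a) : 0 ≤ a :=
  (h.nonneg 0 0 1 0 le_rfl le_rfl le_rfl (Or.inl rfl)).trans h.fresh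

theorem stage_nonneg (hp : ∀ k, IsPotential (Ψ k) (Φ k) (a k)) (h : ValidUpTo southWest x u)
    (hu : 0 < u) (k : ℕ) : 0 ≤ Ψ k (stage x u) :=
  (hp k).nonneg _ _ _ _ (h.inExcursion hu).curDepth_nonneg (h.curDepth_le_maxDepth hu)
    (h.outDisp_pos hu) (h.inExcursion hu).last_mem

theorem potential_nonneg (hp : ∀ k, IsPotential (Ψ k) (Φ k) (a k)) (h : ValidUpTo southWest x u)
    (hu : 0 < u) : 0 ≤ potential Ψ Φ a J x u := by
  unfold potential
  refine mul_nonneg (excProd_nonneg hp h) ?_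
  split_ifs
  · exact mul_nonneg (stage_nonneg hp h hu _)
      (Finset.prod_nonneg fun k _ => (hp k).initial_nonneg)
  · exact zero_le_one

/-- The value of the potential after a step that does not end the excursion. -/
theorem potential_succ_of_not_leaves (hl : ¬ Leaves x u) (hJ : exc x u < J) :
    potential Ψ Φ a J x (u + 1) = excProd Φ J x u * (∏ k ∈ Finset.Ico (exc x u + 1) J, a k) *
      Ψ (exc x u) (stage x (u + 1)) := by
  unfold potential
  rw [excProd, if_neg (fun hh => hl hh.1), exc_succ_of_not_leaves hl, if_pos hJ]
  ring

/-- The value of the potential after a step that ends the excursion. -/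
theorem potential_succ_of_leaves (hp : ∀ k, IsPotential (Ψ k) (Φ k) (a k))
    (h : ValidUpTo southWest x (u + 1)) (hu : 0 < u) (hl : Leaves x u) (hJ : exc x u < J) :
    potential Ψ Φ a J x (u + 1) ≤ excProd Φ J x u * (∏ k ∈ Finset.Ico (exc x u + 1) J, a k) *
      Φ (exc x u) (outDisp x u) (maxDepth x u) := by
  have h' := h.mono (Nat.le_succ u)
  have hE := h'.inExcursion hu
  have hst := hE.stage_succ_of_leaves (h.2 u (Nat.lt_succ_self u)) hl
  have hΦ : 0 ≤ Φ (exc x u) (outDisp x u) (maxDepth x u) :=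
    (hp _).exit_nonneg _ _ (h'.outDisp_pos hu) (hE.curDepth_nonneg.trans (h'.curDepth_le_maxDepth hu))
  have hP : 0 ≤ excProd Φ J x u := excProd_nonneg hp h'
  unfold potential
  rw [excProd, if_pos ⟨hl, hJ⟩, exc_succ_of_leaves hl, hst, mul_assoc, mul_assoc]
  refine mul_le_mul_of_nonneg_left ?_ hP
  rw [mul_comm]
  -- The factor `a` reserved for the next excursion pays for the value of its potential at the fresh
  -- stage.
  refine mul_le_mul_of_nonneg_right ?_ hΦ
  split_ifs with hJ'
  · rw [Finset.prod_eq_prod_Ico_succ_bot hJ']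
    exact mul_le_mul_of_nonneg_right (hp _).fresh
      (Finset.prod_nonneg fun k _ => (hp k).initial_nonneg)
  · rw [Finset.Ico_eq_empty (by omega), Finset.prod_empty]

theorem ValidUpTo.extendPath (h : ValidUpTo B x u) {e : Site}
    (he : e ∈ allowedDirections B x u) : ValidUpTo B (extendPath x u e) (u + 1) := by
  have hag := agree_extendPath x u e
  refine ⟨by rw [hag 0 (Nat.zero_le u), h.1], fun t ht => ?_⟩
  rcases Nat.lt_or_ge t u with h1 | h1
  · rw [hag _ (by omega), hag _ (by omega), (hag.mono h1.le).allowedDirections_eq]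
    exact h.2 t h1
  · obtain rfl : t = u := by omega
    rw [extendPath_succ, hag _ le_rfl, hag.allowedDirections_eq, add_sub_cancel_left]
    exact he

theorem sum_allowed_zero {w : ℕ → Site} {n : ℕ} {R : Fin 2 → Set ℤ} {i : Fin 2} {r : ℤ}
    (h : OnSide B w n R i r 0) (hr : r = 1 ∨ r = -1) (F : Site → ℝ) :
    ∑ e ∈ allowedDirections B w n, F e =
      F (siteOf i 0 r) + F (siteOf i 1 0) + F (siteOf i (-1) 0) := by
  classical
  rw [h.allowed_eq_of_zero hr, Finset.sum_insert, Finset.sum_insert, Finset.sum_singleton, add_assoc]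
  · simp [siteOf_inj]
  · simp [siteOf_inj]

theorem sum_allowed_ne {w : ℕ → Site} {n : ℕ} {R : Fin 2 → Set ℤ} {i : Fin 2} {r c : ℤ}
    (h : OnSide B w n R i r c) (hr : r = 1 ∨ r = -1) (hc : c = 1 ∨ c = -1) (F : Site → ℝ) :
    ∑ e ∈ allowedDirections B w n, F e = F (siteOf i 0 r) + F (siteOf i c 0) := by
  classical
  rw [h.allowed_eq_of_ne hr hc, Finset.sum_insert, Finset.sum_singleton]
  simp only [Finset.mem_singleton, siteOf_inj]
  omega

theorem card_allowed_zero {w : ℕ → Site} {n : ℕ} {R : Fin 2 → Set ℤ} {i : Fin 2} {r : ℤ}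
    (h : OnSide B w n R i r 0) (hr : r = 1 ∨ r = -1) : (allowedDirections B w n).card = 3 := by
  have := sum_allowed_zero h hr fun _ => 1
  simp only [Finset.sum_const, nsmul_eq_mul, mul_one] at this
  norm_num at this
  exact_mod_cast this

theorem card_allowed_ne {w : ℕ → Site} {n : ℕ} {R : Fin 2 → Set ℤ} {i : Fin 2} {r c : ℤ}
    (h : OnSide B w n R i r c) (hr : r = 1 ∨ r = -1) (hc : c = 1 ∨ c = -1) :
    (allowedDirections B w n).card = 2 := by
  have := sum_allowed_ne h hr hc fun _ => 1
  simp only [Finset.sum_const, nsmul_eq_mul, mul_one] at this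
  norm_num at this
  exact_mod_cast this

/-- The potential is a supermartingale. -/
theorem potential_average (hp : ∀ k, IsPotential (Ψ k) (Φ k) (a k))
    (h : ValidUpTo southWest x u) (hu : 0 < u) :
    ∑ e ∈ allowedDirections southWest x u, potential Ψ Φ a J (extendPath x u e) (u + 1) ≤
      (allowedDirections southWest x u).card * potential Ψ Φ a J x u := by
  have hE := h.inExcursion hu
  have hag := fun e => agree_extendPath x u e
  have hval := fun e (he : e ∈ allowedDirections southWest x u) => h.extendPath he
  have hval' := fun e (he : e ∈ allowedDirections southWest x u) => (hval e he).mono (Nat.le_succ u)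
  have hexc := fun e => (hag e).exc_eq hu
  by_cases hJ : exc x u < J
  swap
  -- Once `J` excursions are over, the potential no longer changes.
  · rw [← nsmul_eq_mul]
    refine Finset.sum_le_card_nsmul _ _ _ fun e he => le_of_eq ?_
    have : ¬ exc (extendPath x u e) (u + 1) < J := by
      have := exc_le_succ (extendPath x u e) u
      rw [hexc e] at this
      omega
    unfold potential
    rw [if_neg this, if_neg hJ, excProd, hexc e, if_neg fun hh => hJ hh.2, mul_one,
      (hag e).excProd_eq (hval' e he) h]
  set P := excProd Φ J x u * (∏ k ∈ Finset.Ico (exc x u + 1) J, a k) with hPdef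
  have hP : 0 ≤ P := mul_nonneg (excProd_nonneg hp h)
    (Finset.prod_nonneg fun k _ => (hp k).initial_nonneg)
  have hPe : ∀ e ∈ allowedDirections southWest x u,
      excProd Φ J (extendPath x u e) u *
        (∏ k ∈ Finset.Ico (exc (extendPath x u e) u + 1) J, a k) = P := by
    intro e he
    rw [hexc e, (hag e).excProd_eq (hval' e he) h]
  set i := excSide x u with hi
  set d := curDepth x u with hd
  set n := outDisp x u with hn
  set m := maxDepth x u with hm
  have hd0 : 0 ≤ d := hE.curDepth_nonneg
  have hdm : d ≤ m := h.curDepth_le_maxDepth hu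
  have hn1 : 1 ≤ n := h.outDisp_pos hu
  have hpot : potential Ψ Φ a J x u = P * Ψ (exc x u) ⟨d, lastAlong x u, n, m⟩ := by
    unfold potential
    rw [if_pos hJ, hPdef]
    change _ * (Ψ (exc x u) (stage x u) * _) = _ * Ψ (exc x u) (stage x u)
    ring
  have hs : ∀ e, extendPath x u e (u + 1) i - extendPath x u e u i = e i ∧
      extendPath x u e (u + 1) (i + 1) - extendPath x u e u (i + 1) = e (i + 1) := by
    intro e
    rw [extendPath_succ, extendPath_of_le _ _ le_rfl]
    simp
  have hleaves : ∀ e, Leaves (extendPath x u e) u ↔ d < e i := by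
    intro e
    unfold Leaves
    rw [(hag e).excSide_eq hu, (hag e).excStart_eq hu, extendPath_succ,
      hag e _ (excStart_le x u), hd]
    unfold curDepth
    simp only [Pi.add_apply, hi]
    omega
  have hstage : ∀ e, ¬ d < e i → stage (extendPath x u e) (u + 1) =
      ⟨d - e i, e i, n + e (i + 1), max m (d - e i)⟩ := by
    intro e he
    rw [InExcursion.stage_succ_of_not_leaves (mt (hleaves e).1 he), (hag e).excSide_eq hu, ← hi,
      (hs e).1, (hs e).2, (hag e).curDepth_eq hu, (hag e).outDisp_eq hu, (hag e).maxDepth_eq hu]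
  have hout : siteOf i 0 1 ∈ allowedDirections southWest x u →
      potential Ψ Φ a J (extendPath x u (siteOf i 0 1)) (u + 1) =
        P * Ψ (exc x u) ⟨d, 0, n + 1, m⟩ := by
    intro he
    have hnl : ¬ d < siteOf i 0 1 i := by rw [siteOf_self]; omega
    rw [potential_succ_of_not_leaves (mt (hleaves _).1 hnl) (by rwa [hexc]), hPe _ he, hexc,
      hstage _ hnl, siteOf_self, siteOf_other, sub_zero, max_eq_left hdm]
  have hdown : siteOf i (-1) 0 ∈ allowedDirections southWest x u →
      potential Ψ Φ a J (extendPath x u (siteOf i (-1) 0)) (u + 1) =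
        P * Ψ (exc x u) ⟨d + 1, -1, n, max m (d + 1)⟩ := by
    intro he
    have hnl : ¬ d < siteOf i (-1) 0 i := by rw [siteOf_self]; omega
    rw [potential_succ_of_not_leaves (mt (hleaves _).1 hnl) (by rwa [hexc]), hPe _ he, hexc,
      hstage _ hnl, siteOf_self, siteOf_other, add_zero, sub_neg_eq_add]
  have hup : siteOf i 1 0 ∈ allowedDirections southWest x u →
      potential Ψ Φ a J (extendPath x u (siteOf i 1 0)) (u + 1) ≤
        P * upValue (Ψ (exc x u)) (Φ (exc x u)) d n m := by
    intro he
    unfold upValue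
    split_ifs with h0
    · have hl : d < siteOf i 1 0 i := by rw [siteOf_self]; omega
      have := potential_succ_of_leaves (J := J) hp (hval _ he) hu ((hleaves _).2 hl) (by rwa [hexc])
      rwa [hPe _ he, hexc, (hag _).outDisp_eq hu, (hag _).maxDepth_eq hu] at this
    · have hnl : ¬ d < siteOf i 1 0 i := by rw [siteOf_self]; omega
      rw [potential_succ_of_not_leaves (mt (hleaves _).1 hnl) (by rwa [hexc]), hPe _ he, hexc,
        hstage _ hnl, siteOf_self, siteOf_other, add_zero, max_eq_left (by omega)]
  have hOS := hE.onSide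
  rw [← hi] at hOS
  rw [hpot]
  rcases hE.last_mem with hc | hc | hc <;> rw [hc] at hOS ⊢
  · have hm := fun e => hOS.mem_allowed_iff (Or.inl rfl) (Or.inl rfl) (e := e)
    rw [sum_allowed_zero hOS (Or.inl rfl), card_allowed_zero hOS (Or.inl rfl),
      hout ((hm _).2 (by simp)), hdown ((hm _).2 (by simp))]
    have h1 := hup ((hm _).2 (by simp))
    have h2 := mul_le_mul_of_nonneg_left ((hp (exc x u)).average_out d n m hd0 hdm hn1) hP
    push_cast
    linarith
  · have hm := fun e => hOS.mem_allowed_iff (Or.inl rfl) (Or.inr (Or.inl rfl)) (e := e)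
    rw [sum_allowed_ne hOS (Or.inl rfl) (Or.inl rfl), card_allowed_ne hOS (Or.inl rfl) (Or.inl rfl),
      hout ((hm _).2 (by simp))]
    have h1 := hup ((hm _).2 (by simp))
    have h2 := mul_le_mul_of_nonneg_left ((hp (exc x u)).average_up d n m hd0 hdm hn1) hP
    push_cast
    linarith
  · have hm := fun e => hOS.mem_allowed_iff (Or.inl rfl) (Or.inr (Or.inr rfl)) (e := e)
    rw [sum_allowed_ne hOS (Or.inl rfl) (Or.inr rfl), card_allowed_ne hOS (Or.inl rfl) (Or.inr rfl),
      hout ((hm _).2 (by simp)), hdown ((hm _).2 (by simp))]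
    have h2 := mul_le_mul_of_nonneg_left ((hp (exc x u)).average_down d n m hd0 hdm hn1) hP
    push_cast
    linarith

theorem potential_one_le (hp : ∀ k, IsPotential (Ψ k) (Φ k) (a k)) (h : ValidUpTo southWest x 1) :
    potential Ψ Φ a J x 1 ≤ ∏ k ∈ Finset.range J, a k := by
  obtain ⟨h0, hs⟩ := stage_one h
  have hl : ¬ Leaves x 0 := fun hl => by
    rw [exc_succ_of_leaves hl] at h0
    omega
  unfold potential
  rw [excProd, if_neg fun hh => hl hh.1, h0, hs, Finset.range_eq_Ico, excProd, one_mul, one_mul]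
  split_ifs with hJ
  · rw [Finset.prod_eq_prod_Ico_succ_bot hJ]
    exact mul_le_mul_of_nonneg_right (hp 0).fresh
      (Finset.prod_nonneg fun k _ => (hp k).initial_nonneg)
  · rw [Finset.Ico_eq_empty (by omega), Finset.prod_empty]

variable {Ω : Type*} [MeasurableSpace Ω] {μ : Measure Ω} {X : ℕ → Ω → Site}

/-- The expected potential is at most the product of the initial values. -/
theorem lintegral_potential_le [IsProbabilityMeasure μ] (hX : IsCornerWalk μ X)
    (hp : ∀ k, IsPotential (Ψ k) (Φ k) (a k)) (u : ℕ) :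
    ∫⁻ ω, ENNReal.ofReal (potential Ψ Φ a J (trajectory X ω) (u + 1)) ∂μ ≤
      ENNReal.ofReal (∏ k ∈ Finset.range J, a k) := by
  classical
  induction u with
  | zero =>
    calc _ ≤ ∫⁻ _, ENNReal.ofReal (∏ k ∈ Finset.range J, a k) ∂μ := by
          refine lintegral_mono_ae ?_
          filter_upwards [hX.ae_valid] with ω hω
          exact ENNReal.ofReal_le_ofReal (potential_one_le hp (hω 1))
      _ = _ := by simp
  | succ u ih =>
    refine le_trans ?_ ih
    -- Locality of the potential is available only for valid paths; cutting it off elsewhere gives a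
    -- local function with the same integral.
    let V : ℕ → (ℕ → Site) → ℝ≥0∞ := fun v x =>
      if ValidUpTo southWest x v then ENNReal.ofReal (potential Ψ Φ a J x v) else 0
    have hV : ∀ v, ∫⁻ ω, ENNReal.ofReal (potential Ψ Φ a J (trajectory X ω) v) ∂μ =
        ∫⁻ ω, V v (trajectory X ω) ∂μ := by
      intro v
      refine lintegral_congr_ae ?_
      filter_upwards [hX.ae_valid] with ω hω
      simp only [V, if_pos (hω v)]
    rw [hV, hV]
    refine hX.lintegral_le (u + 1) ?_ ?_
    · intro x y hxy
      have hiff := hxy.validUpTo_iff (B := southWest)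
      by_cases hx : ValidUpTo southWest x (u + 1 + 1)
      · simp only [V, if_pos hx, if_pos (hiff.1 hx),
          hxy.potential_eq (Nat.succ_pos _) hx (hiff.1 hx)]
      · simp only [V, if_neg hx, if_neg (mt hiff.2 hx)]
    · intro x hx
      simp only [V, if_pos hx]
      calc _ ≤ ∑ e ∈ allowedDirections southWest x (u + 1),
            ENNReal.ofReal (potential Ψ Φ a J (extendPath x (u + 1) e) (u + 1 + 1)) := by
            refine Finset.sum_le_sum fun e _ => ?_
            split_ifs
            exacts [le_rfl, zero_le]
        _ = ENNReal.ofReal (∑ e ∈ allowedDirections southWest x (u + 1),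
              potential Ψ Φ a J (extendPath x (u + 1) e) (u + 1 + 1)) := by
            refine (ENNReal.ofReal_sum_of_nonneg fun e he => ?_).symm
            exact potential_nonneg hp (hx.extendPath he) (Nat.succ_pos _)
        _ ≤ ENNReal.ofReal ((allowedDirections southWest x (u + 1)).card *
              potential Ψ Φ a J x (u + 1)) :=
            ENNReal.ofReal_le_ofReal (potential_average hp hx (Nat.succ_pos _))
        _ = _ := by
            rw [ENNReal.ofReal_mul (Nat.cast_nonneg _), ENNReal.ofReal_natCast]

end PrudentWalk

namespace PrudentWalk

/-! ### Some potentials -/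

theorem isPotential_one : IsPotential (fun _ => 1) (fun _ _ => 1) 1 := by
  refine ⟨?_, ?_, le_rfl, ?_, ?_, ?_⟩ <;> intros <;> (try unfold upValue) <;> norm_num

theorem IsPotential.add {Ψ Ψ' : Stage → ℝ} {Φ Φ' : ℤ → ℤ → ℝ} {a a' : ℝ}
    (h : IsPotential Ψ Φ a) (h' : IsPotential Ψ' Φ' a') :
    IsPotential (fun s => Ψ s + Ψ' s) (fun n m => Φ n m + Φ' n m) (a + a') := by
  have hup : ∀ d n m, upValue (fun s => Ψ s + Ψ' s) (fun n m => Φ n m + Φ' n m) d n m =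
      upValue Ψ Φ d n m + upValue Ψ' Φ' d n m := by
    intro d n m
    unfold upValue
    split_ifs <;> rfl
  refine ⟨?_, ?_, add_le_add h.fresh h'.fresh, ?_, ?_, ?_⟩
  · intro d c n m h1 h2 h3 h4
    exact add_nonneg (h.nonneg d c n m h1 h2 h3 h4) (h'.nonneg d c n m h1 h2 h3 h4)
  · intro n m h1 h2
    exact add_nonneg (h.exit_nonneg n m h1 h2) (h'.exit_nonneg n m h1 h2)
  · intro d n m h1 h2 h3
    rw [hup]
    linarith [h.average_out d n m h1 h2 h3, h'.average_out d n m h1 h2 h3]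
  · intro d n m h1 h2 h3
    rw [hup]
    linarith [h.average_up d n m h1 h2 h3, h'.average_up d n m h1 h2 h3]
  · intro d n m h1 h2 h3
    linarith [h.average_down d n m h1 h2 h3, h'.average_down d n m h1 h2 h3]

/-- The probability of reaching depth `K` before the end of the excursion. -/
noncomputable def deepPot (K : ℤ) (s : Stage) : ℝ :=
  if K ≤ s.deepest then 1 else (s.depth + 2 - s.last : ℝ) / (K + 3)

/-- The indicator of the event that the maximal depth is at least `K`. -/
noncomputable def deepExit (K : ℤ) (_ m : ℤ) : ℝ := if K ≤ m then 1 else 0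

/-- The function `d + 2 - c` is harmonic: its values after an outward step, a step towards the
corner and a step away from it are `d + 2`, `d` and `d + 4`, and the averages over the allowed steps
are `d + 2 - c`. It is `0` on leaving, `K + 3` on reaching depth `K` and `2` at the start. -/
theorem isPotential_deep {K : ℤ} (hK : 1 ≤ K) :
    IsPotential (deepPot K) (deepExit K) (2 / (K + 3)) := by
  have hK' : (1 : ℝ) ≤ K := by exact_mod_cast hK
  have hpos : (0 : ℝ) < K + 3 := by linarith
  have hdown : ∀ d n m : ℤ, d ≤ m → ¬ K ≤ m →
      deepPot K ⟨d + 1, -1, n, max m (d + 1)⟩ = (d + 4 : ℝ) / (K + 3) := by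
    intro d n m h1 h2
    unfold deepPot
    simp only
    split_ifs with h3
    · have : K = d + 1 := by
        rcases le_max_iff.1 h3 with h | h <;> omega
      rw [eq_div_iff hpos.ne', this]; push_cast; ring
    · push_cast; congr 1; ring
  have hup : ∀ d n m : ℤ, ¬ K ≤ m → upValue (deepPot K) (deepExit K) d n m = (d : ℝ) / (K + 3) := by
    intro d n m h2
    unfold upValue deepExit deepPot
    simp only [if_neg h2]
    split_ifs with h3
    · rw [h3]; simp
    · push_cast; congr 1; ring
  have hdeep : ∀ d c n m : ℤ, K ≤ m → deepPot K ⟨d, c, n, m⟩ = 1 := fun d c n m h => if_pos h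
  have hnd : ∀ d c n m : ℤ, ¬ K ≤ m → deepPot K ⟨d, c, n, m⟩ = (d + 2 - c : ℝ) / (K + 3) :=
    fun d c n m h => if_neg h
  have hupd : ∀ d n m : ℤ, K ≤ m → upValue (deepPot K) (deepExit K) d n m = 1 := by
    intro d n m h2
    unfold upValue deepExit
    rw [if_pos h2, hdeep _ _ _ _ h2, ite_self]
  refine ⟨?_, ?_, ?_, ?_, ?_, ?_⟩
  · intro d c n m h1 h2 h3 h4
    by_cases hm : K ≤ m
    · rw [hdeep _ _ _ _ hm]; exact zero_le_one
    · rw [hnd _ _ _ _ hm]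
      have : (0 : ℝ) ≤ d + 2 - c := by
        have : (0 : ℤ) ≤ d + 2 - c := by omega
        exact_mod_cast this
      positivity
  · intro n m _ _
    unfold deepExit
    split_ifs <;> norm_num
  · rw [hnd _ _ _ _ (by omega)]; simp
  · intro d n m h1 h2 h3
    by_cases hm : K ≤ m
    · rw [hdeep _ _ _ _ hm, hdeep _ _ _ _ hm, hupd _ _ _ hm, hdeep _ _ _ _ (le_max_of_le_left hm)]
      norm_num
    · rw [hnd _ _ _ _ hm, hnd _ _ _ _ hm, hup _ _ _ hm, hdown _ _ _ h2 hm]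
      refine le_of_eq ?_
      field_simp; push_cast; ring
  · intro d n m h1 h2 h3
    by_cases hm : K ≤ m
    · rw [hdeep _ _ _ _ hm, hdeep _ _ _ _ hm, hupd _ _ _ hm]
      norm_num
    · rw [hnd _ _ _ _ hm, hnd _ _ _ _ hm, hup _ _ _ hm]
      refine le_of_eq ?_
      field_simp; push_cast; ring
  · intro d n m h1 h2 h3
    by_cases hm : K ≤ m
    · rw [hdeep _ _ _ _ hm, hdeep _ _ _ _ hm, hdeep _ _ _ _ (le_max_of_le_left hm)]
      norm_num
    · rw [hnd _ _ _ _ hm, hnd _ _ _ _ hm, hdown _ _ _ h2 hm]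
      refine le_of_eq ?_
      field_simp; push_cast; ring

/-! ### Generating function of the outward displacement -/

/-- The parameter at which the generating function of the outward displacement of an excursion
equals `1 - 2 * δ`. -/
noncomputable def genParam (δ : ℝ) : ℝ := (1 + 2 * δ ^ 2 / ((1 - 2 * δ) * (1 + δ)))⁻¹

/-- The generating function, at `genParam δ`, of the outward displacement of an excursion. -/
noncomputable def genPot (δ : ℝ) (s : Stage) : ℝ :=
  genParam δ ^ s.disp * (1 - δ) ^ s.depth *
    (if s.last = 1 then 1 - δ else if s.last = 0 then (1 - 2 * δ) / genParam δ
      else (1 - 2 * δ) / (1 + δ))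

noncomputable def genExit (δ : ℝ) (n _ : ℤ) : ℝ := genParam δ ^ n

section

variable {δ : ℝ}

theorem genParam_pos (h0 : 0 < δ) (h1 : δ ≤ 1 / 4) : 0 < genParam δ := by
  have : 0 < 1 - 2 * δ := by linarith
  unfold genParam; positivity

/-- The quadratic order in `δ`, against the linear loss in `1 - 2 * δ`, is what makes total
displacements grow faster than linearly in the number of excursions. -/
theorem inv_genParam_le (h0 : 0 < δ) (h1 : δ ≤ 1 / 4) : (genParam δ)⁻¹ ≤ 1 + 4 * δ ^ 2 := by
  have h2 : 0 < (1 - 2 * δ) * (1 + δ) := mul_pos (by linarith) (by linarith)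
  unfold genParam
  rw [inv_inv]
  gcongr
  rw [div_le_iff₀ h2]
  have h3 : 1 / 2 ≤ (1 - 2 * δ) * (1 + δ) := by nlinarith
  nlinarith [mul_le_mul_of_nonneg_left h3 (sq_nonneg δ)]

theorem genParam_lt_one (h0 : 0 < δ) (h1 : δ ≤ 1 / 4) : genParam δ < 1 := by
  have : 0 < 1 - 2 * δ := by linarith
  unfold genParam
  refine inv_lt_one_of_one_lt₀ ?_
  have : 0 < 2 * δ ^ 2 / ((1 - 2 * δ) * (1 + δ)) := by positivity
  linarith

/-- In the ansatz `genParam δ ^ n * (1 - δ) ^ d * C c`, a step towards the corner has value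
`genParam δ ^ n * (1 - δ) ^ d` whether or not it ends the excursion. This equation gives `C 1 = 1 -
δ` once `genParam δ * C 0 = 1 - 2 * δ`; `genPot_down` gives `C (-1)`. -/
theorem genPot_up (h0 : 0 < δ) (h1 : δ ≤ 1 / 4) (d n m : ℤ) :
    genPot δ ⟨d, 0, n + 1, m⟩ + genParam δ ^ n * (1 - δ) ^ d = 2 * genPot δ ⟨d, 1, n, m⟩ := by
  have hl := (genParam_pos h0 h1).ne'
  unfold genPot
  simp only [zpow_add_one₀ hl, zero_ne_one, if_false, if_true]
  field_simp
  ring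

theorem genPot_down (h0 : 0 < δ) (h1 : δ ≤ 1 / 4) (d n m m' : ℤ) :
    genPot δ ⟨d, 0, n + 1, m⟩ + genPot δ ⟨d + 1, -1, n, m'⟩ = 2 * genPot δ ⟨d, -1, n, m⟩ := by
  have hl := (genParam_pos h0 h1).ne'
  have h3 : (1 - δ) ≠ 0 := by linarith
  have h4 : (1 + δ) ≠ 0 := by linarith
  unfold genPot
  simp only [zpow_add_one₀ hl, zpow_add_one₀ h3, zero_ne_one, if_false, if_true,
    show ¬ ((-1 : ℤ) = 1) by decide, show ¬ ((-1 : ℤ) = 0) by decide]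
  field_simp
  ring

/-- With the coefficients fixed by the two other equations, this one determines `genParam δ`. -/
theorem genPot_out (h0 : 0 < δ) (h1 : δ ≤ 1 / 4) (d n m m' : ℤ) :
    genPot δ ⟨d, 0, n + 1, m⟩ + genParam δ ^ n * (1 - δ) ^ d + genPot δ ⟨d + 1, -1, n, m'⟩ =
      3 * genPot δ ⟨d, 0, n, m⟩ := by
  have hl := (genParam_pos h0 h1).ne'
  have h2 : (1 - 2 * δ) ≠ 0 := by linarith
  have h3 : (1 - δ) ≠ 0 := by linarith
  have h4 : (1 + δ) ≠ 0 := by linarith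
  have h5 : (1 - 2 * δ) / genParam δ = (1 - 2 * δ) + 2 * δ ^ 2 / (1 + δ) := by
    unfold genParam
    rw [div_inv_eq_mul]
    field_simp
  unfold genPot
  simp only [zero_ne_one, if_false, if_true,
    show ¬ ((-1 : ℤ) = 1) by decide, show ¬ ((-1 : ℤ) = 0) by decide]
  have h6 : genParam δ ^ (n + 1) * (1 - δ) ^ d * ((1 - 2 * δ) / genParam δ) =
      genParam δ ^ n * (1 - δ) ^ d * (1 - 2 * δ) := by
    rw [zpow_add_one₀ hl]; field_simp
  rw [h6, h5, zpow_add_one₀ h3]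
  field_simp
  ring

theorem genPot_upValue (h0 : 0 < δ) (h1 : δ ≤ 1 / 4) (d n m : ℤ) :
    upValue (genPot δ) (genExit δ) d n m = genParam δ ^ n * (1 - δ) ^ d := by
  have h3 : (1 - δ) ≠ 0 := by linarith
  unfold upValue genExit genPot
  by_cases hd : d = 0
  · rw [if_pos hd, hd]; simp
  · rw [if_neg hd]
    simp only [if_true]
    rw [mul_assoc, ← zpow_add_one₀ h3, sub_add_cancel]

theorem genPot_fresh (h0 : 0 < δ) (h1 : δ ≤ 1 / 4) : genPot δ ⟨0, 0, 1, 0⟩ = 1 - 2 * δ := by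
  have hl := (genParam_pos h0 h1).ne'
  unfold genPot
  simp only [zero_ne_one, if_false, if_true, zpow_one, zpow_zero, mul_one]
  field_simp

theorem genPot_nonneg (h0 : 0 < δ) (h1 : δ ≤ 1 / 4) (s : Stage) : 0 ≤ genPot δ s := by
  have hl := genParam_pos h0 h1
  have h2 : 0 < (1 - 2 * δ) := by linarith
  have h3 : 0 < (1 - δ) := by linarith
  unfold genPot
  split_ifs <;> positivity

theorem genPot_le (h0 : 0 < δ) (h1 : δ ≤ 1 / 4) (s : Stage) :
    genPot δ s ≤ genParam δ ^ (s.disp - 1) * (1 - δ) ^ s.depth := by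
  have hl := genParam_pos h0 h1
  have hl1 := genParam_lt_one h0 h1
  have h2 : 0 < (1 - 2 * δ) := by linarith
  have h3 : 0 < (1 - δ) := by linarith
  unfold genPot
  rw [zpow_sub_one₀ hl.ne', mul_right_comm (genParam δ ^ s.disp) (genParam δ)⁻¹]
  refine mul_le_mul_of_nonneg_left ?_ (by positivity)
  have h5 : 1 ≤ (genParam δ)⁻¹ := (one_le_inv₀ hl).2 hl1.le
  split_ifs
  · linarith
  · rw [div_eq_mul_inv]
    exact mul_le_of_le_one_left (by positivity) (by linarith)
  · refine le_trans ?_ h5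
    rw [div_le_one (by linarith)]
    linarith

theorem isPotential_gen (h0 : 0 < δ) (h1 : δ ≤ 1 / 4) :
    IsPotential (genPot δ) (genExit δ) (1 - 2 * δ) := by
  refine ⟨fun d c n m _ _ _ _ => genPot_nonneg h0 h1 _, fun n m _ _ => ?_,
    (genPot_fresh h0 h1).le, ?_, ?_, ?_⟩
  · exact zpow_nonneg (genParam_pos h0 h1).le n
  · intro d n m _ _ _
    rw [genPot_upValue h0 h1]
    exact (genPot_out h0 h1 d n m _).le
  · intro d n m _ _ _
    rw [genPot_upValue h0 h1]
    exact (genPot_up h0 h1 d n m).le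
  · intro d n m _ _ _
    exact (genPot_down h0 h1 d n m _).le

theorem zpow_mul_zpow_le_one {p q : ℝ} (hp : 0 < p) (hp1 : p ≤ 1) (hq : 0 < q) (hq1 : q ≤ 1)
    {n d : ℤ} (hn : 0 ≤ n) (hd : 0 ≤ d) : p ^ n * q ^ d ≤ 1 := by
  lift n to ℕ using hn
  lift d to ℕ using hd
  rw [zpow_natCast, zpow_natCast]
  exact mul_le_one₀ (pow_le_one₀ hp.le hp1) (by positivity) (pow_le_one₀ hq.le hq1)

/-- A potential that vanishes at the end of the excursion but not if the excursion never ends. -/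
theorem isPotential_one_sub_gen (h0 : 0 < δ) (h1 : δ ≤ 1 / 4) :
    IsPotential (fun s => 1 - genPot δ s) (fun _ _ => 0) (2 * δ) := by
  have hl := genParam_pos h0 h1
  have hl1 := genParam_lt_one h0 h1
  have h3 : 0 < (1 - δ) := by linarith
  -- Harmonicity becomes an inequality because the final value is lowered from `1 - genExit` to
  -- zero.
  have hup : ∀ d n m : ℤ, 0 ≤ d → 1 ≤ n →
      upValue (fun s => 1 - genPot δ s) (fun _ _ => 0) d n m ≤
        1 - genParam δ ^ n * (1 - δ) ^ d := by
    intro d n m hd hn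
    rw [← genPot_upValue h0 h1 d n m]
    unfold upValue
    split_ifs with h
    · have := zpow_mul_zpow_le_one hl hl1.le h3 (by linarith) (by omega : 0 ≤ n) le_rfl
      rw [zpow_zero, mul_one] at this
      unfold genExit
      linarith
    · exact le_rfl
  refine ⟨fun d c n m hd _ hn _ => ?_, fun _ _ _ _ => le_rfl, ?_, ?_, ?_, ?_⟩
  · have h4 := genPot_le h0 h1 ⟨d, c, n, m⟩
    have h5 := zpow_mul_zpow_le_one hl hl1.le h3 (by linarith) (by omega : 0 ≤ n - 1) hd
    simp only at h4
    linarith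
  · rw [genPot_fresh h0 h1]; linarith
  · intro d n m hd _ hn
    linarith [hup d n m hd hn, genPot_out h0 h1 d n m (max m (d + 1))]
  · intro d n m hd _ hn
    linarith [hup d n m hd hn, genPot_up h0 h1 d n m]
  · intro d n m hd _ hn
    linarith [genPot_down h0 h1 d n m (max m (d + 1))]

end

/-! ### Consequences of the supermartingale property -/

/-- The potential `Ψ` for the excursions in `S`, and a constant potential for the others. -/
noncomputable def selectPot (S : Finset ℕ) (Ψ : Stage → ℝ) (k : ℕ) : Stage → ℝ :=
  if k ∈ S then Ψ else fun _ => 1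

/-- The final values of `selectPot`. -/
noncomputable def selectExit (S : Finset ℕ) (Φ : ℤ → ℤ → ℝ) (k : ℕ) : ℤ → ℤ → ℝ :=
  if k ∈ S then Φ else fun _ _ => 1

/-- The initial values of `selectPot`. -/
noncomputable def selectInit (S : Finset ℕ) (a : ℝ) (k : ℕ) : ℝ := if k ∈ S then a else 1

theorem isPotential_select (S : Finset ℕ) {Ψ : Stage → ℝ} {Φ : ℤ → ℤ → ℝ} {a : ℝ}
    (h : IsPotential Ψ Φ a) (k : ℕ) :
    IsPotential (selectPot S Ψ k) (selectExit S Φ k) (selectInit S a k) := by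
  unfold selectPot selectExit selectInit
  split_ifs
  exacts [h, isPotential_one]

theorem prod_selectInit {S : Finset ℕ} {J : ℕ} (hS : S ⊆ Finset.range J) (a : ℝ) :
    ∏ k ∈ Finset.range J, selectInit S a k = a ^ S.card := by
  unfold selectInit
  rw [Finset.prod_ite_mem, Finset.inter_eq_right.2 hS, Finset.prod_const]

variable {Ω : Type*} [MeasurableSpace Ω] {μ : Measure Ω} {X : ℕ → Ω → Site}

/-- A function of finitely many positions factors through a countable discrete space, on which
everything is measurable. -/
theorem measurable_of_agree (hX : ∀ t, Measurable (X t)) {β : Type*} [MeasurableSpace β] (u : ℕ)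
    {F : (ℕ → Site) → β} (hF : ∀ x y, Agree u x y → F x = F y) :
    Measurable fun ω => F (trajectory X ω) := by
  have : (fun ω => F (trajectory X ω)) = fun ω => F (pieceToPath (initialPiece X u ω)) := by
    funext ω
    exact (hF _ _ (agree_pieceToPath u ω)).symm
  rw [this]
  exact (Measurable.of_discrete (f := fun p : Fin (u + 1) → Site => F (pieceToPath p))).comp
    (measurable_initialPiece hX u)

variable {Ψ : ℕ → Stage → ℝ} {Φ : ℕ → ℤ → ℤ → ℝ} {a : ℕ → ℝ} {J : ℕ}

/-- A bound for the probability that the potential is eventually at least `b`. -/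
theorem measure_le_of_potential [IsProbabilityMeasure μ] (hX : IsCornerWalk μ X)
    (hp : ∀ k, IsPotential (Ψ k) (Φ k) (a k)) {b : ℝ} {S : Set Ω}
    (hS : ∀ᵐ ω ∂μ, ω ∈ S → ∀ᶠ u in atTop, b ≤ potential Ψ Φ a J (trajectory X ω) u) :
    ENNReal.ofReal b * μ S ≤ ENNReal.ofReal (∏ k ∈ Finset.range J, a k) := by
  classical
  -- These events increase with `v` and exhaust `S` almost surely, so Markov's inequality at the
  -- single time `v + 1` suffices.
  let A : ℕ → Set Ω := fun v => {ω | ∀ u ≥ v, b ≤ potential Ψ Φ a J (trajectory X ω) u}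
  have hmono : Monotone A := fun v w hvw ω hω u hu => hω u (hvw.trans hu)
  have hSA : μ S ≤ μ (⋃ v, A v) := by
    refine measure_mono_ae ?_
    filter_upwards [hS] with ω hω hωS
    obtain ⟨v, hv⟩ := eventually_atTop.1 (hω hωS)
    exact Set.mem_iUnion.2 ⟨v, hv⟩
  refine (mul_le_mul_right hSA _).trans ?_
  rw [hmono.measure_iUnion, ENNReal.mul_iSup]
  refine iSup_le fun v => ?_
  have hmeas : AEMeasurable
      (fun ω => ENNReal.ofReal (potential Ψ Φ a J (trajectory X ω) (v + 1))) μ := by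
    refine ⟨fun ω => if ValidUpTo southWest (trajectory X ω) (v + 1) then
      ENNReal.ofReal (potential Ψ Φ a J (trajectory X ω) (v + 1)) else 0, ?_, ?_⟩
    · refine measurable_of_agree hX.measurable (v + 1) (F := fun x =>
        if ValidUpTo southWest x (v + 1) then ENNReal.ofReal (potential Ψ Φ a J x (v + 1)) else 0) ?_
      intro x y hxy
      by_cases hx : ValidUpTo southWest x (v + 1)
      · simp only [if_pos hx, if_pos (hxy.validUpTo_iff.1 hx),
          hxy.potential_eq (Nat.succ_pos _) hx (hxy.validUpTo_iff.1 hx)]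
      · simp only [if_neg hx, if_neg (mt hxy.validUpTo_iff.2 hx)]
    · filter_upwards [hX.ae_valid] with ω hω
      rw [if_pos (hω (v + 1))]
  calc ENNReal.ofReal b * μ (A v)
      ≤ ENNReal.ofReal b * μ {ω | ENNReal.ofReal b ≤
          ENNReal.ofReal (potential Ψ Φ a J (trajectory X ω) (v + 1))} := by
        gcongr
        exact fun ω hω => ENNReal.ofReal_le_ofReal (hω (v + 1) (Nat.le_succ v))
    _ ≤ _ := mul_meas_ge_le_lintegral₀ hmeas _
    _ ≤ _ := lintegral_potential_le hX hp v

end PrudentWalk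

namespace PrudentWalk

/-! ### All excursions are finite -/

variable {x y : ℕ → Site} {u : ℕ}

theorem not_leaves_zero (h : ValidUpTo southWest x 1) : ¬ Leaves x 0 := fun hl => by
  have h1 := (stage_one h).1
  rw [exc_succ_of_leaves hl] at h1
  omega

/-- During an excursion that never ends, the outward displacement or the depth tends to infinity. -/
theorem unbounded_of_not_leaves (hx : ∀ u, ValidUpTo southWest x u) {u₀ : ℕ} (hu₀ : 0 < u₀)
    (hl : ∀ u ≥ u₀, ¬ Leaves x u) (C : ℤ) :
    ∃ v, (∀ u ≥ v, C ≤ outDisp x u) ∨ (∀ u ≥ v, C ≤ curDepth x u) := by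
  have hE : ∀ u ≥ u₀, InExcursion x u := fun u hu => (hx u).inExcursion (by omega)
  have hcase : ∀ u ≥ u₀, (outDisp x (u + 1) = outDisp x u + 1) ∨
      (outDisp x (u + 1) = outDisp x u ∧ curDepth x (u + 1) = curDepth x u - lastAlong x (u + 1) ∧
        (lastAlong x (u + 1) = 1 ∨ lastAlong x (u + 1) = -1) ∧
        (lastAlong x u = 0 ∨ lastAlong x u = lastAlong x (u + 1))) := by
    intro u hu
    have hs := InExcursion.stage_succ_of_not_leaves (hl u hu)
    have h1 : outDisp x (u + 1) = _ := congrArg Stage.disp hs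
    have h2 : curDepth x (u + 1) = _ := congrArg Stage.depth hs
    have h3 : lastAlong x (u + 1) = _ := congrArg Stage.last hs
    simp only at h1 h2 h3
    rcases (hE u hu).step_cases ((hx (u + 1)).2 u (Nat.lt_succ_self u)) with
      ⟨-, h4, h5⟩ | ⟨h4, c, h5, h6, h7, -⟩
    · left; omega
    · right; omega
  have hmono1 : ∀ u ≥ u₀, outDisp x u ≤ outDisp x (u + 1) := by
    intro u hu
    rcases hcase u hu with h | h <;> omega
  have hmono : ∀ u ≥ u₀, ∀ v ≥ u, outDisp x u ≤ outDisp x v := by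
    intro u hu v hv
    induction v, hv using Nat.le_induction with
    | base => exact le_rfl
    | succ v hv ih => exact ih.trans (hmono1 v (by omega))
  -- The displacement is nondecreasing. If it stays bounded it is eventually constant, so all later
  -- steps are along the side in one direction, which cannot be towards the corner since the depth
  -- is nonnegative.
  by_cases hunb : ∃ v ≥ u₀, C ≤ outDisp x v
  · obtain ⟨v, hv, hC⟩ := hunb
    exact ⟨v, Or.inl fun u hu => hC.trans (hmono v hv u hu)⟩
  · push Not at hunb
    obtain ⟨v, hv, hmax⟩ : ∃ v ≥ u₀, ∀ u ≥ u₀, outDisp x u ≤ outDisp x v := by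
      by_contra! hcon
      have hgrow : ∀ k : ℕ, ∃ v ≥ u₀, (k : ℤ) ≤ outDisp x v := by
        intro k
        induction k with
        | zero => exact ⟨u₀, le_rfl, by have := (hx u₀).outDisp_pos hu₀; push_cast; omega⟩
        | succ k ih =>
          obtain ⟨v, hv, hk⟩ := ih
          obtain ⟨w, hw, hlt⟩ := hcon v hv
          exact ⟨w, hw, by push_cast; omega⟩
      obtain ⟨w, hw, hk⟩ := hgrow C.toNat
      have := hunb w hw
      omega
    have hvert : ∀ k : ℕ, curDepth x (v + 1 + k) =
        curDepth x (v + 1) - k * lastAlong x (v + 1) ∧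
        lastAlong x (v + 1 + k) = lastAlong x (v + 1) ∧
        (lastAlong x (v + 1) = 1 ∨ lastAlong x (v + 1) = -1) := by
      intro k
      have hconst : ∀ u ≥ v, outDisp x (u + 1) = outDisp x u := fun u hu =>
        le_antisymm ((hmax _ (by omega)).trans (hmono v hv u hu)) (hmono1 u (by omega))
      induction k with
      | zero =>
        rcases hcase v hv with h | h
        · have := hconst v le_rfl; omega
        · exact ⟨by simp, rfl, h.2.2.1⟩
      | succ k ih =>
        obtain ⟨i1, i2, i3⟩ := ih
        rcases hcase (v + 1 + k) (by omega) with h | ⟨-, h1, h2, h3⟩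
        · have := hconst (v + 1 + k) (by omega); omega
        · rw [i2] at h3
          have h4 : lastAlong x (v + 1 + (k + 1)) = lastAlong x (v + 1) := by
            rw [← add_assoc]; omega
          refine ⟨?_, h4, i3⟩
          rw [← add_assoc] at h4 ⊢
          rw [h1, h4, i1]; push_cast; ring
    obtain ⟨-, -, h1 | h1⟩ := hvert 0
    · exfalso
      have h2 := (hvert (curDepth x (v + 1) + 1).toNat).1
      have h3 := ((hx (v + 1)).inExcursion (Nat.succ_pos v)).curDepth_nonneg
      have h4 := ((hx (v + 1 + (curDepth x (v + 1) + 1).toNat)).inExcursion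
        (by omega)).curDepth_nonneg
      rw [h1] at h2
      omega
    · refine ⟨v + 1 + C.toNat, Or.inr fun u hu => ?_⟩
      have h2 := (hvert (u - (v + 1))).1
      have h3 := ((hx (v + 1)).inExcursion (Nat.succ_pos v)).curDepth_nonneg
      rw [h1, show v + 1 + (u - (v + 1)) = u by omega] at h2
      omega

theorem excProd_select_eq_one {Φ : ℤ → ℤ → ℝ} {j : ℕ} (hj : exc x u ≤ j) :
    excProd (selectExit {j} Φ) (j + 1) x u = 1 := by
  induction u with
  | zero => rfl
  | succ u ih =>
    have h1 := exc_le_succ x u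
    rw [excProd, ih (h1.trans hj), one_mul]
    split_ifs with h
    · rw [exc_succ_of_leaves h.1] at hj
      have : exc x u ∉ ({j} : Finset ℕ) := by rw [Finset.mem_singleton]; omega
      simp only [selectExit, if_neg this]
    · rfl

theorem exists_pow_le_half {q : ℝ} (h0 : 0 < q) (h1 : q < 1) :
    ∃ N : ℕ, ∀ n : ℤ, N ≤ n → q ^ n ≤ 1 / 2 := by
  obtain ⟨N, hN⟩ := exists_pow_lt_of_lt_one (by norm_num : (0 : ℝ) < 1 / 2) h1
  refine ⟨N, fun n hn => ?_⟩
  lift n to ℕ using (by omega)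
  rw [zpow_natCast]
  exact (pow_le_pow_of_le_one h0.le h1.le (by exact_mod_cast hn)).trans hN.le

theorem eventually_half_le_one_sub_genPot (hx : ∀ u, ValidUpTo southWest x u) {u₀ : ℕ}
    (hu₀ : 0 < u₀) (hl : ∀ u ≥ u₀, ¬ Leaves x u) {δ : ℝ} (h0 : 0 < δ) (h1 : δ ≤ 1 / 4) :
    ∀ᶠ u in atTop, 1 / 2 ≤ 1 - genPot δ (stage x u) := by
  have hl0 := genParam_pos h0 h1
  have hl1 := genParam_lt_one h0 h1
  obtain ⟨N₁, hN₁⟩ := exists_pow_le_half hl0 hl1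
  obtain ⟨N₂, hN₂⟩ := exists_pow_le_half (show 0 < 1 - δ by linarith) (show 1 - δ < 1 by linarith)
  -- The additional `1` compensates the exponent `disp - 1` in `genPot_le`.
  obtain ⟨v, hv⟩ := unbounded_of_not_leaves hx hu₀ hl (N₁ + N₂ + 1)
  filter_upwards [eventually_ge_atTop v, eventually_ge_atTop 1] with u hu hu1
  have hb := genPot_le h0 h1 (stage x u)
  have hn : 1 ≤ outDisp x u := (hx u).outDisp_pos hu1
  have hd : 0 ≤ curDepth x u := ((hx u).inExcursion hu1).curDepth_nonneg
  change _ ≤ genParam δ ^ (outDisp x u - 1) * (1 - δ) ^ curDepth x u at hb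
  have e1 : genParam δ ^ (outDisp x u - 1) ≤ 1 := by
    simpa using zpow_mul_zpow_le_one hl0 hl1.le one_pos le_rfl (by omega : 0 ≤ outDisp x u - 1)
      (le_refl 0)
  have e2 : (1 - δ) ^ curDepth x u ≤ 1 := by
    simpa using zpow_mul_zpow_le_one one_pos le_rfl (show 0 < 1 - δ by linarith)
      (by linarith) (le_refl 0) hd
  have p1 : 0 ≤ genParam δ ^ (outDisp x u - 1) := zpow_nonneg hl0.le _
  have p2 : 0 ≤ (1 - δ) ^ curDepth x u := zpow_nonneg (by linarith) _
  rcases hv with hv | hv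
  · have := hN₁ (outDisp x u - 1) (by have := hv u hu; omega)
    nlinarith
  · have := hN₂ (curDepth x u) (by have := hv u hu; omega)
    nlinarith

variable {Ω : Type*} [MeasurableSpace Ω] {μ : Measure Ω} {X : ℕ → Ω → Site}

/-- For the `j`-th excursion the potential `1 - genPot δ` starts at `2 * δ` and is eventually at
least `1/2` if the excursion begins but never ends. This has probability at most `4 * δ` for every
small `δ`, hence zero. -/
theorem ae_exc_succ [IsProbabilityMeasure μ] (hX : IsCornerWalk μ X) (j : ℕ) :
    ∀ᵐ ω ∂μ, (∃ u, exc (trajectory X ω) u = j) → ∃ u, exc (trajectory X ω) u = j + 1 := by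
  set S : Set Ω := {ω | ¬ ((∃ u, exc (trajectory X ω) u = j) →
    ∃ u, exc (trajectory X ω) u = j + 1)} with hSdef
  have hbound : ∀ δ : ℝ, 0 < δ → δ ≤ 1 / 4 → μ S ≤ ENNReal.ofReal (4 * δ) := by
    intro δ h0 h1
    have key := measure_le_of_potential (S := S) (b := 1 / 2) (J := j + 1) hX
      (isPotential_select {j} (isPotential_one_sub_gen h0 h1)) ?_
    · rw [prod_selectInit (by simp), Finset.card_singleton, pow_one] at key
      have h2 : ENNReal.ofReal 2 * (ENNReal.ofReal (1 / 2) * μ S) = μ S := by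
        rw [← mul_assoc, ← ENNReal.ofReal_mul (by norm_num)]
        norm_num
      rw [← h2]
      refine (mul_le_mul_right key _).trans ?_
      rw [← ENNReal.ofReal_mul (by norm_num)]
      exact ENNReal.ofReal_le_ofReal (by linarith)
    · filter_upwards [hX.ae_valid] with ω hω hS
      set x := trajectory X ω
      rw [hSdef, Set.mem_ofPred_eq] at hS
      push Not at hS
      obtain ⟨⟨u₁, hu₁⟩, hne⟩ := hS
      have hle : ∀ u, exc x u ≤ j := by
        intro u
        induction u with
        | zero => rw [exc_zero]; omega
        | succ u ih =>
          by_cases hl : Leaves x u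
          · have := hne (u + 1)
            rw [exc_succ_of_leaves hl] at this ⊢
            omega
          · rwa [exc_succ_of_not_leaves hl]
      have heq : ∀ u ≥ u₁, exc x u = j := fun u hu =>
        le_antisymm (hle u) (hu₁ ▸ monotone_exc x hu)
      have hl : ∀ u ≥ u₁ + 1, ¬ Leaves x u := by
        intro u hu h
        rw [leaves_iff_exc, heq u (by omega), heq (u + 1) (by omega)] at h
        exact h rfl
      filter_upwards [eventually_half_le_one_sub_genPot hω (Nat.succ_pos u₁) hl h0 h1,
        eventually_ge_atTop u₁] with u hu hu1
      unfold potential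
      rw [excProd_select_eq_one (hle u), heq u hu1, if_pos (Nat.lt_succ_self j), one_mul,
        Finset.Ico_self, Finset.prod_empty, mul_one]
      simpa [selectPot] using hu
  have hzero : μ S = 0 := by
    have ht : Tendsto (fun n : ℕ => ENNReal.ofReal (4 * (1 / ((n : ℝ) + 4)))) atTop (𝓝 0) := by
      rw [← ENNReal.ofReal_zero]
      refine ENNReal.tendsto_ofReal ?_
      rw [show (0 : ℝ) = 4 * 0 by norm_num]
      refine Tendsto.const_mul 4 ?_
      exact tendsto_const_nhds.div_atTop
        (tendsto_atTop_add_const_right _ _ tendsto_natCast_atTop_atTop)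
    refine le_antisymm (ge_of_tendsto' ht fun n => hbound _ (by positivity) ?_) zero_le
    rw [div_le_div_iff₀ (by positivity) (by norm_num)]
    have : (0 : ℝ) ≤ n := Nat.cast_nonneg n
    linarith
  exact hzero

/-- A path of the corner model all of whose excursions are finite. -/
structure Good (x : ℕ → Site) : Prop where
  valid : ∀ u, ValidUpTo southWest x u
  exists_exc : ∀ j, ∃ u, exc x u = j

theorem ae_good [IsProbabilityMeasure μ] (hX : IsCornerWalk μ X) :
    ∀ᵐ ω ∂μ, Good (trajectory X ω) := by
  filter_upwards [hX.ae_valid, ae_all_iff.2 (ae_exc_succ hX)] with ω h1 h2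
  refine ⟨h1, fun j => ?_⟩
  induction j with
  | zero => exact ⟨0, exc_zero⟩
  | succ j ih => exact h2 j ih

/-! ### Excursions of good paths -/

namespace Good

variable (h : Good x)
include h

theorem inExcursion (hu : 0 < u) : InExcursion x u := (h.valid u).inExcursion hu

/-- The first time at which `exc` reaches `j + 1` is one step after the start of that excursion. -/
theorem startTime_succ_spec (j : ℕ) : 0 < startTime x (j + 1) ∧
    exc x (startTime x (j + 1)) = j ∧ Leaves x (startTime x (j + 1)) := by
  classical
  have hex := h.exists_exc (j + 1)
  obtain ⟨v, hv⟩ : ∃ v, Nat.find hex = v + 1 := by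
    refine ⟨Nat.find hex - 1, ?_⟩
    have : Nat.find hex ≠ 0 := fun h0 => by
      have := Nat.find_spec hex
      rw [h0, exc_zero] at this
      omega
    omega
  have h1 : exc x (v + 1) = j + 1 := hv ▸ Nat.find_spec hex
  have h2 : exc x v ≠ j + 1 := Nat.find_min hex (by omega)
  have hl : Leaves x v := leaves_iff_exc.2 (by omega)
  have h3 : exc x v = j := by
    have := exc_succ_of_leaves hl
    omega
  have hv0 : 0 < v := by
    rcases Nat.eq_zero_or_pos v with rfl | h0
    · exact absurd hl (not_leaves_zero (h.valid 1))
    · exact h0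
  have := (h.inExcursion hv0).startTime_succ hl
  rw [h3] at this
  rw [this]
  exact ⟨hv0, h3, hl⟩

theorem exc_startTime_succ (j : ℕ) : exc x (startTime x j + 1) = j := by
  cases j with
  | zero => exact (stage_one (h.valid 1)).1
  | succ j =>
    obtain ⟨-, h1, h2⟩ := h.startTime_succ_spec j
    rw [exc_succ_of_leaves h2, h1]

theorem startTime_lt (j : ℕ) : startTime x j < startTime x (j + 1) := by
  by_contra! hc
  have h1 := h.exc_startTime_succ j
  have h2 := h.exc_startTime_succ (j + 1)
  have := monotone_exc x (show startTime x (j + 1) + 1 ≤ startTime x j + 1 by omega)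
  omega

theorem strictMono_startTime : StrictMono (startTime x) :=
  strictMono_nat_of_lt_succ h.startTime_lt

/-- A corner time belongs to the excursion that ends there: whether a new one begins is only seen at
the next step. -/
theorem exc_eq_iff (hu : 0 < u) {j : ℕ} :
    exc x u = j ↔ startTime x j < u ∧ u ≤ startTime x (j + 1) := by
  constructor
  · rintro rfl
    refine ⟨?_, ?_⟩
    · rw [(h.inExcursion hu).start_eq]
      obtain ⟨v, rfl⟩ : ∃ v, u = v + 1 := ⟨u - 1, by omega⟩
      exact excStart_lt x v
    · by_contra! hc
      have h1 := h.exc_startTime_succ (exc x u + 1)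
      have := monotone_exc x (show startTime x (exc x u + 1) + 1 ≤ u by omega)
      omega
  · rintro ⟨h1, h2⟩
    refine le_antisymm ?_ ?_
    · have := monotone_exc x h2
      rwa [(h.startTime_succ_spec j).2.1] at this
    · have := monotone_exc x (show startTime x j + 1 ≤ u by omega)
      rwa [h.exc_startTime_succ j] at this

variable {j : ℕ}

theorem excStart_eq (h1 : startTime x j < u) (h2 : u ≤ startTime x (j + 1)) :
    excStart x u = startTime x j := by
  have hu : 0 < u := by omega
  rw [← (h.inExcursion hu).start_eq, (h.exc_eq_iff hu).2 ⟨h1, h2⟩]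

theorem excSide_eq (h1 : startTime x j < u) (h2 : u ≤ startTime x (j + 1)) :
    excSide x u = side x j := by
  unfold excSide
  rw [(h.exc_eq_iff (by omega)).2 ⟨h1, h2⟩]

theorem curDepth_eq (h1 : startTime x j < u) (h2 : u ≤ startTime x (j + 1)) :
    curDepth x u = depth x j u := by
  unfold curDepth depth
  rw [h.excStart_eq h1 h2, h.excSide_eq h1 h2]

theorem depth_nonneg (h1 : startTime x j ≤ u) (h2 : u ≤ startTime x (j + 1)) :
    0 ≤ depth x j u := by
  rcases h1.eq_or_lt with rfl | h1
  · unfold depth; rw [sub_self]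
  · rw [← h.curDepth_eq h1 h2]
    exact (h.inExcursion (by omega)).curDepth_nonneg

theorem outward_le (h1 : startTime x j ≤ u) (h2 : u < startTime x (j + 1)) :
    x u (side x j + 1) ≤ x (u + 1) (side x j + 1) := by
  have hE := h.inExcursion (h.startTime_succ_spec j).1
  have e1 := h.excStart_eq (h.startTime_lt j) le_rfl
  have e2 := h.excSide_eq (h.startTime_lt j) le_rfl
  have := hE.outward_le u (by rw [e1]; exact h1) h2
  rwa [e2] at this

theorem first_step (j : ℕ) :
    x (startTime x j + 1) (side x j + 1) = x (startTime x j) (side x j + 1) + 1 ∧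
      x (startTime x j + 1) (side x j) = x (startTime x j) (side x j) := by
  have hE := h.inExcursion (h.startTime_succ_spec j).1
  have e1 := h.excStart_eq (h.startTime_lt j) le_rfl
  have e2 := h.excSide_eq (h.startTime_lt j) le_rfl
  have := hE.first_step
  rwa [e1, e2] at this

theorem outward_mono {v : ℕ} (h1 : startTime x j ≤ u) (huv : u ≤ v)
    (h2 : v ≤ startTime x (j + 1)) : x u (side x j + 1) ≤ x v (side x j + 1) := by
  induction v, huv using Nat.le_induction with
  | base => exact le_rfl
  | succ v hv ih => exact (ih (by omega)).trans (h.outward_le (by omega) (by omega))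

theorem depth_end (j : ℕ) : depth x j (startTime x (j + 1)) = 0 := by
  obtain ⟨h1, h2, h3⟩ := h.startTime_succ_spec j
  rw [← h.curDepth_eq (h.startTime_lt j) le_rfl]
  rcases (h.inExcursion h1).step_cases ((h.valid _).2 _ (Nat.lt_succ_self _)) with
    ⟨hn, -⟩ | ⟨-, c, -, -, -, hiff⟩
  · exact absurd h3 hn
  · exact (hiff.1 h3).2

theorem along_end (j : ℕ) :
    x (startTime x (j + 1)) (side x j) = x (startTime x j) (side x j) := by
  have := h.depth_end j
  unfold depth at this
  omega

/-- The possible steps inside an excursion. -/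
theorem step_cases (h1 : startTime x j < u) (h2 : u < startTime x (j + 1)) :
    (x (u + 1) (side x j) = x u (side x j) ∧
      x (u + 1) (side x j + 1) = x u (side x j + 1) + 1) ∨
    (x (u + 1) (side x j + 1) = x u (side x j + 1) ∧ ∃ c : ℤ, (c = 1 ∨ c = -1) ∧
      (lastAlong x u = 0 ∨ lastAlong x u = c) ∧
      x (u + 1) (side x j) = x u (side x j) + c) := by
  have := (h.inExcursion (by omega : 0 < u)).step_cases ((h.valid _).2 _ (Nat.lt_succ_self _))
  rw [h.excSide_eq h1 h2.le] at this
  rcases this with ⟨-, h3, h4⟩ | ⟨h3, c, h4, h5, h6, -⟩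
  · exact Or.inl ⟨h3, h4⟩
  · exact Or.inr ⟨h3, c, h4, h5, h6⟩

theorem depth_succ_le (h1 : startTime x j ≤ u) (h2 : u < startTime x (j + 1)) :
    depth x j (u + 1) ≤ depth x j u + 1 := by
  unfold depth
  rcases h1.eq_or_lt with rfl | h1
  · have := (h.first_step j).2; omega
  · rcases h.step_cases h1 h2 with ⟨h3, -⟩ | ⟨-, c, h3, -, h4⟩ <;> omega

theorem le_maxDepth_iff {K : ℤ} (hK : 1 ≤ K) (h1 : startTime x j < u)
    (h2 : u ≤ startTime x (j + 1)) :
    K ≤ maxDepth x u ↔ ∃ t, startTime x j ≤ t ∧ t ≤ u ∧ K ≤ depth x j t := by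
  induction u with
  | zero => omega
  | succ u ih =>
    have hd0 : depth x j (startTime x j) = 0 := by unfold depth; rw [sub_self]
    rcases (Nat.lt_succ_iff.1 h1).eq_or_lt with rfl | h1'
    · have hd : depth x j (startTime x j + 1) = 0 := by
        unfold depth; rw [(h.first_step j).2, sub_self]
      have hm : maxDepth x (startTime x j + 1) ≤ 0 := by
        cases j with
        | zero =>
          have := congrArg Stage.deepest (stage_one (h.valid 1)).2
          exact le_of_eq this
        | succ j => rw [maxDepth_succ_of_leaves (h.startTime_succ_spec j).2.2]
      constructor
      · intro hh; omega
      · rintro ⟨t, h3, h4, h5⟩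
        obtain rfl | rfl : t = startTime x j ∨ t = startTime x j + 1 := by omega
        · omega
        · omega
    · have hl : ¬ Leaves x u := by
        rw [leaves_iff_exc, (h.exc_eq_iff (by omega)).2 ⟨h1, h2⟩,
          (h.exc_eq_iff (by omega)).2 ⟨h1', by omega⟩]
        exact fun hh => hh rfl
      rw [maxDepth_succ_of_not_leaves hl, le_max_iff, ih h1' (by omega), h.curDepth_eq h1 h2]
      constructor
      · rintro (⟨t, h3, h4, h5⟩ | h3)
        · exact ⟨t, h3, by omega, h5⟩
        · exact ⟨u + 1, by omega, le_rfl, h3⟩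
      · rintro ⟨t, h3, h4, h5⟩
        rcases Nat.lt_or_ge u t with h6 | h6
        · obtain rfl : t = u + 1 := by omega
          exact Or.inr h5
        · exact Or.inl ⟨t, h3, h6, h5⟩

/-- The product of final values over the completed excursions. -/
theorem excProd_eq (Φ : ℕ → ℤ → ℤ → ℝ) (J u : ℕ) : excProd Φ J x u =
    ∏ k ∈ Finset.range (min (exc x u) J), Φ k (outDisp x (startTime x (k + 1)))
      (maxDepth x (startTime x (k + 1))) := by
  induction u with
  | zero => simp [excProd, exc_zero]
  | succ u ih =>
    rw [excProd, ih]
    by_cases hl : Leaves x u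
    · have hu : 0 < u := by
        rcases Nat.eq_zero_or_pos u with rfl | h0
        · exact absurd hl (not_leaves_zero (h.valid 1))
        · exact h0
      rw [exc_succ_of_leaves hl]
      by_cases hJ : exc x u < J
      · rw [if_pos ⟨hl, hJ⟩, min_eq_left hJ.le, min_eq_left (by omega), Finset.prod_range_succ,
          (h.inExcursion hu).startTime_succ hl]
      · rw [if_neg (fun hh => hJ hh.2), mul_one, min_eq_right (by omega), min_eq_right (by omega)]
    · rw [if_neg (fun hh => hl hh.1), mul_one, exc_succ_of_not_leaves hl]

/-- The frozen value is the product of final values, the form in which `measure_le_of_potential` is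
applied to functionals of completed excursions. -/
theorem eventually_potential_eq (Ψ : ℕ → Stage → ℝ) (Φ : ℕ → ℤ → ℤ → ℝ) (a : ℕ → ℝ) (J : ℕ) :
    ∀ᶠ u in atTop, potential Ψ Φ a J x u = ∏ k ∈ Finset.range J,
      Φ k (outDisp x (startTime x (k + 1))) (maxDepth x (startTime x (k + 1))) := by
  filter_upwards [eventually_ge_atTop (startTime x J + 1)] with u hu
  have hJ : J ≤ exc x u := by
    have := monotone_exc x hu
    rwa [h.exc_startTime_succ] at this
  unfold potential
  rw [if_neg (by omega), mul_one, h.excProd_eq, min_eq_right hJ]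

end Good

end PrudentWalk

namespace PrudentWalk

/-! ### The kept parts of the excursions -/

variable {x y : ℕ → Site} {u : ℕ}

namespace Good

section

variable (h : Good x)
include h

/-- The kept part of an excursion, if the side along which it takes place has length `l`. -/
theorem keptEnd_spec (j : ℕ) {l : ℤ} (hl : 0 ≤ l) :
    startTime x j < keptEnd x j l ∧ keptEnd x j l ≤ startTime x (j + 1) ∧
    (∀ t, startTime x j ≤ t → t ≤ keptEnd x j l → depth x j t ≤ l) ∧
    (Exceeds x j l → keptEnd x j l < startTime x (j + 1) ∧ depth x j (keptEnd x j l) = l ∧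
      depth x j (keptEnd x j l + 1) = l + 1) ∧
    (¬ Exceeds x j l → keptEnd x j l = startTime x (j + 1)) := by
  classical
  by_cases hE : Exceeds x j l
  · have hk : keptEnd x j l = sInf {t | startTime x j ≤ t ∧ depth x j t = l + 1} - 1 := by
      unfold keptEnd; rw [if_pos hE]
    have hex : ∃ t, startTime x j ≤ t ∧ l < depth x j t := by
      obtain ⟨t, h1, -, h2⟩ := hE
      exact ⟨t, h1, h2⟩
    obtain ⟨t₀, ht1, ht2, ht3⟩ := hE
    -- The first time at which the depth exceeds `l`. As the depth grows by at most one per step, it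
    -- equals `l + 1` there, which matches the equality in `keptEnd`.
    set s := Nat.find hex with hs
    obtain ⟨hs1, hs2⟩ := Nat.find_spec hex
    rw [← hs] at hs1 hs2
    have hmin : ∀ t, startTime x j ≤ t → t < s → depth x j t ≤ l := by
      intro t h1 h2
      by_contra hc
      exact Nat.find_min hex h2 ⟨h1, not_le.1 hc⟩
    have hst : s ≤ startTime x (j + 1) := (Nat.find_min' hex ⟨ht1, ht3⟩).trans ht2
    have hd0 : depth x j (startTime x j) = 0 := by unfold depth; rw [sub_self]
    have hd1 : depth x j (startTime x j + 1) = 0 := by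
      unfold depth; rw [(h.first_step j).2, sub_self]
    have hs3 : startTime x j + 1 < s := by
      by_contra! hc
      obtain h3 | h3 : s = startTime x j ∨ s = startTime x j + 1 := by omega
      · rw [h3] at hs2; omega
      · rw [h3] at hs2; omega
    obtain ⟨v, hv⟩ : ∃ v, s = v + 1 := ⟨s - 1, by omega⟩
    have hdv := hmin v (by omega) (by omega)
    have hdv' := h.depth_succ_le (j := j) (u := v) (by omega) (by omega)
    rw [hv] at hs2
    have hset : sInf {t | startTime x j ≤ t ∧ depth x j t = l + 1} = v + 1 := by
      refine le_antisymm (Nat.sInf_le ⟨by omega, by omega⟩)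
        (le_csInf ⟨v + 1, by omega, by omega⟩ ?_)
      rintro t ⟨h1, h2⟩
      by_contra hc
      have := hmin t h1 (by omega)
      omega
    rw [hset, Nat.add_sub_cancel] at hk
    rw [hk]
    refine ⟨by omega, by omega, fun t h1 h2 => hmin t h1 (by omega),
      fun _ => ⟨by omega, by omega, by omega⟩, fun hn => ?_⟩
    exact absurd ⟨t₀, ht1, ht2, ht3⟩ hn
  · have hk : keptEnd x j l = startTime x (j + 1) := by
      unfold keptEnd; rw [if_neg hE]
    rw [hk]
    refine ⟨h.startTime_lt j, le_rfl, fun t h1 h2 => ?_, fun hh => absurd hh hE, fun _ => rfl⟩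
    by_contra hc
    exact hE ⟨t, h1, h2, not_le.1 hc⟩

end

end Good

/-- The time at which the kept part of the `j`-th excursion ends. -/
noncomputable def lastKept (x : ℕ → Site) (j : ℕ) : ℕ := keptEnd x j (extent x j (side x j))

theorem extent_succ_other (x : ℕ → Site) (j : ℕ) :
    extent x (j + 1) (side x j + 1) = extent x j (side x j + 1) +
      (x (lastKept x j) (side x j + 1) - x (startTime x j) (side x j + 1)) :=
  Function.update_self _ _ _

theorem extent_succ_side (x : ℕ → Site) (j : ℕ) :
    extent x (j + 1) (side x j) = extent x j (side x j) := by
  rw [extent, Function.update_of_ne (fin_two_ne _).symm]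

namespace Good

variable (h : Good x)
include h

theorem extent_nonneg (j : ℕ) (k : Fin 2) : 0 ≤ extent x j k := by
  induction j generalizing k with
  | zero => exact le_rfl
  | succ j ih =>
    rcases fin_two_eq_or (side x j) k with rfl | rfl
    · rw [extent_succ_side]; exact ih _
    · obtain ⟨h1, h2, -⟩ := h.keptEnd_spec j (ih (side x j))
      have := h.outward_mono le_rfl h1.le h2
      have := ih (side x j + 1)
      rw [extent_succ_other]
      unfold lastKept
      omega

theorem lastKept_spec (j : ℕ) :
    startTime x j < lastKept x j ∧ lastKept x j ≤ startTime x (j + 1) ∧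
    (∀ t, startTime x j ≤ t → t ≤ lastKept x j → depth x j t ≤ extent x j (side x j)) ∧
    (IsTruncated x j → lastKept x j < startTime x (j + 1) ∧
      depth x j (lastKept x j) = extent x j (side x j) ∧
      depth x j (lastKept x j + 1) = extent x j (side x j) + 1) ∧
    (¬ IsTruncated x j → lastKept x j = startTime x (j + 1)) :=
  h.keptEnd_spec j (h.extent_nonneg j _)

/-- The first step of an excursion is outward and at depth zero, so truncation never removes it. -/
theorem kept_disp_pos (j : ℕ) :
    1 ≤ x (lastKept x j) (side x j + 1) - x (startTime x j) (side x j + 1) := by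
  obtain ⟨h1, h2, -⟩ := h.lastKept_spec j
  have h3 := h.outward_mono (j := j) (Nat.le_succ _) h1 h2
  rw [Nat.succ_eq_add_one, (h.first_step j).1] at h3
  omega

theorem extent_le_succ (j : ℕ) (k : Fin 2) : extent x j k ≤ extent x (j + 1) k := by
  rcases fin_two_eq_or (side x j) k with rfl | rfl
  · rw [extent_succ_side]
  · have := h.kept_disp_pos j
    rw [extent_succ_other]; omega

theorem monotone_extent (k : Fin 2) : Monotone fun j => extent x j k :=
  monotone_nat_of_le_succ fun j => h.extent_le_succ j k

/-- Two consecutive excursions have different orientations, so together they lengthen each side by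
at least one. -/
theorem half_le_extent (N : ℕ) (k : Fin 2) : (N : ℤ) ≤ extent x (2 * N) k := by
  induction N with
  | zero => exact le_rfl
  | succ N ih =>
    have e : 2 * (N + 1) = 2 * N + 1 + 1 := by ring
    rw [e]
    have h1 := h.kept_disp_pos (2 * N)
    have h2 := h.kept_disp_pos (2 * N + 1)
    have h3 := extent_succ_other x (2 * N)
    have h4 := extent_succ_other x (2 * N + 1)
    have h5 := extent_succ_side x (2 * N + 1)
    rcases fin_two_eq_or (side x (2 * N)) k with rfl | rfl
    · rw [side_succ, fin_two_add] at h2 h4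
      have := extent_succ_side x (2 * N)
      push_cast; omega
    · rw [side_succ] at h5
      push_cast; omega

/-- Truncation can only discard outward displacement, so the corner walk is at least as far out as
the rectangle is large. -/
theorem extent_le_startTime (j : ℕ) (k : Fin 2) : extent x j k ≤ x (startTime x j) k := by
  induction j generalizing k with
  | zero =>
    show (0 : ℤ) ≤ x 0 k
    rw [(h.valid 0).1]; exact le_rfl
  | succ j ih =>
    rcases fin_two_eq_or (side x j) k with rfl | rfl
    · rw [extent_succ_side, h.along_end j]; exact ih _
    · obtain ⟨h1, h2, -⟩ := h.lastKept_spec j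
      have := h.outward_mono (j := j) h1.le h2 le_rfl
      have := ih (side x j + 1)
      rw [extent_succ_other]
      omega

theorem depth_le_maxDepth {j t : ℕ} (h1 : startTime x j ≤ t) (h2 : t ≤ startTime x (j + 1)) :
    depth x j t ≤ maxDepth x (startTime x (j + 1)) := by
  rcases le_or_gt (depth x j t) 0 with h0 | h0
  · refine h0.trans ?_
    have hpos := (h.startTime_succ_spec j).1
    exact (h.inExcursion hpos).curDepth_nonneg.trans ((h.valid _).curDepth_le_maxDepth hpos)
  · exact (h.le_maxDepth_iff h0 (h.startTime_lt j) le_rfl).2 ⟨t, h1, h2, le_rfl⟩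

theorem not_isTruncated {j : ℕ} (hm : maxDepth x (startTime x (j + 1)) ≤ extent x j (side x j)) :
    ¬ IsTruncated x j := by
  rintro ⟨t, h1, h2, h3⟩
  have := h.depth_le_maxDepth h1 h2
  omega

theorem extent_succ_of_not_truncated {j : ℕ} (hn : ¬ IsTruncated x j) :
    extent x (j + 1) (side x j + 1) =
      extent x j (side x j + 1) + outDisp x (startTime x (j + 1)) := by
  rw [extent_succ_other, (h.lastKept_spec j).2.2.2.2 hn]
  unfold outDisp
  rw [h.excStart_eq (h.startTime_lt j) le_rfl, h.excSide_eq (h.startTime_lt j) le_rfl]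

end Good

theorem side_add_two_mul (x : ℕ → Site) (b r : ℕ) : side x (2 * r + b) = side x b := by
  induction r with
  | zero => rw [mul_zero, zero_add]
  | succ r ih =>
    rw [show 2 * (r + 1) + b = 2 * r + b + 1 + 1 by ring, side_succ, side_succ, fin_two_add, ih]

/-- The outward displacement of the `j`-th excursion if its depth is at most `N`. -/
noncomputable def shallowDisp (x : ℕ → Site) (N j : ℕ) : ℤ :=
  if maxDepth x (startTime x (j + 1)) ≤ N then outDisp x (startTime x (j + 1)) else 0

/-- From index `2 * N` on the sides are at least `N`, so excursions of depth at most `N` are not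
truncated and contribute their whole displacement. The parity of `b` selects excursions that
lengthen the same side. -/
theorem Good.sum_shallowDisp_le (h : Good x) (N b R : ℕ) :
    ∑ r ∈ Finset.range R, shallowDisp x N (2 * N + 2 * r + b) ≤
      extent x (2 * N + 2 * R + b) (side x b + 1) := by
  induction R with
  | zero => simpa using h.extent_nonneg _ _
  | succ R ih =>
    rw [Finset.sum_range_succ]
    set j := 2 * N + 2 * R + b with hj
    have hside : side x j = side x b := by
      rw [hj, show 2 * N + 2 * R + b = 2 * (N + R) + b by ring, side_add_two_mul]
    have h1 := h.extent_le_succ (j + 1) (side x b + 1)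
    rw [show 2 * N + 2 * (R + 1) + b = j + 1 + 1 by omega]
    have h2 : extent x j (side x b + 1) + shallowDisp x N j ≤ extent x (j + 1) (side x b + 1) := by
      unfold shallowDisp
      split_ifs with hm
      · have hn : ¬ IsTruncated x j := by
          refine h.not_isTruncated (hm.trans ((h.half_le_extent N (side x j)).trans ?_))
          exact h.monotone_extent (side x j) (show 2 * N ≤ j by omega)
        have := h.extent_succ_of_not_truncated hn
        rw [hside] at this
        exact this.ge
      · rw [add_zero]; exact h.extent_le_succ j _
    omega

/-! ### The tail estimates -/

variable {Ω : Type*} [MeasurableSpace Ω] {μ : Measure Ω} {X : ℕ → Ω → Site}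

/-- The probability that an excursion is deep. -/
theorem measure_deep_le [IsProbabilityMeasure μ] (hX : IsCornerWalk μ X) (j : ℕ) {K : ℤ}
    (hK : 1 ≤ K) :
    μ {ω | K ≤ maxDepth (trajectory X ω) (startTime (trajectory X ω) (j + 1))} ≤
      ENNReal.ofReal (2 / (K + 3)) := by
  have key := measure_le_of_potential (b := 1) (J := j + 1) hX
      (isPotential_select {j} (isPotential_deep hK))
      (S := {ω | K ≤ maxDepth (trajectory X ω) (startTime (trajectory X ω) (j + 1))}) ?_
  · rwa [prod_selectInit (by simp), Finset.card_singleton, pow_one, ENNReal.ofReal_one,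
      one_mul] at key
  · filter_upwards [ae_good hX] with ω hω hS
    filter_upwards [hω.eventually_potential_eq (selectPot {j} (deepPot K))
      (selectExit {j} (deepExit K)) (selectInit {j} (2 / (K + 3))) (j + 1)] with u hu
    rw [hu]
    refine le_of_eq (Finset.prod_eq_one fun k _ => ?_).symm
    unfold selectExit
    by_cases hk : k ∈ ({j} : Finset ℕ)
    · rw [if_pos hk]
      rw [Finset.mem_singleton] at hk
      subst hk
      unfold deepExit
      rw [if_pos hS]
    · rw [if_neg hk]

/-- The probability that the total displacement of `N` shallow excursions is small. -/
theorem measure_sum_shallowDisp_lt [IsProbabilityMeasure μ] (hX : IsCornerWalk μ X) (N b L : ℕ)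
    {δ : ℝ} (h0 : 0 < δ) (h1 : δ ≤ 1 / 4) :
    μ {ω | ∑ r ∈ Finset.range N, shallowDisp (trajectory X ω) N (2 * N + 2 * r + b) < L} ≤
      ENNReal.ofReal (Real.exp (4 * δ ^ 2 * L - 2 * δ * N + 2)) := by
  have hl := genParam_pos h0 h1
  have hl1 := genParam_lt_one h0 h1
  set A : Finset ℕ := (Finset.range N).image fun r => 2 * N + 2 * r + b with hA
  have hinj : Set.InjOn (fun r => 2 * N + 2 * r + b) (Finset.range N : Set ℕ) := by
    intro r _ s _ hrs
    simp only at hrs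
    omega
  have hcard : A.card = N := by rw [hA, Finset.card_image_of_injOn hinj, Finset.card_range]
  set J := 4 * N + b with hJ
  have hAJ : A ⊆ Finset.range J := by
    intro k hk
    rw [hA, Finset.mem_image] at hk
    obtain ⟨r, hr, rfl⟩ := hk
    rw [Finset.mem_range] at hr ⊢
    omega
  -- The factor `genParam δ ^ shallowDisp` is at most `genExit` plus the indicator of depth at least
  -- `N + 1`, whose potentials add up; `a` is the sum of their initial values.
  set a : ℝ := 1 - 2 * δ + 2 / (((N + 1 : ℕ) : ℤ) + 3 : ℝ) with ha
  have hpot := (isPotential_gen h0 h1).add (isPotential_deep (K := ((N + 1 : ℕ) : ℤ))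
    (by push_cast; omega))
  have key := measure_le_of_potential (b := genParam δ ^ L) (J := J) hX
      (isPotential_select A hpot)
      (S := {ω | ∑ r ∈ Finset.range N,
        shallowDisp (trajectory X ω) N (2 * N + 2 * r + b) < L}) ?_
  · rw [prod_selectInit hAJ, hcard] at key
    have hinv : ENNReal.ofReal ((genParam δ)⁻¹ ^ L) * ENNReal.ofReal (genParam δ ^ L) = 1 := by
      rw [← ENNReal.ofReal_mul (by positivity), ← mul_pow, inv_mul_cancel₀ hl.ne', one_pow,
        ENNReal.ofReal_one]
    calc _ = ENNReal.ofReal ((genParam δ)⁻¹ ^ L) * (ENNReal.ofReal (genParam δ ^ L) * _) := by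
          rw [← mul_assoc, hinv, one_mul]
      _ ≤ _ := mul_le_mul_right key _
      _ ≤ _ := by
        rw [← ENNReal.ofReal_mul (by positivity)]
        refine ENNReal.ofReal_le_ofReal ?_
        have e1 : (genParam δ)⁻¹ ^ L ≤ Real.exp (4 * δ ^ 2 * L) := by
          rw [mul_comm, Real.exp_nat_mul]
          refine pow_le_pow_left₀ (by positivity) ((inv_genParam_le h0 h1).trans ?_) L
          linarith [Real.add_one_le_exp (4 * δ ^ 2)]
        have hN : (0 : ℝ) ≤ N := Nat.cast_nonneg N
        have e2 : a ^ N ≤ Real.exp (-2 * δ * N + 2) := by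
          have e3 : a ≤ Real.exp (-2 * δ + 2 / (N + 4)) := by
            refine le_trans (le_of_eq ?_) (Real.add_one_le_exp _)
            rw [ha]; push_cast; ring
          have e4 : 0 ≤ a := by
            rw [ha]
            have : 0 ≤ 1 - 2 * δ := by linarith
            push_cast
            positivity
          refine (pow_le_pow_left₀ e4 e3 N).trans ?_
          rw [← Real.exp_nat_mul]
          refine Real.exp_le_exp.2 ?_
          -- Ignoring deep excursions costs only a constant factor `exp 2`.
          have : (N : ℝ) * (2 / (N + 4)) ≤ 2 := by
            rw [mul_div_assoc', div_le_iff₀ (by positivity)]; linarith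
          linarith
        refine (mul_le_mul e1 e2 (pow_nonneg ?_ N) (Real.exp_pos _).le).trans ?_
        · have : 0 ≤ 1 - 2 * δ := by linarith
          positivity
        · rw [← Real.exp_add]
          exact Real.exp_le_exp.2 (by linarith)
  · filter_upwards [ae_good hX] with ω hω hS
    set x := trajectory X ω
    filter_upwards [hω.eventually_potential_eq (selectPot A _) (selectExit A _) (selectInit A _) J]
      with u hu
    rw [hu]
    unfold selectExit
    have hsplit : ∏ k ∈ Finset.range J, (if k ∈ A then fun n m => genExit δ n m +
          deepExit ((N + 1 : ℕ) : ℤ) n m else fun _ _ => 1)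
          (outDisp x (startTime x (k + 1))) (maxDepth x (startTime x (k + 1))) =
        ∏ r ∈ Finset.range N, (genExit δ (outDisp x (startTime x (2 * N + 2 * r + b + 1)))
            (maxDepth x (startTime x (2 * N + 2 * r + b + 1))) +
          deepExit ((N + 1 : ℕ) : ℤ) (outDisp x (startTime x (2 * N + 2 * r + b + 1)))
            (maxDepth x (startTime x (2 * N + 2 * r + b + 1)))) := by
      rw [← Finset.prod_subset hAJ, hA, Finset.prod_image hinj]
      · refine Finset.prod_congr rfl fun r hr => ?_
        rw [if_pos (Finset.mem_image_of_mem _ hr)]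
      · intro k _ hk
        rw [if_neg hk]
    rw [hsplit]
    have hpos : ∀ r, 0 ≤ shallowDisp x N (2 * N + 2 * r + b) := by
      intro r
      unfold shallowDisp
      split_ifs
      · have := (hω.valid _).outDisp_pos (hω.startTime_succ_spec (2 * N + 2 * r + b)).1
        omega
      · exact le_rfl
    calc genParam δ ^ L ≤ genParam δ ^ (∑ r ∈ Finset.range N,
            shallowDisp x N (2 * N + 2 * r + b)) := by
          rw [← zpow_natCast]
          exact zpow_le_zpow_right_of_le_one₀ hl hl1.le (le_of_lt hS)
      _ = ∏ r ∈ Finset.range N, genParam δ ^ shallowDisp x N (2 * N + 2 * r + b) := by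
          induction Finset.range N using Finset.induction_on with
          | empty => simp
          | insert r s hr ih =>
            rw [Finset.sum_insert hr, Finset.prod_insert hr, zpow_add₀ hl.ne', ih]
      _ ≤ _ := by
          refine Finset.prod_le_prod (fun r _ => (zpow_pos hl _).le) fun r _ => ?_
          unfold shallowDisp genExit deepExit
          have hz := zpow_pos hl (outDisp x (startTime x (2 * N + 2 * r + b + 1)))
          split_ifs with c1 c2 c2
          · linarith
          · linarith
          · rw [zpow_zero]; linarith
          · exfalso; push_cast at c2; omega

end PrudentWalk

namespace PrudentWalk

/-! ### Comparison of depths and extents -/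

variable {x y : ℕ → Site} {u : ℕ}

/-- The depths of the excursions become negligible with respect to the extents of the rectangle. -/
def Tame (x : ℕ → Site) : Prop :=
  ∀ C : ℤ, ∃ j₀, ∀ j ≥ j₀, ∀ k, maxDepth x (startTime x (j + 1)) + C ≤ extent x j k

/-- For `j` between `4 * n ^ 4 + 1` and `4 * (n + 1) ^ 4` the sides are at least `2 * n ^ 6` and the
depth is below `n ^ 6`; the gap `n ^ 6 ≥ n` absorbs any constant. -/
theorem Good.tame (h : Good x) {n₀ : ℕ} (hsum : ∀ n ≥ n₀, ∀ b < 2,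
      ((2 * n ^ 6 : ℕ) : ℤ) ≤ ∑ r ∈ Finset.range (n ^ 4),
        shallowDisp x (n ^ 4) (2 * n ^ 4 + 2 * r + b))
    (hdeep : ∀ n ≥ n₀, ∀ j < 4 * (n + 1) ^ 4 + 1,
      maxDepth x (startTime x (j + 1)) < ((n ^ 6 : ℕ) : ℤ)) : Tame x := by
  have hext : ∀ n ≥ n₀, ∀ k, ((2 * n ^ 6 : ℕ) : ℤ) ≤ extent x (4 * n ^ 4 + 1) k := by
    intro n hn k
    obtain ⟨b, hb, rfl⟩ : ∃ b < 2, side x b + 1 = k := by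
      rcases fin_two_eq_or (side x 0) k with rfl | rfl
      · exact ⟨1, by omega, by rw [side_succ, fin_two_add]⟩
      · exact ⟨0, by omega, rfl⟩
    refine (hsum n hn b hb).trans ((h.sum_shallowDisp_le (n ^ 4) b (n ^ 4)).trans ?_)
    exact h.monotone_extent (side x b + 1) (show 2 * n ^ 4 + 2 * n ^ 4 + b ≤ 4 * n ^ 4 + 1 by omega)
  intro C
  set m := max n₀ C.toNat with hm
  refine ⟨4 * m ^ 4 + 1, fun j hj k => ?_⟩
  classical
  have hex : ∃ n, j < 4 * (n + 1) ^ 4 + 1 := by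
    refine ⟨j, ?_⟩
    have : j + 1 ≤ (j + 1) ^ 4 := Nat.le_self_pow (by norm_num) _
    omega
  set n := Nat.find hex with hn
  have hlt : j < 4 * (n + 1) ^ 4 + 1 := Nat.find_spec hex
  have hmn : m ≤ n := by
    by_contra! hc
    have : (n + 1) ^ 4 ≤ m ^ 4 := Nat.pow_le_pow_left hc 4
    omega
  have hge : 4 * n ^ 4 + 1 ≤ j := by
    rcases Nat.eq_zero_or_pos n with h0 | h0
    · have hm0 : m = 0 := by omega
      rw [hm0] at hj
      rw [h0]; exact hj
    · have := Nat.find_min hex (show n - 1 < n by omega)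
      rw [Nat.sub_add_cancel h0] at this
      omega
  have hn₀ : n₀ ≤ n := (le_max_left _ _).trans hmn
  have h1 := hext n hn₀ k
  have h2 := hdeep n hn₀ j hlt
  have h3 : extent x (4 * n ^ 4 + 1) k ≤ extent x j k := h.monotone_extent k hge
  have h4 : n ≤ n ^ 6 := Nat.le_self_pow (by norm_num) _
  have h5 : C.toNat ≤ n := (le_max_right _ _).trans hmn
  push_cast at h1 h2
  have h6 : (n : ℤ) ≤ (n : ℤ) ^ 6 := by exact_mod_cast h4
  omega

variable {Ω : Type*} [MeasurableSpace Ω] {μ : Measure Ω} {X : ℕ → Ω → Site}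

theorem ae_eventually_not_of_summable {S : ℕ → Set Ω} {f : ℕ → ℝ} (hf : Summable f)
    (hS : ∀ᶠ n in atTop, μ (S n) ≤ ENNReal.ofReal (f n)) :
    ∀ᵐ ω ∂μ, ∀ᶠ n in atTop, ω ∉ S n := by
  obtain ⟨n₀, hn₀⟩ := eventually_atTop.1 hS
  have hle : ∑' n, μ (S (n + n₀)) ≠ ∞ := by
    refine ne_top_of_le_ne_top ?_
      (ENNReal.tsum_le_tsum fun n => hn₀ (n + n₀) (Nat.le_add_left _ _))
    exact ((summable_nat_add_iff n₀).2 hf).tsum_ofReal_ne_top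
  filter_upwards [ae_eventually_notMem hle] with ω hω
  obtain ⟨m, hm⟩ := eventually_atTop.1 hω
  refine eventually_atTop.2 ⟨m + n₀, fun n hn => ?_⟩
  have := hm (n - n₀) (by omega)
  rwa [Nat.sub_add_cancel (by omega)] at this

/-- With `N = n ^ 4`, `L = 2 * n ^ 6` and `δ = 1 / n ^ 3` the exponent `4 * δ ^ 2 * L - 2 * δ * N +
2` is `10 - 2 * n`. -/
theorem ae_eventually_sum_shallowDisp [IsProbabilityMeasure μ] (hX : IsCornerWalk μ X) (b : ℕ) :
    ∀ᵐ ω ∂μ, ∀ᶠ n in atTop, ¬ (∑ r ∈ Finset.range (n ^ 4),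
      shallowDisp (trajectory X ω) (n ^ 4) (2 * n ^ 4 + 2 * r + b) < ((2 * n ^ 6 : ℕ) : ℤ)) := by
  have hsum : Summable fun n : ℕ => Real.exp 10 * Real.exp (-2) ^ n :=
    (summable_geometric_of_lt_one (Real.exp_pos _).le (by
      rw [Real.exp_lt_one_iff]; norm_num)).mul_left _
  refine ae_eventually_not_of_summable (S := fun n => {ω | ∑ r ∈ Finset.range (n ^ 4),
      shallowDisp (trajectory X ω) (n ^ 4) (2 * n ^ 4 + 2 * r + b) < ((2 * n ^ 6 : ℕ) : ℤ)}) hsum ?_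
  filter_upwards [eventually_ge_atTop 2] with n hn
  have hn' : (2 : ℝ) ≤ n := by exact_mod_cast hn
  have hn0 : (0 : ℝ) < n := by linarith
  have h8 : (8 : ℝ) ≤ n ^ 3 := by
    calc (8 : ℝ) = 2 ^ 3 := by norm_num
      _ ≤ n ^ 3 := by gcongr
  refine (measure_sum_shallowDisp_lt hX (n ^ 4) b (2 * n ^ 6) (δ := 1 / (n : ℝ) ^ 3)
    (by positivity) ?_).trans (ENNReal.ofReal_le_ofReal ?_)
  · rw [div_le_div_iff₀ (by positivity) (by norm_num)]; linarith
  · rw [← Real.exp_nat_mul, ← Real.exp_add]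
    refine Real.exp_le_exp.2 (le_of_eq ?_)
    push_cast
    field_simp
    ring

/-- Union bound: at most `65 * n ^ 4` excursions, each deep with probability at most `2 / n ^ 6`,
giving the summable `130 / n ^ 2`. -/
theorem ae_eventually_shallow [IsProbabilityMeasure μ] (hX : IsCornerWalk μ X) :
    ∀ᵐ ω ∂μ, ∀ᶠ n in atTop, ∀ j < 4 * (n + 1) ^ 4 + 1,
      maxDepth (trajectory X ω) (startTime (trajectory X ω) (j + 1)) < ((n ^ 6 : ℕ) : ℤ) := by
  have hsum : Summable fun n : ℕ => (130 : ℝ) * (1 / (n : ℝ) ^ 2) :=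
    (Real.summable_one_div_nat_pow.2 (by norm_num)).mul_left _
  have := ae_eventually_not_of_summable (μ := μ)
    (S := fun n => ⋃ j ∈ Finset.range (4 * (n + 1) ^ 4 + 1), {ω | ((n ^ 6 : ℕ) : ℤ) ≤
      maxDepth (trajectory X ω) (startTime (trajectory X ω) (j + 1))}) hsum ?_
  · filter_upwards [this] with ω hω
    filter_upwards [hω] with n hn j hj
    by_contra hc
    refine hn (Set.mem_biUnion (Finset.mem_coe.2 (Finset.mem_range.2 hj)) ?_)
    exact not_lt.1 hc
  · filter_upwards [eventually_ge_atTop 1] with n hn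
    have hn' : (1 : ℝ) ≤ n := by exact_mod_cast hn
    have hn0 : (0 : ℝ) < n := by linarith
    have h6 : 1 ≤ n ^ 6 := Nat.one_le_pow _ _ hn
    calc _ ≤ ∑ j ∈ Finset.range (4 * (n + 1) ^ 4 + 1), _ := measure_biUnion_finset_le _ _
      _ ≤ ∑ j ∈ Finset.range (4 * (n + 1) ^ 4 + 1),
          ENNReal.ofReal (2 / ((((n ^ 6 : ℕ) : ℤ) : ℝ) + 3)) :=
        Finset.sum_le_sum fun j _ => measure_deep_le hX j (by exact_mod_cast h6)
      _ = ENNReal.ofReal ((4 * (n + 1) ^ 4 + 1) * (2 / ((n : ℝ) ^ 6 + 3))) := by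
        rw [Finset.sum_const, Finset.card_range, nsmul_eq_mul, ← ENNReal.ofReal_natCast,
          ← ENNReal.ofReal_mul (Nat.cast_nonneg _)]
        push_cast
        rfl
      _ ≤ _ := by
        refine ENNReal.ofReal_le_ofReal ?_
        have e1 : (4 * ((n : ℝ) + 1) ^ 4 + 1) ≤ 65 * n ^ 4 := by
          have : ((n : ℝ) + 1) ^ 4 ≤ (2 * n) ^ 4 := by gcongr; linarith
          have h1 : (1 : ℝ) ≤ n ^ 4 := one_le_pow₀ hn'
          nlinarith
        calc _ ≤ 65 * (n : ℝ) ^ 4 * (2 / n ^ 6) := by gcongr; linarith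
          _ = _ := by field_simp; ring

theorem ae_tame [IsProbabilityMeasure μ] (hX : IsCornerWalk μ X) :
    ∀ᵐ ω ∂μ, Tame (trajectory X ω) := by
  filter_upwards [ae_good hX, ae_eventually_sum_shallowDisp hX 0,
    ae_eventually_sum_shallowDisp hX 1, ae_eventually_shallow hX] with ω hg h0 h1 h2
  obtain ⟨n₀, hn₀⟩ := eventually_atTop.1 (h0.and (h1.and h2))
  refine hg.tame (n₀ := n₀) (fun n hn b hb => ?_) fun n hn => (hn₀ n hn).2.2
  obtain rfl | rfl : b = 0 ∨ b = 1 := by omega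
  · exact not_lt.1 (hn₀ n hn).1
  · exact not_lt.1 (hn₀ n hn).2.1

theorem Tame.finite_truncated (ht : Tame x) (h : Good x) : {j | IsTruncated x j}.Finite := by
  obtain ⟨j₀, hj₀⟩ := ht 0
  refine (Set.finite_lt_nat j₀).subset fun j hj => ?_
  by_contra hc
  exact h.not_isTruncated (by simpa using hj₀ j (not_lt.1 hc) (side x j)) hj

/-- Both coordinates of a tame path of the corner model tend to infinity. -/
theorem Tame.eventually_le (ht : Tame x) (h : Good x) (C : ℤ) (k : Fin 2) :
    ∀ᶠ t in atTop, C ≤ x t k := by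
  obtain ⟨j₀, hj₀⟩ := ht C
  filter_upwards [eventually_ge_atTop (startTime x j₀ + 1)] with t htj
  have hpos : 0 < t := by omega
  obtain ⟨h1, h2⟩ := (h.exc_eq_iff hpos).1 (rfl : exc x t = exc x t)
  set j := exc x t
  have hj : j₀ ≤ j := by
    have := monotone_exc x htj
    rwa [h.exc_startTime_succ] at this
  have h3 := hj₀ j hj k
  have h4 := h.extent_le_startTime j k
  have h5 := h.depth_le_maxDepth h1.le h2
  have h6 := h.depth_nonneg h1.le h2
  -- Along the side the walk is behind the corner by at most the maximal depth, which `Tame`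
  -- controls; in the other coordinate it has only advanced.
  rcases fin_two_eq_or (side x j) k with rfl | rfl
  · unfold depth at h5; omega
  · have := h.outward_mono (j := j) le_rfl h1.le h2
    omega

end PrudentWalk

namespace PrudentWalk

/-! ### The clock of the coupled path -/

variable {x y : ℕ → Site} {u : ℕ} {s : Fin 2 → ℤˣ}

theorem clock_zero (x : ℕ → Site) : clock x 0 = 0 := rfl

theorem clock_succ (x : ℕ → Site) (j : ℕ) :
    clock x (j + 1) = clock x j + (lastKept x j - startTime x j) := by
  unfold clock
  rw [Finset.sum_range_succ]
  rfl

theorem reflection_succ_other (x : ℕ → Site) (s : Fin 2 → ℤˣ) (j : ℕ) :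
    reflection x s (j + 1) (side x j + 1) = reflection x s j (side x j + 1) := by
  rw [reflection]
  split_ifs
  · rw [Function.update_of_ne (fin_two_ne _)]
  · rfl

theorem reflection_succ_of_not_truncated (s : Fin 2 → ℤˣ) {j : ℕ} (h : ¬ IsTruncated x j) :
    reflection x s (j + 1) = reflection x s j := by
  rw [reflection, if_neg h]

theorem reflection_succ_of_truncated (s : Fin 2 → ℤˣ) {j : ℕ} (h : IsTruncated x j) :
    reflection x s (j + 1) (side x j) = -reflection x s j (side x j) := by
  rw [reflection, if_pos h, Function.update_self]

theorem units_cases (r : ℤˣ) : (r : ℤ) = 1 ∨ (r : ℤ) = -1 := by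
  rcases Int.units_eq_one_or r with rfl | rfl <;> simp

theorem units_mul_self (r : ℤˣ) : (r : ℤ) * r = 1 := coord_unit (units_cases r)

/-- Reflection of a site. -/
def reflect (r : Fin 2 → ℤˣ) (e : Site) : Site := fun k => (r k : ℤ) * e k

theorem reflect_reflect (r : Fin 2 → ℤˣ) (e : Site) : reflect r (reflect r e) = e := by
  funext k
  unfold reflect
  rw [← mul_assoc, units_mul_self, one_mul]

theorem coupledPath_zero (x : ℕ → Site) (s : Fin 2 → ℤˣ) : coupledPath x s 0 = 0 := by
  funext k
  simp [coupledPath]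

theorem coupledPath_succ (x : ℕ → Site) (s : Fin 2 → ℤˣ) (n : ℕ) (k : Fin 2) :
    coupledPath x s (n + 1) k = coupledPath x s n k + (reflection x s (excursionIndex x n) k : ℤ) *
      (x (sourceTime x n + 1) k - x (sourceTime x n) k) := by
  unfold coupledPath
  rw [Finset.sum_range_succ]

namespace Good

variable (h : Good x)
include h

theorem strictMono_clock : StrictMono (clock x) := by
  refine strictMono_nat_of_lt_succ fun j => ?_
  have := (h.lastKept_spec j).1
  rw [clock_succ]; omega

theorem excursionIndex_eq {j n : ℕ} (h1 : clock x j ≤ n) (h2 : n < clock x (j + 1)) :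
    excursionIndex x n = j := by
  unfold excursionIndex
  -- Every excursion takes at least one step, so the search bound `n` in `excursionIndex` loses
  -- nothing.
  have hj : j ≤ n := (h.strictMono_clock.id_le j).trans h1
  refine (Nat.findGreatest_eq_iff).2 ⟨hj, fun _ => h1, fun k hk _ hc => ?_⟩
  have := h.strictMono_clock.monotone (show j + 1 ≤ k by omega)
  omega

theorem exists_clock_le (n : ℕ) : ∃ j, clock x j ≤ n ∧ n < clock x (j + 1) := by
  refine ⟨excursionIndex x n, ?_, ?_⟩
  · unfold excursionIndex
    exact Nat.findGreatest_spec (P := fun j => clock x j ≤ n) (Nat.zero_le n) (by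
      rw [clock_zero]; exact Nat.zero_le n)
  · by_contra! hc
    have hle : excursionIndex x n + 1 ≤ n := (h.strictMono_clock.id_le _).trans hc
    have := Nat.le_findGreatest (P := fun j => clock x j ≤ n) hle hc
    unfold excursionIndex at this
    omega

theorem source_eq {j v : ℕ} (h1 : startTime x j ≤ v) (h2 : v < lastKept x j) :
    excursionIndex x (clock x j + (v - startTime x j)) = j ∧
      sourceTime x (clock x j + (v - startTime x j)) = v := by
  have e : excursionIndex x (clock x j + (v - startTime x j)) = j := by
    refine h.excursionIndex_eq (by omega) ?_
    rw [clock_succ]; omega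
  refine ⟨e, ?_⟩
  unfold sourceTime
  rw [e]; omega

/-- The steps of the coupled path are reflected copies of those of the corner path. -/
theorem coupledPath_step {j v : ℕ} (h1 : startTime x j ≤ v) (h2 : v < lastKept x j) (k : Fin 2) :
    coupledPath x s (clock x j + (v + 1 - startTime x j)) k =
      coupledPath x s (clock x j + (v - startTime x j)) k +
        (reflection x s j k : ℤ) * (x (v + 1) k - x v k) := by
  obtain ⟨e1, e2⟩ := h.source_eq h1 h2
  rw [show clock x j + (v + 1 - startTime x j) = clock x j + (v - startTime x j) + 1 by omega,
    coupledPath_succ, e1, e2]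

theorem coupledPath_eq {j v : ℕ} (h1 : startTime x j ≤ v) (h2 : v ≤ lastKept x j) (k : Fin 2) :
    coupledPath x s (clock x j + (v - startTime x j)) k = coupledPath x s (clock x j) k +
      (reflection x s j k : ℤ) * (x v k - x (startTime x j) k) := by
  induction v, h1 using Nat.le_induction with
  | base => simp
  | succ v hv ih =>
    rw [h.coupledPath_step hv (by omega), ih (by omega)]; ring

/-! ### The coupled path and its bounding rectangle -/

end Good

/-- The bounding rectangle of the coupled path at the start of an excursion. -/
def boxRange (x : ℕ → Site) (s : Fin 2 → ℤˣ) (j : ℕ) (k : Fin 2) : Set ℤ :=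
  {v | (reflection x s j k : ℤ) * coupledPath x s (clock x j) k - extent x j k ≤
      (reflection x s j k : ℤ) * v ∧
    (reflection x s j k : ℤ) * v ≤ (reflection x s j k : ℤ) * coupledPath x s (clock x j) k}

/-- The bounding rectangle of the coupled path at the time corresponding to the time `v` of the
corner path. -/
def sideRange (x : ℕ → Site) (s : Fin 2 → ℤˣ) (j v : ℕ) (k : Fin 2) : Set ℤ :=
  if k = side x j then boxRange x s j k else
    {w | (reflection x s j k : ℤ) * coupledPath x s (clock x j) k - extent x j k ≤
        (reflection x s j k : ℤ) * w ∧
      (reflection x s j k : ℤ) * w ≤ (reflection x s j k : ℤ) *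
        coupledPath x s (clock x j + (v - startTime x j)) k}

theorem sideRange_side (x : ℕ → Site) (s : Fin 2 → ℤˣ) (j v : ℕ) :
    sideRange x s j v (side x j) = boxRange x s j (side x j) := if_pos rfl

theorem sideRange_other (x : ℕ → Site) (s : Fin 2 → ℤˣ) (j v : ℕ) :
    sideRange x s j v (side x j + 1) =
      {w | (reflection x s j (side x j + 1) : ℤ) * coupledPath x s (clock x j) (side x j + 1) -
          extent x j (side x j + 1) ≤ (reflection x s j (side x j + 1) : ℤ) * w ∧
        (reflection x s j (side x j + 1) : ℤ) * w ≤ (reflection x s j (side x j + 1) : ℤ) *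
          coupledPath x s (clock x j + (v - startTime x j)) (side x j + 1)} :=
  if_neg (fin_two_ne _)

theorem insert_range {r a b p q : ℤ} (hr : r = 1 ∨ r = -1) (hq : q = p + r) (hab : a ≤ r * p)
    (hb : b = r * p) :
    {w : ℤ | a ≤ r * w ∧ r * w ≤ r * q} = insert q {w : ℤ | a ≤ r * w ∧ r * w ≤ b} := by
  subst hq hb
  ext w
  simp only [Set.mem_ofPred_eq, Set.mem_insert_iff]
  rcases hr with rfl | rfl <;> omega

namespace Good

variable (h : Good x)
include h

/-- Propagation of the invariant along an excursion. -/
theorem onSide_of_fills {j : ℕ}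
    (hF : Fills ∅ (coupledPath x s) (clock x j) (boxRange x s j)) {v : ℕ}
    (h1 : startTime x j < v) (h2 : v ≤ lastKept x j) :
    OnSide ∅ (coupledPath x s) (clock x j + (v - startTime x j)) (sideRange x s j v) (side x j)
      (reflection x s j (side x j + 1)) (reflection x s j (side x j) * lastAlong x v) := by
  obtain ⟨k1, k2, k3, -⟩ := h.lastKept_spec j
  have hlast : ∀ v, startTime x j < v → v ≤ lastKept x j →
      lastAlong x v = x v (side x j) - x (v - 1) (side x j) := by
    intro v h1 h2
    unfold lastAlong
    rw [h.excSide_eq h1 (h2.trans k2)]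
  have hr := units_cases (reflection x s j (side x j + 1))
  have hri := units_mul_self (reflection x s j (side x j))
  have hext := h.extent_nonneg j
  induction v, h1 using Nat.le_induction with
  | base =>
    rw [Nat.succ_eq_add_one] at h2 ⊢
    obtain ⟨f1, f2⟩ := h.first_step j
    have hstep := fun k => h.coupledPath_step (s := s) (j := j) le_rfl k1 k
    simp only [Nat.sub_self, add_zero] at hstep
    have e : clock x j + (startTime x j + 1 - startTime x j) = clock x j + 1 := by omega
    have hl : lastAlong x (startTime x j + 1) = 0 := by
      rw [hlast _ (by omega) h2, Nat.add_sub_cancel, f2, sub_self]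
    rw [hl, mul_zero]
    have o1 := hstep (side x j)
    have o2 := hstep (side x j + 1)
    rw [f2, sub_self, mul_zero, add_zero] at o1
    rw [f1, add_sub_cancel_left, mul_one] at o2
    rw [e] at o1 o2
    rw [e]
    refine hF.outward hr (fun y hy => (hF.mem y hy _).2) o1 o2 (sideRange_side x s j _) ?_
    rw [sideRange_other, e]
    exact insert_range hr o2 (by have := hext (side x j + 1); omega) rfl
  | succ v hv ih =>
    have hv' : startTime x j < v := hv
    specialize ih (by omega)
    have hstep := fun k => h.coupledPath_step (s := s) (j := j) hv'.le h2 k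
    have e : clock x j + (v + 1 - startTime x j) = clock x j + (v - startTime x j) + 1 := by omega
    have hl := hlast (v + 1) (by omega) h2
    rw [Nat.add_sub_cancel] at hl
    have o1 := hstep (side x j)
    have o2 := hstep (side x j + 1)
    rcases h.step_cases hv' (by omega) with ⟨s1, s2⟩ | ⟨s1, c, hc, hcc, s2⟩
    · rw [s1, sub_self, mul_zero, add_zero] at o1
      rw [s2, add_sub_cancel_left, mul_one] at o2
      rw [hl, s1, sub_self, mul_zero]
      rw [e] at o1 o2
      rw [e]
      refine ih.outward hr o1 o2 ?_ ?_
      · rw [sideRange_side, sideRange_side]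
      · rw [sideRange_other, sideRange_other, e]
        refine insert_range hr o2 ?_ rfl
        have hm := ih.mem _ (self_mem_occupied _ _ _) (side x j + 1)
        rw [sideRange_other] at hm
        exact hm.1
    · rw [s1, sub_self, mul_zero, add_zero] at o2
      rw [s2, add_sub_cancel_left] at o1
      rw [hl, s2, add_sub_cancel_left]
      have hR : sideRange x s j (v + 1) = sideRange x s j v := by
        funext k
        rcases fin_two_eq_or (side x j) k with rfl | rfl
        · rw [sideRange_side, sideRange_side]
        · rw [sideRange_other, sideRange_other, o2]
      have hpos := h.coupledPath_eq (s := s) (j := j) (v := v + 1) (by omega) h2 (side x j)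
      rw [hR]
      rw [e] at o1 o2 hpos ⊢
      refine ih.along ?_ ?_ o1 o2 ?_
      · rcases units_cases (reflection x s j (side x j)) with h3 | h3 <;> rw [h3] <;> omega
      · rcases hcc with h3 | h3
        · left; rw [h3, mul_zero]
        · right; rw [h3]
      · rw [sideRange_side]
        -- The kept depth lies between zero and the length of the side, so a step along the side
        -- stays in the rectangle.
        have d1 := k3 (v + 1) (by omega) h2
        have d2 := h.depth_nonneg (j := j) (u := v + 1) (by omega) (h2.trans k2)
        unfold depth at d1 d2
        rw [boxRange, Set.mem_ofPred_eq, hpos, mul_add, ← mul_assoc, hri]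
        omega

/-- A kept part ends at a corner: the one it started from in the coordinate of the side, or the
opposite one if truncated, the depth then being exactly the extent. Reversing the sign describes the
same interval from its other end. -/
theorem fills_succ {j : ℕ}
    (hF : Fills ∅ (coupledPath x s) (clock x j) (boxRange x s j)) :
    Fills ∅ (coupledPath x s) (clock x (j + 1)) (boxRange x s (j + 1)) := by
  obtain ⟨k1, k2, k3, k4, k5⟩ := h.lastKept_spec j
  have hS := (h.onSide_of_fills hF k1 le_rfl).toFills
  rw [← clock_succ] at hS
  have hpos := fun k => h.coupledPath_eq (s := s) (j := j) k1.le le_rfl k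
  rw [← clock_succ] at hpos
  have hR : boxRange x s (j + 1) = sideRange x s j (lastKept x j) := by
    funext k
    rcases fin_two_eq_or (side x j) k with rfl | rfl
    · rw [sideRange_side]
      unfold boxRange
      rw [extent_succ_side]
      by_cases ht : IsTruncated x j
      · obtain ⟨-, d1, -⟩ := k4 ht
        unfold depth at d1
        rw [reflection_succ_of_truncated s ht, hpos]
        have hri := units_mul_self (reflection x s j (side x j))
        have e : (reflection x s j (side x j) : ℤ) * (coupledPath x s (clock x j) (side x j) +
            (reflection x s j (side x j) : ℤ) * (x (lastKept x j) (side x j) -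
              x (startTime x j) (side x j))) =
            (reflection x s j (side x j) : ℤ) * coupledPath x s (clock x j) (side x j) -
              extent x j (side x j) := by
          rw [mul_add, ← mul_assoc, hri]; omega
        ext v
        simp only [Set.mem_ofPred_eq, Units.val_neg, neg_mul, e]
        omega
      · rw [reflection_succ_of_not_truncated s ht, hpos, k5 ht, h.along_end, sub_self, mul_zero,
          add_zero]
    · rw [sideRange_other, ← clock_succ]
      unfold boxRange
      rw [reflection_succ_other, extent_succ_other, hpos]
      have hri := units_mul_self (reflection x s j (side x j + 1))
      ext v
      simp only [Set.mem_ofPred_eq, mul_add, ← mul_assoc, hri]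
      omega
  rw [hR]
  exact hS

theorem fills_clock (s : Fin 2 → ℤˣ) (j : ℕ) :
    Fills ∅ (coupledPath x s) (clock x j) (boxRange x s j) := by
  induction j with
  | zero =>
    have hocc : occupied ∅ (coupledPath x s) 0 = {0} := by
      rw [occupied, Set.empty_union, show Set.Iic 0 = {0} by ext; simp, Set.image_singleton,
        coupledPath_zero]
    have hr : ∀ k, boxRange x s 0 k = {0} := by
      intro k
      ext v
      have he : extent x 0 k = 0 := rfl
      rw [boxRange, clock_zero, coupledPath_zero, he]
      simp only [Set.mem_ofPred_eq, Pi.zero_apply, mul_zero, sub_zero, Set.mem_singleton_iff]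
      rcases units_cases (reflection x s 0 k) with h3 | h3 <;> rw [h3] <;> omega
    rw [clock_zero]
    refine ⟨?_, ?_⟩
    · rw [hocc]
      rintro y rfl k
      rw [hr]; rfl
    · rw [hocc]
      intro k v hv
      rw [hr] at hv
      exact ⟨0, rfl, hv.symm⟩
  | succ j ih => exact h.fills_succ ih

/-- The directions allowed to the coupled path are reflected copies of those allowed to the corner
path. -/
theorem mem_allowed_coupledPath_iff (s : Fin 2 → ℤˣ) {j v : ℕ} (h1 : startTime x j < v)
    (h2 : v ≤ lastKept x j) {e : Site} :
    e ∈ allowedDirections ∅ (coupledPath x s) (clock x j + (v - startTime x j)) ↔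
      reflect (reflection x s j) e ∈ allowedDirections southWest x v := by
  have hk := (h.lastKept_spec j).2.1
  have hE := h.inExcursion (show 0 < v by omega)
  have hA := h.onSide_of_fills (h.fills_clock s j) h1 h2
  have hB := hE.onSide
  rw [h.excSide_eq h1 (h2.trans hk)] at hB
  have hc := hE.last_mem
  -- Both walks are on a side, with outward directions and last steps exchanged by the reflection,
  -- so the two criteria match.
  rw [hA.mem_allowed_iff (units_cases _), hB.mem_allowed_iff (Or.inl rfl) hc]
  · unfold reflect
    rcases units_cases (reflection x s j (side x j)) with h3 | h3 <;>
    rcases units_cases (reflection x s j (side x j + 1)) with h4 | h4 <;>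
    rw [h3, h4] <;> omega
  · rcases units_cases (reflection x s j (side x j)) with h3 | h3 <;> rw [h3] <;> omega

theorem card_allowed_coupledPath (s : Fin 2 → ℤˣ) {j v : ℕ} (h1 : startTime x j < v)
    (h2 : v ≤ lastKept x j) :
    (allowedDirections ∅ (coupledPath x s) (clock x j + (v - startTime x j))).card =
      (allowedDirections southWest x v).card := by
  refine Finset.card_bij (fun e _ => reflect (reflection x s j) e)
    (fun e he => (h.mem_allowed_coupledPath_iff s h1 h2).1 he) ?_ ?_
  · intro e _ e' _ hee
    rw [← reflect_reflect (reflection x s j) e, hee, reflect_reflect]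
  · intro e he
    refine ⟨reflect (reflection x s j) e, ?_, reflect_reflect _ _⟩
    rw [h.mem_allowed_coupledPath_iff s h1 h2, reflect_reflect]
    exact he

/-- The next step of the coupled path is the reflected copy of the next step of the corner path,
even if it belongs to the next excursion. -/
theorem coupledPath_next (s : Fin 2 → ℤˣ) {j v : ℕ} (h1 : startTime x j < v)
    (h2 : v ≤ lastKept x j) :
    coupledPath x s (clock x j + (v - startTime x j) + 1) -
      coupledPath x s (clock x j + (v - startTime x j)) =
        reflect (reflection x s j) (x (v + 1) - x v) := by
  obtain ⟨k1, k2, k3, k4, k5⟩ := h.lastKept_spec j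
  rcases h2.lt_or_eq with h2 | rfl
  · funext k
    have := h.coupledPath_step (s := s) h1.le h2 k
    rw [show clock x j + (v + 1 - startTime x j) = clock x j + (v - startTime x j) + 1 by omega]
      at this
    rw [Pi.sub_apply, this]
    unfold reflect
    rw [Pi.sub_apply]
    ring
  · rw [← clock_succ]
    have hn := fun k => h.coupledPath_step (s := s) (j := j + 1) le_rfl (h.lastKept_spec (j + 1)).1 k
    simp only [Nat.sub_self, add_zero, Nat.add_sub_cancel_left] at hn
    obtain ⟨f1, f2⟩ := h.first_step (j + 1)
    rw [side_succ, fin_two_add] at f1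
    rw [side_succ] at f2
    -- In the truncated case the corner path makes the discarded step to depth `extent + 1`, a `-1`
    -- along the side; the coupled path makes the first outward step `+1` of the next excursion with
    -- the opposite sign, which is the same step. Without truncation nothing is skipped.
    by_cases ht : IsTruncated x j
    · obtain ⟨t1, t2, t3⟩ := k4 ht
      refine site_ext (side x j) ?_ ?_
      · rw [Pi.sub_apply, hn, reflection_succ_of_truncated s ht, f1]
        unfold reflect
        unfold depth at t2 t3
        rw [Pi.sub_apply, show x (lastKept x j + 1) (side x j) - x (lastKept x j) (side x j) = -1 by
          omega]
        push_cast
        ring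
      · rw [Pi.sub_apply, hn, f2]
        unfold reflect
        have : x (lastKept x j + 1) (side x j + 1) = x (lastKept x j) (side x j + 1) := by
          unfold depth at t2 t3
          rcases h.step_cases h1 t1 with ⟨s1, -⟩ | ⟨s1, -⟩
          · omega
          · exact s1
        rw [Pi.sub_apply, this]
        ring
    · funext k
      rw [Pi.sub_apply, hn, reflection_succ_of_not_truncated s ht, k5 ht]
      unfold reflect
      rw [Pi.sub_apply]
      ring

end Good

end PrudentWalk

namespace PrudentWalk

/-! ### Measurability of the coupled path -/

section

variable {α β ι : Type*} [MeasurableSpace α] [MeasurableSpace β] [MeasurableSpace ι] [Countable ι]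
  [MeasurableSingletonClass ι]

theorem measurable_comp_countable {f : ι → α → β} {g : α → ι} (hf : ∀ i, Measurable (f i))
    (hg : Measurable g) : Measurable fun a => f (g a) a := by
  intro S hS
  have : (fun a => f (g a) a) ⁻¹' S = ⋃ i, g ⁻¹' {i} ∩ f i ⁻¹' S := by
    ext a
    simp
  rw [this]
  exact MeasurableSet.iUnion fun i => (hg (measurableSet_singleton i)).inter (hf i hS)

theorem measurable_nat_sInf {P : α → ℕ → Prop} (hP : ∀ t, MeasurableSet {a | P a t}) :
    Measurable fun a => sInf {t | P a t} := by
  refine measurable_to_countable' fun n => ?_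
  -- The second set accounts for the default value `sInf ∅ = 0`.
  have : (fun a => sInf {t | P a t}) ⁻¹' {n} =
      ({a | P a n} ∩ ⋂ k ∈ Finset.range n, {a | P a k}ᶜ) ∪
        ({_a : α | n = 0} ∩ ⋂ k, {a | P a k}ᶜ) := by
    ext a
    simp only [Set.mem_preimage, Set.mem_singleton_iff, Set.mem_union, Set.mem_inter_iff,
      Set.mem_ofPred_eq, Set.mem_iInter, Set.mem_compl_iff, Finset.mem_range]
    constructor
    · rintro rfl
      rcases Set.eq_empty_or_nonempty {t | P a t} with h | h
      · right
        rw [h]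
        exact ⟨Nat.sInf_empty, fun k hk => Set.eq_empty_iff_forall_notMem.1 h k hk⟩
      · exact Or.inl ⟨Nat.sInf_mem h, fun k hk => Nat.notMem_of_lt_sInf hk⟩
    · rintro (⟨h1, h2⟩ | ⟨rfl, h2⟩)
      · exact le_antisymm (Nat.sInf_le h1)
          (le_csInf ⟨n, h1⟩ fun k hk => not_lt.1 fun hlt => h2 k hlt hk)
      · have : {t | P a t} = ∅ := Set.eq_empty_iff_forall_notMem.2 h2
        rw [this, Nat.sInf_empty]
  rw [this]
  refine ((hP n).inter ?_).union ((MeasurableSet.const _).inter ?_)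
  · exact Finset.measurableSet_biInter _ fun k _ => (hP k).compl
  · exact MeasurableSet.iInter fun k => (hP k).compl

end

theorem measurable_coord (t : ℕ) (k : Fin 2) : Measurable fun x : ℕ → Site => x t k :=
  (measurable_pi_apply k).comp (measurable_pi_apply t)

theorem measurable_at {N : (ℕ → Site) → ℕ} {i : (ℕ → Site) → Fin 2} (hN : Measurable N)
    (hi : Measurable i) : Measurable fun x : ℕ → Site => x (N x) (i x) :=
  measurable_comp_countable (f := fun (p : ℕ × Fin 2) (x : ℕ → Site) => x p.1 p.2)
    (g := fun x => (N x, i x)) (fun p => measurable_coord p.1 p.2) (hN.prodMk hi)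

theorem measurable_side (j : ℕ) : Measurable fun x => side x j := by
  induction j with
  | zero =>
    refine Measurable.ite ?_ measurable_const measurable_const
    exact measurable_pi_apply 1 (measurableSet_singleton _)
  | succ j ih => exact (Measurable.of_discrete (f := fun i : Fin 2 => i + 1)).comp ih

theorem measurable_startTime (j : ℕ) : Measurable fun x => startTime x j := by
  induction j with
  | zero => exact measurable_const
  | succ j ih =>
    refine (Measurable.of_discrete (f := fun n : ℕ => n - 1)).comp (measurable_nat_sInf fun t => ?_)
    exact (measurableSet_lt ih measurable_const).inter
      (measurableSet_lt (measurable_at ih (measurable_side j))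
        (measurable_at measurable_const (measurable_side j)))

theorem measurable_depth (j t : ℕ) : Measurable fun x => depth x j t :=
  (measurable_at (measurable_startTime j) (measurable_side j)).sub
    (measurable_at measurable_const (measurable_side j))

theorem measurableSet_exceeds (j : ℕ) {l : (ℕ → Site) → ℤ} (hl : Measurable l) :
    MeasurableSet {x | Exceeds x j (l x)} := by
  have : {x | Exceeds x j (l x)} = ⋃ t, ({x | startTime x j ≤ t} ∩ {x | t ≤ startTime x (j + 1)} ∩
      {x | l x < depth x j t}) := by
    ext x
    simp [Exceeds, and_assoc]
  rw [this]
  refine MeasurableSet.iUnion fun t => ((measurableSet_le (measurable_startTime j)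
    measurable_const).inter (measurableSet_le measurable_const (measurable_startTime _))).inter
      (measurableSet_lt hl (measurable_depth j t))

theorem measurable_keptEnd (j : ℕ) {l : (ℕ → Site) → ℤ} (hl : Measurable l) :
    Measurable fun x => keptEnd x j (l x) := by
  refine Measurable.ite (measurableSet_exceeds j hl) ?_ (measurable_startTime _)
  refine (Measurable.of_discrete (f := fun n : ℕ => n - 1)).comp (measurable_nat_sInf fun t => ?_)
  exact (measurableSet_le (measurable_startTime j) measurable_const).inter
    (measurableSet_eq_fun (measurable_depth j t) (hl.add measurable_const))

theorem measurable_extent (j : ℕ) (k : Fin 2) : Measurable fun x => extent x j k := by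
  induction j generalizing k with
  | zero => exact measurable_const
  | succ j ih =>
    have hat : ∀ {i : (ℕ → Site) → Fin 2}, Measurable i → Measurable fun x => extent x j (i x) :=
      fun hi => measurable_comp_countable (f := fun k x => extent x j k) ih hi
    have hs := measurable_side (j + 1)
    have : (fun x => extent x (j + 1) k) = fun x => if k = side x (j + 1) then
        extent x j (side x (j + 1)) + (x (keptEnd x j (extent x j (side x j))) (side x (j + 1)) -
          x (startTime x j) (side x (j + 1))) else extent x j k := by
      funext x
      rw [extent, side_succ, Function.update_apply]
    rw [this]
    refine Measurable.ite (measurableSet_eq_fun measurable_const hs) ((hat hs).add ?_) (ih k)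
    exact (measurable_at (measurable_keptEnd j (hat (measurable_side j))) hs).sub
      (measurable_at (measurable_startTime j) hs)

theorem measurable_extent_side (j : ℕ) : Measurable fun x => extent x j (side x j) :=
  measurable_comp_countable (f := fun k x => extent x j k) (measurable_extent j) (measurable_side j)

theorem measurableSet_isTruncated (j : ℕ) : MeasurableSet {x | IsTruncated x j} :=
  measurableSet_exceeds j (measurable_extent_side j)

theorem measurable_clock (j : ℕ) : Measurable fun x => clock x j := by
  unfold clock
  refine Finset.measurable_sum _ fun i _ => ?_
  exact (measurable_keptEnd i (measurable_extent_side i)).sub (measurable_startTime i)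

theorem measurable_reflection (s : Fin 2 → ℤˣ) (j : ℕ) (k : Fin 2) :
    Measurable fun x => (reflection x s j k : ℤ) := by
  classical
  induction j generalizing k with
  | zero => exact measurable_const (a := ((s k : ℤˣ) : ℤ))
  | succ j ih =>
    have : (fun x => (reflection x s (j + 1) k : ℤ)) = fun x => if IsTruncated x j then
        (if k = side x j then -(reflection x s j k : ℤ) else (reflection x s j k : ℤ)) else
          (reflection x s j k : ℤ) := by
      funext x
      rw [reflection]
      by_cases h1 : IsTruncated x j
      · rw [if_pos h1, if_pos h1]
        by_cases h2 : k = side x j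
        · rw [h2, Function.update_self, Units.val_neg, if_pos rfl]
        · rw [Function.update_of_ne h2, if_neg h2]
      · rw [if_neg h1, if_neg h1]
    rw [this]
    refine Measurable.ite (measurableSet_isTruncated j) (Measurable.ite ?_ (ih k).neg (ih k)) (ih k)
    exact measurableSet_eq_fun measurable_const (measurable_side j)

theorem measurable_excursionIndex (n : ℕ) : Measurable fun x => excursionIndex x n :=
  measurable_findGreatest fun j _ => measurableSet_le (measurable_clock j) measurable_const

theorem measurable_sourceTime (n : ℕ) : Measurable fun x => sourceTime x n := by
  have h := measurable_excursionIndex n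
  exact (measurable_comp_countable (f := fun j x => startTime x j) measurable_startTime h).add
    ((measurable_const (a := n)).sub
      (measurable_comp_countable (f := fun j x => clock x j) measurable_clock h))

theorem measurable_coupledPath (s : Fin 2 → ℤˣ) (t : ℕ) : Measurable fun x => coupledPath x s t := by
  refine measurable_pi_lambda _ fun k => Finset.measurable_sum _ fun n _ => ?_
  have hs := measurable_sourceTime n
  refine (measurable_comp_countable (f := fun j x => (reflection x s j k : ℤ))
    (fun j => measurable_reflection s j k) (measurable_excursionIndex n)).mul ?_
  exact (measurable_at (hs.add measurable_const) measurable_const).sub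
    (measurable_at hs measurable_const)

variable {Ω : Type*} [MeasurableSpace Ω] {μ : Measure Ω} {X : ℕ → Ω → Site}

theorem measurable_trajectory (hX : ∀ t, Measurable (X t)) : Measurable (trajectory X) :=
  measurable_pi_lambda _ hX

theorem measurable_units_val : Measurable (fun r : ℤˣ => (r : ℤ)) :=
  comap_measurable _

instance : MeasurableSingletonClass ℤˣ := ⟨fun r => by
  have : ({r} : Set ℤˣ) = (fun r : ℤˣ => (r : ℤ)) ⁻¹' {(r : ℤ)} := by
    ext q
    simp [Units.ext_iff]
  rw [this]
  exact measurable_units_val (measurableSet_singleton _)⟩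

theorem measurable_coupledWalk (hX : ∀ t, Measurable (X t)) {σ : Ω → Fin 2 → ℤˣ}
    (hσ : Measurable σ) (t : ℕ) : Measurable (coupledWalk X σ t) :=
  measurable_comp_countable (f := fun s ω => coupledPath (trajectory X ω) s t)
    (fun s => (measurable_coupledPath s t).comp (measurable_trajectory hX)) hσ

end PrudentWalk

namespace PrudentWalk

/-! ### Locality of the coupled path -/

variable {x y : ℕ → Site} {u : ℕ} {s : Fin 2 → ℤˣ}

/-- The strict inequality is essential: the start of an excursion is recognised only from the step
that follows it. -/
theorem Agree.startTime_eq (hag : Agree u x y) (hx : Good x) (hy : Good y) {j : ℕ}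
    (hj : startTime x j < u) : startTime y j = startTime x j := by
  have hag' := hag.mono (show startTime x j + 1 ≤ u by omega)
  have h1 := hag'.exc_eq (Nat.succ_pos _)
  rw [hx.exc_startTime_succ] at h1
  rw [← hx.excStart_eq (Nat.lt_succ_self _) (hx.startTime_lt j), hag'.excStart_eq (Nat.succ_pos _),
    ← (hy.inExcursion (Nat.succ_pos _)).start_eq, ← h1]

theorem Agree.depth_eq (hag : Agree u x y) (hx : Good x) (hy : Good y) {j t : ℕ}
    (hj : startTime x j < u) (ht : t ≤ u) : depth y j t = depth x j t := by
  unfold depth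
  rw [hag.startTime_eq hx hy hj, hag.side_eq (by omega), hag t ht, hag _ hj.le]

theorem Agree.lastKept_eq (hag : Agree u x y) (hx : Good x) (hy : Good y) {j : ℕ}
    (hj : startTime x (j + 1) < u) (hext : extent y j = extent x j) :
    lastKept y j = lastKept x j := by
  have hj' : startTime x j < u := (hx.startTime_lt j).trans hj
  have e1 := hag.startTime_eq hx hy hj
  have e0 := hag.startTime_eq hx hy hj'
  have es : side y j = side x j := (hag.side_eq (by omega) j).symm
  have hd : ∀ t ≤ startTime x (j + 1), depth y j t = depth x j t := fun t ht =>
    hag.depth_eq hx hy hj' (by omega)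
  obtain ⟨a1, a2, a3, a4, a5⟩ := hx.lastKept_spec j
  obtain ⟨b1, b2, b3, b4, b5⟩ := hy.lastKept_spec j
  have hiff : IsTruncated y j ↔ IsTruncated x j := by
    unfold IsTruncated Exceeds
    rw [e0, e1, es, hext]
    refine exists_congr fun t => and_congr_right fun _ => and_congr_right fun ht => ?_
    rw [hd t ht]
  rw [e0] at b1 b3
  rw [e1] at b2 b4 b5
  rw [hext, es] at b3 b4
  by_cases ht : IsTruncated x j
  · obtain ⟨a6, a7, a8⟩ := a4 ht
    obtain ⟨b6, b7, b8⟩ := b4 (hiff.2 ht)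
    refine le_antisymm ?_ ?_
    · by_contra! hc
      have h1 := b3 (lastKept x j + 1) (by omega) (by omega)
      rw [hd _ (by omega)] at h1
      omega
    · by_contra! hc
      have h1 := a3 (lastKept y j + 1) (by omega) (by omega)
      rw [← hd _ (by omega)] at h1
      omega
  · rw [a5 ht, b5 (mt hiff.1 ht)]

theorem Agree.excursion_data_eq (hag : Agree u x y) (hx : Good x) (hy : Good y) {j : ℕ}
    (hj : startTime x j < u) : extent y j = extent x j ∧ clock y j = clock x j ∧
      ∀ s, reflection y s j = reflection x s j := by
  classical
  induction j with
  | zero => exact ⟨rfl, rfl, fun _ => rfl⟩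
  | succ j ih =>
    have hj' : startTime x j < u := (hx.startTime_lt j).trans hj
    obtain ⟨i1, i2, i3⟩ := ih hj'
    have es : side y j = side x j := (hag.side_eq (by omega) j).symm
    have hk := hag.lastKept_eq hx hy hj i1
    have e1 := hag.startTime_eq hx hy hj
    have e0 := hag.startTime_eq hx hy hj'
    obtain ⟨a1, a2, -⟩ := hx.lastKept_spec j
    refine ⟨?_, ?_, fun s => ?_⟩
    · funext k
      rcases fin_two_eq_or (side x j) k with rfl | rfl
      · rw [extent_succ_side, ← es, extent_succ_side, i1]
      · have := extent_succ_other y j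
        rw [es, hk, e0, ← hag _ (show lastKept x j ≤ u by omega), ← hag _ hj'.le, i1] at this
        rw [extent_succ_other, this]
    · rw [clock_succ, clock_succ, i2, hk, e0]
    · have hiff : IsTruncated y j ↔ IsTruncated x j := by
        unfold IsTruncated Exceeds
        rw [e0, e1, es, i1]
        refine exists_congr fun t => and_congr_right fun _ => and_congr_right fun ht => ?_
        rw [hag.depth_eq hx hy hj' (by omega)]
      by_cases ht : IsTruncated x j
      · rw [reflection, reflection, if_pos ht, if_pos (hiff.2 ht), i3, es]
      · rw [reflection, reflection, if_neg ht, if_neg (mt hiff.1 ht), i3]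

/-- The time `n` of the coupled path corresponds to the time `u` of the corner path, which belongs
to the kept part of the `j`-th excursion. -/
structure Corresponds (x : ℕ → Site) (j u n : ℕ) : Prop where
  lt : startTime x j < u
  le : u ≤ lastKept x j
  eq : n = clock x j + (u - startTime x j)

theorem Good.corresponds_iff (h : Good x) {j u n : ℕ} :
    Corresponds x j u (n + 1) ↔ excursionIndex x n = j ∧ sourceTime x n + 1 = u := by
  constructor
  · rintro ⟨h1, h2, h3⟩
    obtain ⟨e1, e2⟩ := h.source_eq (j := j) (v := u - 1) (by omega) (by omega)
    rw [show clock x j + (u - 1 - startTime x j) = n by omega] at e1 e2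
    exact ⟨e1, by omega⟩
  · rintro ⟨rfl, rfl⟩
    obtain ⟨k, h1, h2⟩ := h.exists_clock_le n
    have e := h.excursionIndex_eq h1 h2
    have := (h.lastKept_spec k).1
    rw [clock_succ] at h2
    unfold sourceTime
    rw [e]
    exact ⟨by omega, by omega, by omega⟩

/-- This plays the role of a stopping-time property: whether time `n` of the coupled path
corresponds to time `u`, and the coupled path up to `n`, depend only on the corner path up to `u`,
even though skipped pieces have random length. -/
theorem Corresponds.agree {j n : ℕ} (hc : Corresponds x j u n) (hx : Good x) (hy : Good y)
    (hag : Agree u x y) : Corresponds y j u n ∧ (∀ s, reflection y s j = reflection x s j) ∧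
      ∀ s, Agree n (coupledPath x s) (coupledPath y s) := by
  obtain ⟨h1, h2, h3⟩ := hc
  obtain ⟨d1, d2, d3⟩ := hag.excursion_data_eq hx hy h1
  have e0 := hag.startTime_eq hx hy h1
  have es : side y j = side x j := (hag.side_eq (by omega) j).symm
  obtain ⟨a1, a2, a3, -⟩ := hx.lastKept_spec j
  obtain ⟨b1, b2, b3, b4, b5⟩ := hy.lastKept_spec j
  have hle : u ≤ lastKept y j := by
    -- If the kept part of `y` ended before `u`, then either a depth beyond the side, or the end of
    -- the whole excursion, would be visible before or at time `u` and hence shared by `x`.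
    by_contra! hlt
    by_cases ht : IsTruncated y j
    · obtain ⟨-, -, b8⟩ := b4 ht
      rw [hag.depth_eq hx hy h1 (by omega), d1, es] at b8
      have := a3 (lastKept y j + 1) (by omega) (by omega)
      omega
    · rw [b5 ht] at hlt
      have := hag.symm.startTime_eq hy hx hlt
      omega
  refine ⟨⟨by omega, hle, by rw [d2, e0]; exact h3⟩, d3, fun s m => ?_⟩
  induction m with
  | zero => intro _; rw [coupledPath_zero, coupledPath_zero]
  | succ m ih =>
    intro hm
    obtain ⟨k, k1, k2⟩ := hx.exists_clock_le m
    have hkj : k ≤ j := by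
      by_contra! hlt
      have h5 : clock x (j + 1) ≤ clock x k := hx.strictMono_clock.monotone hlt
      rw [clock_succ] at h5
      omega
    set v := startTime x k + (m - clock x k) with hv
    have hclock : clock x (k + 1) = clock x k + (lastKept x k - startTime x k) := clock_succ x k
    have hvk : v < lastKept x k := by
      have := (hx.lastKept_spec k).1
      omega
    have hm' : m = clock x k + (v - startTime x k) := by omega
    have hku : startTime x k < u := (hx.strictMono_startTime.monotone hkj).trans_lt h1
    obtain ⟨f1, f2, f3⟩ := hag.excursion_data_eq hx hy hku
    have g0 := hag.startTime_eq hx hy hku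
    have hvu : v < u ∧ v < lastKept y k := by
      rcases hkj.eq_or_lt with rfl | hlt
      · omega
      · have h5 : startTime x (k + 1) ≤ startTime x j := hx.strictMono_startTime.monotone hlt
        have h6 := (hx.lastKept_spec k).2.1
        rw [hag.lastKept_eq hx hy (h5.trans_lt h1) f1]
        omega
    obtain ⟨p1, p2⟩ := hx.source_eq (j := k) (v := v) (by omega) hvk
    obtain ⟨q1, q2⟩ := hy.source_eq (j := k) (v := v) (by omega) hvu.2
    rw [f2, g0] at q1 q2
    rw [← hm'] at p1 p2 q1 q2
    funext i
    rw [coupledPath_succ, coupledPath_succ, ih (by omega), p1, p2, q1, q2, f3,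
      hag _ (show v + 1 ≤ u by omega), hag v (by omega)]

/-! ### The coupled walk is prudent -/

variable {Ω : Type*} [MeasurableSpace Ω] {μ : Measure Ω} {X : ℕ → Ω → Site}

/-- One-step transition probabilities of the coupled path, for given initial signs. -/
theorem measure_coupledPath_step [IsProbabilityMeasure μ] (hX : IsCornerWalk μ X)
    (s : Fin 2 → ℤˣ) (n : ℕ) (w : ℕ → Site) :
    μ {ω | ∀ m ≤ n + 2, coupledPath (trajectory X ω) s m = w m} =
      (if w (n + 2) - w (n + 1) ∈ allowedDirections ∅ w (n + 1)
        then ((allowedDirections ∅ w (n + 1)).card : ℝ≥0∞)⁻¹ else 0) *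
      μ {ω | ∀ m ≤ n + 1, coupledPath (trajectory X ω) s m = w m} := by
  have hR : Measurable fun ω => (excursionIndex (trajectory X ω) n,
      sourceTime (trajectory X ω) n + 1) :=
    ((measurable_excursionIndex n).prodMk ((measurable_sourceTime n).add measurable_const)).comp
      (measurable_trajectory hX.measurable)
  rw [measure_eq_tsum_fiber hR,
    measure_eq_tsum_fiber hR {ω | ∀ m ≤ n + 1, coupledPath (trajectory X ω) s m = w m},
    ← ENNReal.tsum_mul_left]
  refine tsum_congr fun p => ?_
  obtain ⟨j, u⟩ := p
  have hgood := ae_good hX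
  -- On each fibre of excursion index and source time, a prescribed step of the coupled path is a
  -- prescribed reflected step of the corner path at the fixed time `u`. Locality holds among good
  -- paths only, whence `G`.
  have key := hX.measure_step u (G := {x | Good x})
    (A := {x | Corresponds x j u (n + 1) ∧ ∀ m ≤ n + 1, coupledPath x s m = w m})
    (φ := fun x => reflect (reflection x s j) (w (n + 2) - w (n + 1)))
    (q := if w (n + 2) - w (n + 1) ∈ allowedDirections ∅ w (n + 1)
        then ((allowedDirections ∅ w (n + 1)).card : ℝ≥0∞)⁻¹ else 0) hgood ?_ ?_ ?_
  · have e1 : μ ((fun ω => (excursionIndex (trajectory X ω) n,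
        sourceTime (trajectory X ω) n + 1)) ⁻¹' {(j, u)} ∩
          {ω | ∀ m ≤ n + 1, coupledPath (trajectory X ω) s m = w m}) =
        μ {ω | trajectory X ω ∈ {x | Corresponds x j u (n + 1) ∧
          ∀ m ≤ n + 1, coupledPath x s m = w m}} := by
      refine measure_congr ?_
      filter_upwards [hgood] with ω hω
      refine propext (and_congr_left fun _ => ?_)
      rw [hω.corresponds_iff]
      exact Prod.mk_inj
    have e2 : μ ((fun ω => (excursionIndex (trajectory X ω) n,
        sourceTime (trajectory X ω) n + 1)) ⁻¹' {(j, u)} ∩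
          {ω | ∀ m ≤ n + 2, coupledPath (trajectory X ω) s m = w m}) =
        μ {ω | trajectory X ω ∈ {x | Corresponds x j u (n + 1) ∧
            ∀ m ≤ n + 1, coupledPath x s m = w m} ∧ X (u + 1) ω - X u ω =
              reflect (reflection (trajectory X ω) s j) (w (n + 2) - w (n + 1))} := by
      refine measure_congr ?_
      filter_upwards [hgood] with ω hω
      have hiff : (excursionIndex (trajectory X ω) n = j ∧ sourceTime (trajectory X ω) n + 1 = u) ↔
        _ := hω.corresponds_iff.symm
      have hnext : ∀ hc : Corresponds (trajectory X ω) j u (n + 1),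
          coupledPath (trajectory X ω) s (n + 2) - coupledPath (trajectory X ω) s (n + 1) =
            reflect (reflection (trajectory X ω) s j) (X (u + 1) ω - X u ω) := by
        intro hc
        have := hω.coupledPath_next s hc.lt hc.le
        rwa [← hc.eq] at this
      refine propext ⟨fun hh => ?_, fun hh => ?_⟩
      · have hc := hiff.1 (Prod.mk_inj.1 hh.1)
        refine ⟨⟨hc, fun m hm => hh.2 m (by omega)⟩, ?_⟩
        rw [← hh.2 (n + 2) le_rfl, ← hh.2 (n + 1) (by omega), hnext hc, reflect_reflect]
      · obtain ⟨⟨hc, hw⟩, hstep⟩ := hh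
        refine ⟨Prod.mk_inj.2 (hiff.2 hc), fun m hm => ?_⟩
        rcases Nat.lt_or_ge (n + 1) m with h1 | h1
        · obtain rfl : m = n + 2 := by omega
          have := hnext hc
          rw [hstep, reflect_reflect, hw (n + 1) le_rfl, sub_left_inj] at this
          exact this
        · exact hw m h1
    rw [e1, e2, key]
  · rintro x ⟨hc, hw⟩ hx y hy hag
    obtain ⟨c1, -, c3⟩ := hc.agree hx hy hag
    exact ⟨c1, fun m hm => by rw [← c3 s m hm, hw m hm]⟩
  · rintro x ⟨hc, hw⟩ hx y hy hag
    simp only [(hc.agree hx hy hag).2.1]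
  · rintro x ⟨hc, hw⟩ (hx : Good x)
    have hag : Agree (n + 1) (coupledPath x s) w := hw
    have hmem := hx.mem_allowed_coupledPath_iff s hc.lt hc.le (e := w (n + 2) - w (n + 1))
    have hcard := hx.card_allowed_coupledPath s hc.lt hc.le
    rw [← hc.eq, hag.allowedDirections_eq] at hmem hcard
    rw [hcard]
    by_cases hm : w (n + 2) - w (n + 1) ∈ allowedDirections ∅ w (n + 1)
    · rw [if_pos hm, if_pos (hmem.1 hm)]
    · rw [if_neg hm, if_neg (mt hmem.2 hm)]

/-! ### The first step and the average over the signs -/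

theorem Good.coupledPath_one (h : Good x) (s : Fin 2 → ℤˣ) : coupledPath x s 1 = reflect s (x 1) := by
  funext k
  have := h.coupledPath_step (s := s) (j := 0) le_rfl (h.lastKept_spec 0).1 k
  change coupledPath x s 1 k = coupledPath x s 0 k + (s k : ℤ) * (x 1 k - x 0 k) at this
  rw [this, coupledPath_zero, (h.valid 0).1]
  simp [reflect]

theorem allowedDirections_empty_zero (w : ℕ → Site) : allowedDirections ∅ w 0 = directions := by
  ext e
  rw [mem_allowedDirections]
  refine and_iff_left_of_imp fun he k hk => ?_
  rintro (h | ⟨m, hm, h⟩)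
  · exact h
  · obtain rfl : m = 0 := by simpa using hm
    have h0 : ∀ i, e i = 0 := by
      intro i
      have := congrFun h i
      rw [add_nsmul_coord] at this
      have h1 : (k : ℤ) * e i = 0 := by linarith
      rcases mul_eq_zero.1 h1 with h2 | h2
      · omega
      · exact h2
    rw [mem_directions_iff 0] at he
    have := h0 0
    have := h0 (0 + 1)
    omega

theorem allowedDirections_southWest_zero (h0 : x 0 = 0) :
    allowedDirections southWest x 0 = {siteOf 0 1 0, siteOf 0 0 1} := by
  ext e
  rw [Finset.mem_insert, Finset.mem_singleton]
  constructor
  · intro he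
    -- An auxiliary path that makes the step `e` reduces the claim to the known cases of the first
    -- step.
    obtain ⟨h1, h2⟩ := first_step_cases (x := fun n => if n = 0 then 0 else e) rfl (by
      have hag : Agree 0 (fun n => if n = 0 then 0 else e) x := fun m hm => by
        obtain rfl : m = 0 := by omega
        simp [h0]
      rw [hag.allowedDirections_eq]
      simpa using he)
    simp only [one_ne_zero, if_false] at h1 h2
    generalize side (fun n => if n = 0 then 0 else e) 0 = i at h1 h2
    fin_cases i
    · exact Or.inr (eq_siteOf h1 h2)
    · exact Or.inl (eq_siteOf h2 h1)
  · intro he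
    have hF := fills_southWest h0
    rw [mem_allowedDirections, mem_directions_iff 0]
    refine ⟨by rcases he with rfl | rfl <;> simp only [siteOf_self, siteOf_other] <;> norm_num,
      fun k hk hmem => ?_⟩
    have h1 := hF.mem _ hmem 0
    have h2 := hF.mem _ hmem (0 + 1)
    rw [add_nsmul_coord, h0, Set.mem_Iic] at h1 h2
    rcases he with rfl | rfl
    · rw [siteOf_self] at h1
      simp at h1
      omega
    · rw [siteOf_other] at h2
      simp at h2
      omega

theorem measure_first_step (hX : IsCornerWalk μ X) [IsProbabilityMeasure μ] (e : Site) :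
    μ {ω | X 1 ω = e} =
      if e ∈ ({siteOf 0 1 0, siteOf 0 0 1} : Finset Site) then (2 : ℝ≥0∞)⁻¹ else 0 := by
  have hcard : ({siteOf 0 1 0, siteOf 0 0 1} : Finset Site).card = 2 := by
    rw [Finset.card_pair]
    rw [Ne, siteOf_inj]
    omega
  have key := hX.measure_step 0 (G := {x | x 0 = 0}) (A := Set.univ) (φ := fun _ => e)
    (q := if e ∈ ({siteOf 0 1 0, siteOf 0 0 1} : Finset Site) then (2 : ℝ≥0∞)⁻¹ else 0)
    hX.start (fun _ _ _ _ _ _ => Set.mem_univ _) (fun _ _ _ _ _ _ => rfl) (fun x _ hx => by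
      rw [allowedDirections_southWest_zero hx, hcard]; norm_num)
  have hone : μ {ω | trajectory X ω ∈ Set.univ} = 1 := by
    simp
  rw [hone, mul_one] at key
  rw [← key]
  refine measure_congr ?_
  filter_upwards [hX.start] with ω hω
  refine propext ?_
  change X 1 ω = e ↔ True ∧ X (0 + 1) ω - X 0 ω = e
  rw [hω, sub_zero, true_and]

/-- Two of the four sign pairs bring `e` into the first quadrant, so its probability is `2 * (1/4) *
(1/2) = 1/4`. -/
theorem card_reflect_mem {e : Site} (he : e ∈ directions) :
    (Finset.univ.filter fun s : Fin 2 → ℤˣ =>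
      reflect s e ∈ ({siteOf 0 1 0, siteOf 0 0 1} : Finset Site)).card = 2 := by
  simp only [directions, Finset.mem_insert, Finset.mem_singleton] at he
  rcases he with rfl | rfl | rfl | rfl <;> decide

theorem reflect_mem_directions {r : Fin 2 → ℤˣ} {e : Site} :
    reflect r e ∈ directions ↔ e ∈ directions := by
  rw [mem_directions_iff 0, mem_directions_iff 0]
  unfold reflect
  rcases units_cases (r 0) with h0 | h0 <;> rcases units_cases (r (0 + 1)) with h1 | h1 <;>
    rw [h0, h1] <;> omega

/-- Disintegration with respect to independent uniform signs. -/
theorem measure_eq_sum_signs {σ : Ω → Fin 2 → ℤˣ} (hσ : Measurable σ)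
    (hσ_unif : ∀ s : Fin 2 → ℤˣ, μ {ω | σ ω = s} = 1 / 4)
    (hσ_indep : IndepFun σ (trajectory X) μ) {E : (Fin 2 → ℤˣ) → Set (ℕ → Site)}
    (hE : ∀ s, MeasurableSet (E s)) :
    μ {ω | trajectory X ω ∈ E (σ ω)} = ∑ s, 1 / 4 * μ {ω | trajectory X ω ∈ E s} := by
  rw [measure_eq_tsum_fiber hσ, tsum_fintype]
  refine Finset.sum_congr rfl fun s _ => ?_
  rw [← hσ_unif s]
  have := hσ_indep.measure_inter_preimage_eq_mul {s} (E s) (measurableSet_singleton s) (hE s)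
  refine Eq.trans ?_ this
  congr 1
  ext ω
  simp only [Set.mem_inter_iff, Set.mem_preimage, Set.mem_singleton_iff, Set.mem_ofPred_eq]
  refine and_congr_right fun h => ?_
  rw [h]

theorem isPrudentWalk_coupledWalk [IsProbabilityMeasure μ] (hX : IsCornerWalk μ X)
    {σ : Ω → Fin 2 → ℤˣ} (hσ : Measurable σ)
    (hσ_unif : ∀ s : Fin 2 → ℤˣ, μ {ω | σ ω = s} = 1 / 4)
    (hσ_indep : IndepFun σ (trajectory X) μ) : IsPrudentWalk μ (coupledWalk X σ) := by
  have hmeas : ∀ (w : ℕ → Site) (n : ℕ) (s : Fin 2 → ℤˣ),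
      MeasurableSet {x | ∀ m ≤ n, coupledPath x s m = w m} := by
    intro w n s
    have : {x | ∀ m ≤ n, coupledPath x s m = w m} =
        ⋂ m ∈ Finset.range (n + 1), {x | coupledPath x s m = w m} := by
      ext x; simp
    rw [this]
    exact Finset.measurableSet_biInter _ fun m _ =>
      measurableSet_eq_fun (measurable_coupledPath s m) measurable_const
  have hdis : ∀ (w : ℕ → Site) (n : ℕ), μ {ω | ∀ m ≤ n, coupledWalk X σ m ω = w m} =
      ∑ s, 1 / 4 * μ {ω | ∀ m ≤ n, coupledPath (trajectory X ω) s m = w m} := fun w n =>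
    measure_eq_sum_signs hσ hσ_unif hσ_indep (hmeas w n)
  refine ⟨measurable_coupledWalk hX.measurable hσ,
    ae_of_all _ fun ω => coupledPath_zero _ _, fun t w => ?_⟩
  rcases t with _ | n
  · rw [hdis w 0, hdis w (0 + 1), allowedDirections_empty_zero]
    by_cases h0 : w 0 = 0
    swap
    · have hz : ∀ n s, μ {ω | ∀ m ≤ n, coupledPath (trajectory X ω) s m = w m} = 0 := by
        intro n s
        have : {ω | ∀ m ≤ n, coupledPath (trajectory X ω) s m = w m} = ∅ := by
          refine Set.eq_empty_iff_forall_notMem.2 fun ω hω => h0 ?_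
          rw [← hω 0 (Nat.zero_le n), coupledPath_zero]
        rw [this, measure_empty]
      simp only [hz, mul_zero, Finset.sum_const_zero]
    · have hone : ∀ s, μ {ω | ∀ m ≤ 0, coupledPath (trajectory X ω) s m = w m} = 1 := by
        intro s
        have : {ω | ∀ m ≤ 0, coupledPath (trajectory X ω) s m = w m} = Set.univ := by
          refine Set.eq_univ_of_forall fun ω m hm => ?_
          obtain rfl : m = 0 := by omega
          rw [coupledPath_zero, h0]
        rw [this, measure_univ]
      have hstep : ∀ s, μ {ω | ∀ m ≤ 0 + 1, coupledPath (trajectory X ω) s m = w m} =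
          if reflect s (w 1) ∈ ({siteOf 0 1 0, siteOf 0 0 1} : Finset Site)
            then (2 : ℝ≥0∞)⁻¹ else 0 := by
        intro s
        rw [← measure_first_step hX]
        refine measure_congr ?_
        filter_upwards [ae_good hX] with ω hω
        refine propext ⟨fun hh => ?_, fun hh m hm => ?_⟩
        · have := hh 1 le_rfl
          rw [hω.coupledPath_one] at this
          change X 1 ω = _
          rw [← this, reflect_reflect]
          rfl
        · rcases Nat.eq_zero_or_pos m with rfl | hpos
          · rw [coupledPath_zero, h0]
          · obtain rfl : m = 1 := by omega
            rw [hω.coupledPath_one, show trajectory X ω 1 = _ from hh, reflect_reflect]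
      have hcard : (directions.card : ℝ≥0∞) = 4 := by
        have : directions.card = 4 := by unfold directions unitVec; decide
        rw [this]; norm_num
      simp only [hone, hstep, h0, sub_zero, zero_add, hcard, mul_one]
      rw [← Finset.mul_sum, ← Finset.sum_filter, Finset.sum_const, Finset.sum_const,
        Finset.card_univ, show Fintype.card (Fin 2 → ℤˣ) = 4 by decide]
      have h4 : (4 • (1 / 4) : ℝ≥0∞) = 1 := by
        rw [nsmul_eq_mul, one_div]
        exact ENNReal.mul_inv_cancel (by norm_num) (by norm_num)
      rw [h4, mul_one]
      split_ifs with he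
      · rw [card_reflect_mem he, nsmul_eq_mul, Nat.cast_ofNat,
          ENNReal.mul_inv_cancel (by norm_num) (by norm_num), mul_one, one_div]
      · rw [Finset.filter_false_of_mem, Finset.card_empty, zero_smul, mul_zero]
        intro s _ hs
        refine he ((reflect_mem_directions (r := s)).1 ?_)
        rw [mem_directions_iff 0]
        rw [Finset.mem_insert, Finset.mem_singleton] at hs
        rcases hs with hs | hs <;> rw [hs] <;> simp only [siteOf_self, siteOf_other] <;> norm_num
  · rw [hdis, hdis, Finset.mul_sum]
    refine Finset.sum_congr rfl fun s _ => ?_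
    rw [measure_coupledPath_step hX, mul_left_comm]

end PrudentWalk

namespace PrudentWalk

/-! ### The final orientation of the coupled path -/

variable {x : ℕ → Site} {s : Fin 2 → ℤˣ}

/-- Truncations depend only on the corner path, so the initial signs act by multiplication. -/
theorem reflection_eq_mul (x : ℕ → Site) (s : Fin 2 → ℤˣ) (j : ℕ) :
    reflection x s j = s * reflection x 1 j := by
  induction j with
  | zero => simp [reflection]
  | succ j ih =>
    by_cases ht : IsTruncated x j
    · rw [reflection, reflection, if_pos ht, if_pos ht, ih]
      funext k
      rcases eq_or_ne k (side x j) with rfl | hk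
      · simp
      · simp [Function.update_of_ne hk]
    · rw [reflection, reflection, if_neg ht, if_neg ht, ih]

/-- The paths for which the reflections eventually disappear, for initial signs `s`. -/
def finallyUpright (s : Fin 2 → ℤˣ) : Set (ℕ → Site) :=
  {x | ∃ j₀, ∀ j ≥ j₀, reflection x s j = 1}

theorem measurableSet_finallyUpright (s : Fin 2 → ℤˣ) : MeasurableSet (finallyUpright s) := by
  have : finallyUpright s = ⋃ j₀ : ℕ, ⋂ j ∈ Set.Ici j₀, ⋂ k,
      {x | (reflection x s j k : ℤ) = 1} := by
    ext x
    simp only [finallyUpright, Set.mem_ofPred_eq, Set.mem_iUnion, Set.mem_iInter, Set.mem_Ici]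
    refine exists_congr fun j₀ => forall₂_congr fun j _ => ?_
    rw [funext_iff]
    exact forall_congr' fun k => by rw [Pi.one_apply, Units.val_eq_one]
  rw [this]
  refine MeasurableSet.iUnion fun j₀ => MeasurableSet.biInter (Set.to_countable _) fun j _ =>
    MeasurableSet.iInter fun k => ?_
  exact measurableSet_eq_fun (measurable_reflection s j k) measurable_const

theorem eventually_reflection_eq {j₀ : ℕ} (hj₀ : ∀ j ≥ j₀, ¬ IsTruncated x j) (s : Fin 2 → ℤˣ) :
    ∀ j ≥ j₀, reflection x s j = reflection x s j₀ := by
  intro j hj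
  induction j, hj using Nat.le_induction with
  | base => rfl
  | succ j hj ih => rw [reflection_succ_of_not_truncated s (hj₀ j hj), ih]

theorem mem_finallyUpright_iff {j₀ : ℕ} (hj₀ : ∀ j ≥ j₀, ¬ IsTruncated x j) :
    x ∈ finallyUpright s ↔ reflection x s j₀ = 1 := by
  constructor
  · rintro ⟨j₁, hj₁⟩
    rw [← eventually_reflection_eq hj₀ s _ (le_max_left j₀ j₁), hj₁ _ (le_max_right j₀ j₁)]
  · intro h
    exact ⟨j₀, fun j hj => by rw [eventually_reflection_eq hj₀ s j hj, h]⟩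

theorem Tame.exists_not_truncated (ht : Tame x) (h : Good x) :
    ∃ j₀, ∀ j ≥ j₀, ¬ IsTruncated x j := by
  obtain ⟨b, hb⟩ := (ht.finite_truncated h).bddAbove
  refine ⟨b + 1, fun j hj hjt => ?_⟩
  have : j ≤ b := hb hjt
  omega

/-- After the last truncation, the coupled path is a reflected copy of the corner path, up to a
translation in space and time. -/
theorem Good.exists_shift (h : Good x) {j₀ : ℕ} (hj₀ : ∀ j ≥ j₀, ¬ IsTruncated x j)
    (s : Fin 2 → ℤˣ) : ∃ (n₀ c : ℕ) (a : Site), ∀ n ≥ n₀, ∀ k,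
      coupledPath x s n k = a k + (reflection x s j₀ k : ℤ) * x (n + c) k := by
  have hle : ∀ j, clock x j ≤ startTime x j := by
    intro j
    induction j with
    | zero => exact le_rfl
    | succ j ih =>
      have h1 := (h.lastKept_spec j).1
      have h2 := (h.lastKept_spec j).2.1
      rw [clock_succ]; omega
  -- The number of steps discarded before excursion `j₀`; it is constant afterwards.
  set c := startTime x j₀ - clock x j₀ with hc
  have hshift : ∀ j ≥ j₀, startTime x j = clock x j + c := by
    intro j hj
    induction j, hj using Nat.le_induction with
    | base => have := hle j₀; omega
    | succ j hj ih =>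
      have h1 := h.startTime_lt j
      rw [clock_succ, (h.lastKept_spec j).2.2.2.2 (hj₀ j hj)]; omega
  refine ⟨clock x j₀, c, fun k => coupledPath x s (clock x j₀) k -
    (reflection x s j₀ k : ℤ) * x (clock x j₀ + c) k, fun n hn k => ?_⟩
  induction n, hn using Nat.le_induction with
  | base => ring
  | succ n hn ih =>
    obtain ⟨j, h1, h2⟩ := h.exists_clock_le n
    have hj : j₀ ≤ j := by
      by_contra! hlt
      have := h.strictMono_clock.monotone (show j + 1 ≤ j₀ by omega)
      omega
    have hs : sourceTime x n = n + c := by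
      unfold sourceTime
      rw [h.excursionIndex_eq h1 h2, hshift j hj]; omega
    rw [coupledPath_succ, ih, hs, h.excursionIndex_eq h1 h2, eventually_reflection_eq hj₀ s j hj,
      show n + 1 + c = n + c + 1 by ring]
    ring

/-- Both coordinates of the corner path tend to infinity and the coupled path is eventually a
translate of its reflection, so a coordinate is finally nonnegative exactly when its final sign is
`1`. -/
theorem Tame.settles_iff (ht : Tame x) (h : Good x) (s : Fin 2 → ℤˣ) :
    (∃ t₀ : ℕ, ∀ t ≥ t₀, ∀ i, 0 ≤ coupledPath x s t i) ↔ x ∈ finallyUpright s := by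
  obtain ⟨j₀, hj₀⟩ := ht.exists_not_truncated h
  obtain ⟨n₀, c, a, hshift⟩ := h.exists_shift hj₀ s
  rw [mem_finallyUpright_iff hj₀]
  have hlarge : ∀ k, ∀ᶠ n in atTop, |a k| + 1 ≤ x (n + c) k := fun k =>
    (tendsto_add_atTop_nat c).eventually (ht.eventually_le h (|a k| + 1) k)
  constructor
  · rintro ⟨t₀, ht₀⟩
    funext k
    obtain ⟨n, hn1, hn2, hn3⟩ := ((hlarge k).and ((eventually_ge_atTop t₀).and
      (eventually_ge_atTop n₀))).exists
    have h1 := ht₀ n hn2 k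
    rw [hshift n hn3] at h1
    rcases Int.units_eq_one_or (reflection x s j₀ k) with h2 | h2
    · exact h2
    · rw [h2, Units.val_neg, Units.val_one] at h1
      have := le_abs_self (a k)
      omega
  · intro hr
    obtain ⟨t₀, ht₀⟩ := eventually_atTop.1 ((eventually_all.2 hlarge).and (eventually_ge_atTop n₀))
    refine ⟨t₀, fun t ht i => ?_⟩
    obtain ⟨h1, h2⟩ := ht₀ t ht
    have h1 := h1 i
    rw [hshift t h2, hr, Pi.one_apply, Units.val_one, one_mul]
    have := neg_abs_le (a i)
    omega

theorem Good.abs_step_le (h : Good x) (n : ℕ) (k : Fin 2) : |x (n + 1) k - x n k| ≤ 1 := by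
  have hd := directions_finite_allowed ((h.valid (n + 1)).2 n (Nat.lt_succ_self n))
  rw [mem_directions_iff k] at hd
  simp only [Pi.sub_apply] at hd
  rw [abs_le]
  omega

theorem Good.abs_sub_le (h : Good x) (n c : ℕ) (k : Fin 2) : |x (n + c) k - x n k| ≤ c := by
  induction c with
  | zero => simp
  | succ c ih =>
    have := h.abs_step_le (n + c) k
    rw [abs_le] at *
    rw [← add_assoc]
    push_cast
    omega

theorem norm_toPlane_sub_le (p q : Site) :
    ‖toPlane p - toPlane q‖ ≤ |((p 0 - q 0 : ℤ) : ℝ)| + |((p 1 - q 1 : ℤ) : ℝ)| := by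
  rw [EuclideanSpace.norm_eq, Fin.sum_univ_two]
  refine Real.sqrt_le_iff.2 ⟨by positivity, ?_⟩
  have e : ∀ k, (toPlane p - toPlane q) k = ((p k - q k : ℤ) : ℝ) := by
    intro k
    simp [toPlane]
  rw [e, e, Real.norm_eq_abs, Real.norm_eq_abs]
  nlinarith [mul_nonneg (abs_nonneg ((p 0 - q 0 : ℤ) : ℝ)) (abs_nonneg ((p 1 - q 1 : ℤ) : ℝ))]

/-- If the final orientation is upright, the coupled path stays close to the corner path. -/
theorem Tame.exists_bound (ht : Tame x) (h : Good x) (hs : x ∈ finallyUpright s) :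
    ∃ C : ℝ, ∀ t, ‖toPlane (x t) - toPlane (coupledPath x s t)‖ ≤ C := by
  obtain ⟨j₀, hj₀⟩ := ht.exists_not_truncated h
  obtain ⟨n₀, c, a, hshift⟩ := h.exists_shift hj₀ s
  rw [mem_finallyUpright_iff hj₀] at hs
  have hev : ∀ᶠ t in atTop, ‖toPlane (x t) - toPlane (coupledPath x s t)‖ ≤
      ((|a 0| + c : ℤ) : ℝ) + ((|a 1| + c : ℤ) : ℝ) := by
    filter_upwards [eventually_ge_atTop n₀] with t htn
    refine (norm_toPlane_sub_le _ _).trans ?_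
    have hk : ∀ k, |((x t k - coupledPath x s t k : ℤ) : ℝ)| ≤ ((|a k| + c : ℤ) : ℝ) := by
      intro k
      rw [← Int.cast_abs]
      refine Int.cast_le.2 ?_
      rw [hshift t htn, hs, Pi.one_apply, Units.val_one, one_mul]
      have h1 := h.abs_sub_le t c k
      have h2 := neg_abs_le (a k)
      have h3 := le_abs_self (a k)
      rw [abs_le] at h1 ⊢
      omega
    exact add_le_add (hk 0) (hk 1)
  have hb : IsBoundedUnder (· ≤ ·) atTop
      fun t => ‖toPlane (x t) - toPlane (coupledPath x s t)‖ := ⟨_, hev⟩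
  obtain ⟨C, hC⟩ := hb.bddAbove_range
  exact ⟨C, fun t => hC ⟨t, rfl⟩⟩

/-! ### The event of settling in the first quadrant -/

variable {Ω : Type*} [MeasurableSpace Ω] {μ : Measure Ω} {X : ℕ → Ω → Site}

theorem measurableSet_settlesFirstQuadrant (hX : ∀ t, Measurable (X t)) :
    MeasurableSet (settlesFirstQuadrant X) := by
  have : settlesFirstQuadrant X = ⋃ t₀ : ℕ, ⋂ t ∈ Set.Ici t₀, ⋂ i, {ω | 0 ≤ X t ω i} := by
    ext ω
    simp [settlesFirstQuadrant]
  rw [this]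
  refine MeasurableSet.iUnion fun t₀ => MeasurableSet.biInter (Set.to_countable _) fun t _ =>
    MeasurableSet.iInter fun i => ?_
  exact measurableSet_le measurable_const ((measurable_pi_apply i).comp (hX t))

/-- For almost every path exactly one sign pair works, namely the inverse of the final reflection
obtained from trivial initial signs. -/
theorem sum_measure_finallyUpright [IsProbabilityMeasure μ] (hX : IsCornerWalk μ X) :
    ∑ s : Fin 2 → ℤˣ, μ {ω | trajectory X ω ∈ finallyUpright s} = 1 := by
  have hmeas : ∀ s, MeasurableSet {ω | trajectory X ω ∈ finallyUpright s} := fun s =>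
    measurable_trajectory hX.measurable (measurableSet_finallyUpright s)
  rw [← measure_biUnion_finset _ fun s _ => hmeas s, ← measure_univ (μ := μ)]
  · refine measure_congr ?_
    filter_upwards [ae_good hX, ae_tame hX] with ω hg ht
    refine propext (iff_of_true ?_ trivial)
    obtain ⟨j₀, hj₀⟩ := ht.exists_not_truncated hg
    refine Set.mem_biUnion (Finset.mem_coe.2 (Finset.mem_univ
      ((reflection (trajectory X ω) 1 j₀)⁻¹))) ?_
    rw [Set.mem_ofPred_eq, mem_finallyUpright_iff hj₀, reflection_eq_mul, inv_mul_cancel]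
  · intro s _ s' _ hne
    refine Set.disjoint_left.2 ?_
    rintro ω ⟨j₁, h1⟩ ⟨j₂, h2⟩
    have e1 := h1 _ (le_max_left j₁ j₂)
    have e2 := h2 _ (le_max_right j₁ j₂)
    rw [reflection_eq_mul] at e1 e2
    exact hne (mul_right_cancel (e1.trans e2.symm))

theorem ae_settles_iff [IsProbabilityMeasure μ] (hX : IsCornerWalk μ X) (σ : Ω → Fin 2 → ℤˣ) :
    ∀ᵐ ω ∂μ, ω ∈ settlesFirstQuadrant (coupledWalk X σ) ↔
      trajectory X ω ∈ finallyUpright (σ ω) := by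
  filter_upwards [ae_good hX, ae_tame hX] with ω hg ht
  exact ht.settles_iff hg (σ ω)

theorem measure_settlesFirstQuadrant [IsProbabilityMeasure μ] (hX : IsCornerWalk μ X)
    {σ : Ω → Fin 2 → ℤˣ} (hσ : Measurable σ)
    (hσ_unif : ∀ s : Fin 2 → ℤˣ, μ {ω | σ ω = s} = 1 / 4)
    (hσ_indep : IndepFun σ (trajectory X) μ) :
    μ (settlesFirstQuadrant (coupledWalk X σ)) = 1 / 4 := by
  have : μ (settlesFirstQuadrant (coupledWalk X σ)) =
      μ {ω | trajectory X ω ∈ finallyUpright (σ ω)} := by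
    refine measure_congr ?_
    filter_upwards [ae_settles_iff hX σ] with ω hω
    exact propext hω
  rw [this, measure_eq_sum_signs hσ hσ_unif hσ_indep measurableSet_finallyUpright,
    ← Finset.mul_sum, sum_measure_finallyUpright hX, mul_one]

theorem ae_bounded_of_settles [IsProbabilityMeasure μ] (hX : IsCornerWalk μ X)
    (σ : Ω → Fin 2 → ℤˣ) :
    ∀ᵐ ω ∂μ, ω ∈ settlesFirstQuadrant (coupledWalk X σ) →
      ∃ C : ℝ, ∀ t : ℕ, ‖toPlane (X t ω) - toPlane (coupledWalk X σ t ω)‖ ≤ C := by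
  filter_upwards [ae_good hX, ae_tame hX, ae_settles_iff hX σ] with ω hg ht hiff hω
  exact ht.exists_bound hg (hiff.1 hω)

/-! ### From bounded distance to convergence in conditional probability -/

/-- Almost sure decay on `Q` implies decay in probability given `Q`. -/
theorem tendsto_cond_of_le_div [IsProbabilityMeasure μ] {f : ℕ → Ω → ℝ}
    (hf : ∀ t, Measurable (f t)) (hf0 : ∀ t ω, 0 ≤ f t ω) {Q : Set Ω} (hQ : MeasurableSet Q)
    (hb : ∀ᵐ ω ∂μ, ω ∈ Q → ∃ C : ℝ, ∀ t : ℕ, f t ω ≤ C / t) {ε : ℝ} (hε : 0 < ε) :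
    Tendsto (fun t : ℕ => (μ[| Q]) {ω | ε ≤ f t ω}) atTop (𝓝 0) := by
  have hac : μ[| Q] ≪ μ := cond_absolutelyContinuous
  have hae : ∀ᵐ ω ∂μ[| Q], Tendsto (fun t => f t ω) atTop (𝓝 0) := by
    filter_upwards [hac.ae_le hb, ae_cond_mem hQ] with ω h1 h2
    obtain ⟨C, hC⟩ := h1 h2
    exact squeeze_zero (fun t => hf0 t ω) hC (tendsto_const_div_atTop_nhds_zero_nat C)
  have := tendstoInMeasure_of_tendsto_ae (fun t => (hf t).aestronglyMeasurable) hae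
  rw [tendstoInMeasure_iff_norm] at this
  refine (this ε hε).congr fun t => ?_
  simp only [sub_zero, Real.norm_of_nonneg (hf0 t _)]

theorem measurable_norm_sub_rescaled {Y : ℕ → Ω → Site} (hX : ∀ t, Measurable (X t))
    (hY : ∀ t, Measurable (Y t)) (c : ℝ) (s : ℕ) :
    Measurable fun ω => ‖c • toPlane (X s ω) - c • toPlane (Y s ω)‖ := by
  have h : Measurable toPlane := by unfold toPlane; fun_prop
  have h1 : Measurable fun ω => toPlane (X s ω) := h.comp (hX s)
  have h2 : Measurable fun ω => toPlane (Y s ω) := h.comp (hY s)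
  fun_prop

/-- Two processes at bounded distance on `Q` are asymptotically close in probability, given `Q`,
after rescaling. -/
theorem tendsto_cond_rescaled [IsProbabilityMeasure μ] {Y : ℕ → Ω → Site}
    (hX : ∀ t, Measurable (X t)) (hY : ∀ t, Measurable (Y t)) {Q : Set Ω} (hQ : MeasurableSet Q)
    (hb : ∀ᵐ ω ∂μ, ω ∈ Q → ∃ C : ℝ, ∀ t : ℕ, ‖toPlane (X t ω) - toPlane (Y t ω)‖ ≤ C)
    {ε : ℝ} (hε : 0 < ε) :
    Tendsto (fun t : ℕ => (μ[| Q]) {ω | ε ≤ ⨆ s : Fin (t + 1),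
        ‖(1 / (t : ℝ)) • toPlane (X s ω) - (1 / (t : ℝ)) • toPlane (Y s ω)‖}) atTop (𝓝 0) := by
  refine tendsto_cond_of_le_div
    (fun t => Measurable.iSup fun s : Fin (t + 1) => measurable_norm_sub_rescaled hX hY _ s)
    (fun t ω => Real.iSup_nonneg fun s => norm_nonneg _) hQ ?_ hε
  filter_upwards [hb] with ω h1 h2
  obtain ⟨C, hC⟩ := h1 h2
  refine ⟨C, fun t => ciSup_le fun s => ?_⟩
  -- At `t = 0` both sides vanish, division by zero being zero, so no restriction on `t` is needed.
  rw [← smul_sub, norm_smul, Real.norm_of_nonneg (by positivity), one_div, inv_mul_eq_div]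
  exact div_le_div_of_nonneg_right (hC s) (Nat.cast_nonneg t)

end PrudentWalk

theorem mainTheorem4 {Ω : Type*} [MeasurableSpace Ω] (μ : Measure Ω) [IsProbabilityMeasure μ]
    (γhat : ℕ → Ω → Site) (hγhat : IsCornerWalk μ γhat)
    (σ : Ω → Fin 2 → ℤˣ) (hσ : Measurable σ)
    (hσ_unif : ∀ s : Fin 2 → ℤˣ, μ {ω | σ ω = s} = 1 / 4)
    (hσ_indep : IndepFun σ (fun ω t => γhat t ω) μ)
    (γ : ℕ → Ω → Site) (hγ : γ = coupledWalk γhat σ) :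
    IsPrudentWalk μ γ ∧
    μ (settlesFirstQuadrant γ) = 1 / 4 ∧
    (∀ ε : ℝ, 0 < ε →
      Tendsto (fun t : ℕ =>
          (μ[| settlesFirstQuadrant γ])
            {ω | ε ≤ ⨆ s : Fin (t + 1),
              ‖(1 / (t : ℝ)) • toPlane (γhat s ω) - (1 / (t : ℝ)) • toPlane (γ s ω)‖})
        atTop (𝓝 0)) ∧
    (∀ᵐ ω ∂μ, {j : ℕ | IsTruncated (fun n => γhat n ω) j}.Finite) ∧
    (∀ᵐ ω ∂μ, ω ∈ settlesFirstQuadrant γ →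
      ∃ C : ℝ, ∀ t : ℕ, ‖toPlane (γhat t ω) - toPlane (γ t ω)‖ ≤ C) := by
  subst hγ
  have hγm := measurable_coupledWalk hγhat.measurable hσ
  refine ⟨isPrudentWalk_coupledWalk hγhat hσ hσ_unif hσ_indep,
    measure_settlesFirstQuadrant hγhat hσ hσ_unif hσ_indep, fun ε hε => ?_, ?_,
    ae_bounded_of_settles hγhat σ⟩
  · exact tendsto_cond_rescaled hγhat.measurable hγm (measurableSet_settlesFirstQuadrant hγm)
      (ae_bounded_of_settles hγhat σ) hε
  · filter_upwards [ae_good hγhat, ae_tame hγhat] with ω hg ht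
    exact ht.finite_truncated hg
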